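/- **Setting.** Let $M$ be a Sasakian sub-Riemannian $3$-manifold: a connected $3$-manifold with an oriented contact distribution $\mathcal H$ carrying a Riemannian metric, with normalized contact form $\eta$ (so $\ker\eta=\mathcal H$ and $d\eta|_{\mathcal H}$ is the area form, where $d\eta(U,V)=\tfrac12\{U(\eta(V))-V(\eta(U))-\eta([U,V])\}$), Reeb field $T$ (so $\eta(T)=1$, $d\eta(T,\cdot)=0$), orientation-preserving $90^\circ$ rotation $J$ of $\mathcal H$ extended by $J(T)=0$, and canonical Riemannian extension $g=\langle\cdot,\cdot\rangle$ of the metric of $\mathcal H$, for which $T$ is unit and orthogonal to $\mathcal H$; Sasakian means that the (local) flow of $T$ acts by $C^\infty$ diffeomorphisms whose differentials are orientation-preserving linear isometries between horizontal planes. A CC-geodesic of curvature $\lambda$ is a $C^2$ horizontal curve parameterized by arc-length with $\dot\gamma'+2\lambda J(\dot\gamma)=0$, where $'$ is the Levi-Civita covariant derivative of $g$ along $\gamma$. For a surface with Riemannian unit normal $N$ and area element $da$, put $N_h=N-\langle N,T\rangle T$, $A=\int|N_h|\,da$ and, where $N_h\ne0$, $\nu_h=N_h/|N_h|$, $Z=J(\nu_h)$,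 $S=\langle N,T\rangle\nu_h-|N_h|T$. Let $I\subseteq\mathbb R$ be a non-degenerate interval, $\Gamma:I\to M$ a $C^3$ horizontal curve parameterized by arc-length, $\lambda\in\mathbb R$ and $\sigma>0$. For $i=1,2$ let $F_i(\varepsilon,s)=\gamma_{i,\varepsilon}(s)$, where $\gamma_{i,\varepsilon}$ is the CC-geodesic of curvature $\lambda$ with $\gamma_{i,\varepsilon}(0)=\Gamma(\varepsilon)$ and $\dot\gamma_{i,\varepsilon}(0)=(-1)^{i-1}J(\dot\Gamma(\varepsilon))$. Suppose that $F_1,F_2$ are well-defined $C^2$ immersions on $I\times[0,\sigma]$ and that $\langle\partial F_i/\partial\varepsilon,T\rangle\neq0$ for $s\in(0,\sigma]$. The immersed surface $\Sigma=E_{\lambda,\sigma}:=F_1(I\times[0,\sigma])\cup F_2(I\times[0,\sigma])$, parameterized by $I\times[-\sigma,\sigma]$ through $(\varepsilon,s)\mapsto F_1(\varepsilon,s)$ if $s\ge0$, $F_2(\varepsilon,-s)$ if $s\le0$, is the $\lambda$-neighborhood of $\Gamma$ of radius $\sigma$; choose its normal $N$ so that $N=T$ along $\Gamma$. **Proposition.**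 Let $\rho\in C^1(\Sigma)$ be such that $Z(\rho)=0$ in $\Sigma-\Gamma$ and $\rho_\Gamma:=\rho\circ\Gamma$ is a $C^2$ function on $I$ with compact support in $I$. Then there is $\sigma'\in(0,\sigma]$ such that, for every $\sigma_0\in(0,\sigma')$ and $E_0:=E_{\lambda,\sigma_0}$, the vertical variation $\varphi_r(p):=\exp_p(r\,\rho(p)\,T_p)$ of $E_0$, where $\exp$ is the Riemannian exponential map of $g$, is well defined, of class $C^1$ in $(r,p)$ and by immersions for $|r|$ small; the area functional $A(r):=A(\varphi_r(E_0))$, computed over any compact set of $E_0$ outside of which $\rho=0$, is differentiable near $r=0$ and twice differentiable at $r=0$; and $$A''(0)=\int_I\rho_\Gamma'(\varepsilon)^2\,d\varepsilon=\int_\Gamma S(\rho)^2\,dl.$$ Here $dl$ is the length element and $S$ along $\Gamma$ is either of the two continuous extensions to $\Gamma$ (which exist) of the restrictions of $S$ to the interiors of the two sides, $s>0$ and $s<0$, of $\Sigma$. -/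

import Mathlib

open Set Filter Topology MeasureTheory
open scoped Manifold ContDiff

noncomputable section

namespace SubRiem

/-- The model space of `3`-manifolds. -/
abbrev E3 := EuclideanSpace ℝ (Fin 3)

section Riemannian

variable {M : Type*} [TopologicalSpace M] [ChartedSpace E3 M] [IsManifold (𝓡 3) ∞ M]

/-- A vector field on `M`. -/
abbrev VField (M : Type*) [TopologicalSpace M] [ChartedSpace E3 M] :=
  (p : M) → TangentSpace (𝓡 3) p

/-- The vector field `U` is of class `C^∞` at the point `p`. -/
def SmoothFieldAt (U : VField M) (p : M) : Prop :=
  ContMDiffAt (𝓡 3) (𝓡 3).tangent ∞ (fun q => (⟨q, U q⟩ : TangentBundle (𝓡 3) M)) p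

/-- `C^∞` Riemannian metrics on `M`. -/
abbrev Metric3 (M : Type*) [TopologicalSpace M] [ChartedSpace E3 M] [IsManifold (𝓡 3) ∞ M] :=
  Bundle.ContMDiffRiemannianMetric (𝓡 3) ∞ E3 (fun p : M => TangentSpace (𝓡 3) p)

/-- The velocity at time `t` of a curve `γ` defined on the set of times `s` (an interval);
at an endpoint of `s` it is the one-sided velocity. -/
def velocity (γ : ℝ → M) (s : Set ℝ) (t : ℝ) : TangentSpace (𝓡 3) (γ t) :=
  mfderivWithin 𝓘(ℝ, ℝ) (𝓡 3) γ s t (1 : ℝ)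

/-- The coefficients of the metric `g` in the preferred chart around `p`: the value of `g` on
the coordinate vectors `u`, `w` at the point with coordinates `y`. -/
def metricInChart (g : Metric3 M) (p : M) (y u w : E3) : ℝ :=
  g.inner ((extChartAt (𝓡 3) p).symm y)
    (mfderiv 𝓘(ℝ, E3) (𝓡 3) (extChartAt (𝓡 3) p).symm y u)
    (mfderiv 𝓘(ℝ, E3) (𝓡 3) (extChartAt (𝓡 3) p).symm y w)

/-- `a` is the covariant derivative at time `t`, for the Levi-Civita connection of `g`, of the
velocity of the `C^2` curve `γ` defined on the interval `s`. In the chart `x` around `γ t` this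
is the identity
`⟨a, w⟩ = ⟨x'', w⟩ + (∂_{x'} g)(x', w) - (1/2) (∂_w g)(x', x')` for all `w`,
i.e. `a^k = x''^k + Γ^k_{ij} x'^i x'^j` with the indices lowered. The tangent space at `γ t` is
identified with `E3` by means of the preferred chart at `γ t`, as everywhere in Mathlib. -/
def IsCovAcceleration (g : Metric3 M) (γ : ℝ → M) (s : Set ℝ) (t : ℝ)
    (a : TangentSpace (𝓡 3) (γ t)) : Prop :=
  let p : M := γ t
  let x : ℝ → E3 := fun τ => extChartAt (𝓡 3) p (γ τ)
  let x₁ : E3 := derivWithin x s t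
  let x₂ : E3 := derivWithin (derivWithin x s) s t
  ∀ w : E3,
    g.inner p a w = g.inner p x₂ w
      + fderiv ℝ (fun y => metricInChart g p y x₁ w) (x t) x₁
      - (1 / 2) * fderiv ℝ (fun y => metricInChart g p y x₁ x₁) (x t) w

/-- `γ` is a Riemannian geodesic of `g` on `[0,1]` with initial point `p` and initial
velocity `v`. -/
def IsGeodesicFrom (g : Metric3 M) (p : M) (v : TangentSpace (𝓡 3) p) (γ : ℝ → M) : Prop :=
  ContMDiffOn 𝓘(ℝ, ℝ) (𝓡 3) 2 γ (Icc 0 1) ∧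
  (∀ t ∈ Icc (0 : ℝ) 1, IsCovAcceleration g γ (Icc 0 1) t 0) ∧
  (⟨γ 0, velocity γ (Icc 0 1) 0⟩ : TangentBundle (𝓡 3) M) = ⟨p, v⟩

/-- The Riemannian exponential map is defined at `v ∈ T_p M`. -/
def ExpDefined (g : Metric3 M) (p : M) (v : TangentSpace (𝓡 3) p) : Prop :=
  ∃ γ : ℝ → M, IsGeodesicFrom g p v γ

open Classical in
/-- The Riemannian exponential map `exp_p (v)`: the value at time `1` of the geodesic leaving
from `p` with velocity `v` (and `p`, as a default value, if there is no such geodesic). -/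
def riemExp (g : Metric3 M) (p : M) (v : TangentSpace (𝓡 3) p) : M :=
  if h : ExpDefined g p v then h.choose 1 else p

/-- The derivative at `p` of the function `φ` on `M` in the direction `u`. -/
def dirDeriv (φ : M → ℝ) (p : M) (u : TangentSpace (𝓡 3) p) : ℝ :=
  mfderiv (𝓡 3) 𝓘(ℝ, ℝ) φ p u

/-! ### Surfaces parameterized by a planar domain `D` -/

/-- The first coordinate vector field of the parameterized surface `f : D → M`. -/
def d₁ (f : ℝ × ℝ → M) (D : Set (ℝ × ℝ)) (x : ℝ × ℝ) : TangentSpace (𝓡 3) (f x) :=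
  mfderivWithin 𝓘(ℝ, ℝ × ℝ) (𝓡 3) f D x ((1, 0) : ℝ × ℝ)

/-- The second coordinate vector field of the parameterized surface `f : D → M`. -/
def d₂ (f : ℝ × ℝ → M) (D : Set (ℝ × ℝ)) (x : ℝ × ℝ) : TangentSpace (𝓡 3) (f x) :=
  mfderivWithin 𝓘(ℝ, ℝ × ℝ) (𝓡 3) f D x ((0, 1) : ℝ × ℝ)

/-- `f` has injective differential at all the points of `D`. -/
def ImmersiveOn (f : ℝ × ℝ → M) (D : Set (ℝ × ℝ)) : Prop :=
  ∀ x ∈ D, Function.Injective (mfderivWithin 𝓘(ℝ, ℝ × ℝ) (𝓡 3) f D x)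

/-- The derivative of the function `ρ` on the immersed surface `f : D → M` (that is, of a function
`ρ` of the parameters) at the point of parameters `x` in the direction of a vector `u` tangent to
the surface: `dρ_x(e)` for the unique `e` with `df_x(e) = u`. -/
def surfaceDeriv (f : ℝ × ℝ → M) (D : Set (ℝ × ℝ)) (ρ : ℝ × ℝ → ℝ) (x : ℝ × ℝ)
    (u : TangentSpace (𝓡 3) (f x)) : ℝ :=
  fderivWithin ℝ ρ D x
    (Function.invFun (fun e : ℝ × ℝ => mfderivWithin 𝓘(ℝ, ℝ × ℝ) (𝓡 3) f D x e) u)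

/-- The domain of parameters `I × [-σ,σ]`. -/
def strip (I : Set ℝ) (σ : ℝ) : Set (ℝ × ℝ) := I ×ˢ Icc (-σ) σ

/-- A contact sub-Riemannian structure on a `3`-manifold, encoded by its normalized contact form
`η` (with horizontal distribution `ker η`), its Reeb field `T`, the rotation `J` of the oriented
horizontal planes (extended by `J T = 0`) and the canonical extension `g` of the horizontal
metric. The convention for the exterior derivative is
`dη(U,V) = (1/2) (U(η(V)) - V(η(U)) - η([U,V]))`. -/
structure ContactSubRiemannian (M : Type*) [TopologicalSpace M] [ChartedSpace E3 M]
    [IsManifold (𝓡 3) ∞ M] where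
  /-- the canonical extension of the horizontal metric -/
  g : Metric3 M
  /-- the normalized contact form -/
  η : (p : M) → TangentSpace (𝓡 3) p →L[ℝ] ℝ
  /-- the Reeb vector field -/
  T : VField M
  /-- the `90` degree rotation in the oriented horizontal distribution -/
  J : (p : M) → TangentSpace (𝓡 3) p →L[ℝ] TangentSpace (𝓡 3) p
  T_smooth : ∀ p, SmoothFieldAt T p
  η_T : ∀ p, η p (T p) = 1
  /-- `T` is unit and orthogonal to the horizontal distribution -/
  g_T : ∀ p u, g.inner p (T p) u = η p u
  J_T : ∀ p, J p (T p) = 0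
  J_horizontal : ∀ p u, η p (J p u) = 0
  J_sq : ∀ p u, η p u = 0 → J p (J p u) = -u
  J_isometry : ∀ p u w, η p u = 0 → η p w = 0 → g.inner p (J p u) (J p w) = g.inner p u w
  /-- `dη(U,V) = ⟨J(U),V⟩`. As `J` takes values in the horizontal distribution and `J(T) = 0`,
  this says that `dη(T,·) = 0` and that the restriction of `dη` to the horizontal planes is the
  area form associated to the metric and to the orientation for which `(u, J(u))` is positive
  (in particular `η` is a contact form). -/
  dη_eq : ∀ (p : M) (U V : VField M), SmoothFieldAt U p → SmoothFieldAt V p →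
    (1 / 2 : ℝ) *
      (dirDeriv (fun q => η q (V q)) p (U p)
        - dirDeriv (fun q => η q (U q)) p (V p)
        - η p (VectorField.mlieBracket (𝓡 3) U V p))
      = g.inner p (J p (U p)) (V p)

namespace ContactSubRiemannian

variable (A : ContactSubRiemannian M)

/-- The contact sub-Riemannian manifold is Sasakian: the (local) diffeomorphisms of the
one-parameter group of the Reeb field are isometries, i.e. any time-`t` flow map `Φ` of `T`,
defined on an open set `W`, is `C^∞` and its differential maps horizontal planes to horizontal
planes as an orientation-preserving linear isometry. -/
def IsSasakian : Prop :=
  ∀ (t : ℝ) (W : Set M) (Φ : M → M), IsOpen W →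
    (∀ p ∈ W, ∃ c : ℝ → M, c 0 = p ∧ c t = Φ p ∧ IsMIntegralCurveOn c A.T (uIcc 0 t)) →
    ContMDiffOn (𝓡 3) (𝓡 3) ∞ Φ W ∧
    ∀ p ∈ W, ∀ u w : TangentSpace (𝓡 3) p, A.η p u = 0 → A.η p w = 0 →
      A.η (Φ p) (mfderiv (𝓡 3) (𝓡 3) Φ p u) = 0 ∧
      A.g.inner (Φ p) (mfderiv (𝓡 3) (𝓡 3) Φ p u) (mfderiv (𝓡 3) (𝓡 3) Φ p w)
        = A.g.inner p u w ∧
      A.J (Φ p) (mfderiv (𝓡 3) (𝓡 3) Φ p u) = mfderiv (𝓡 3) (𝓡 3) Φ p (A.J p u)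

/-- The Riemannian norm of a tangent vector. -/
def norm (p : M) (u : TangentSpace (𝓡 3) p) : ℝ := Real.sqrt (A.g.inner p u u)

/-- `γ` is, on the interval `s`, a horizontal curve parameterized by arc-length. -/
def IsUnitHorizontalOn (γ : ℝ → M) (s : Set ℝ) : Prop :=
  ∀ t ∈ s, A.η (γ t) (velocity γ s t) = 0 ∧ A.norm (γ t) (velocity γ s t) = 1

/-- `γ` is, on the interval `s`, a CC-geodesic of curvature `lam`: a `C^2` horizontal curve
parameterized by arc-length with `γ̇' + 2 lam J(γ̇) = 0`. -/
def IsCCGeodesicOn (lam : ℝ) (γ : ℝ → M) (s : Set ℝ) : Prop :=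
  ContMDiffOn 𝓘(ℝ, ℝ) (𝓡 3) 2 γ s ∧ A.IsUnitHorizontalOn γ s ∧
  ∀ t ∈ s, IsCovAcceleration A.g γ s t (-((2 * lam) • A.J (γ t) (velocity γ s t)))

/-- The vector product of the oriented Euclidean space `T_p M`: positive orthonormal bases are
`(u, J(u), T)` with `u` horizontal and unit. -/
def cross (p : M) (u w : TangentSpace (𝓡 3) p) : TangentSpace (𝓡 3) p :=
  A.g.inner p (A.J p u) w • A.T p + A.η p u • A.J p w - A.η p w • A.J p u

/-- The Riemannian unit normal `N` of a parameterized surface. -/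
def normal (f : ℝ × ℝ → M) (D : Set (ℝ × ℝ)) (x : ℝ × ℝ) : TangentSpace (𝓡 3) (f x) :=
  (A.norm (f x) (A.cross (f x) (d₁ f D x) (d₂ f D x)))⁻¹ •
    A.cross (f x) (d₁ f D x) (d₂ f D x)

/-- The horizontal projection `N_h` of the unit normal. -/
def normalH (f : ℝ × ℝ → M) (D : Set (ℝ × ℝ)) (x : ℝ × ℝ) : TangentSpace (𝓡 3) (f x) :=
  A.normal f D x - A.g.inner (f x) (A.normal f D x) (A.T (f x)) • A.T (f x)

/-- The horizontal Gauss map `ν_h = N_h / |N_h|`. -/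
def gaussH (f : ℝ × ℝ → M) (D : Set (ℝ × ℝ)) (x : ℝ × ℝ) : TangentSpace (𝓡 3) (f x) :=
  (A.norm (f x) (A.normalH f D x))⁻¹ • A.normalH f D x

/-- The characteristic field `Z = J(ν_h)`. -/
def fieldZ (f : ℝ × ℝ → M) (D : Set (ℝ × ℝ)) (x : ℝ × ℝ) : TangentSpace (𝓡 3) (f x) :=
  A.J (f x) (A.gaussH f D x)

/-- The tangent field `S = ⟨N,T⟩ ν_h - |N_h| T`. -/
def fieldS (f : ℝ × ℝ → M) (D : Set (ℝ × ℝ)) (x : ℝ × ℝ) : TangentSpace (𝓡 3) (f x) :=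
  A.g.inner (f x) (A.normal f D x) (A.T (f x)) • A.gaussH f D x
    - A.norm (f x) (A.normalH f D x) • A.T (f x)

/-- The density of the Riemannian area element `da` with respect to the Lebesgue measure of the
domain of parameters. -/
def areaElement (f : ℝ × ℝ → M) (D : Set (ℝ × ℝ)) (x : ℝ × ℝ) : ℝ :=
  Real.sqrt (A.g.inner (f x) (d₁ f D x) (d₁ f D x) * A.g.inner (f x) (d₂ f D x) (d₂ f D x)
    - A.g.inner (f x) (d₁ f D x) (d₂ f D x) ^ 2)

/-- The sub-Riemannian area `∫ |N_h| da` of the part with parameters in `C` of the parameterized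
surface `f : D → M`. -/
def area (f : ℝ × ℝ → M) (D C : Set (ℝ × ℝ)) : ℝ :=
  ∫ x in C, A.norm (f x) (A.normalH f D x) * A.areaElement f D x

/-- `F : I × [0,σ] → M` is the `C^2` immersed surface, ruled by the CC-geodesics of curvature
`lam` that leave from the points `Γ(ε)` with velocity `δ J(Γ̇(ε))` (`δ = ± 1`), and the function
`v_ε(s) = ⟨∂F/∂ε, T⟩` does not vanish for `s ∈ (0,σ]`. -/
def IsRuledSide (I : Set ℝ) (Γ : ℝ → M) (lam σ δ : ℝ) (F : ℝ × ℝ → M) : Prop :=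
  (∀ ε ∈ I, A.IsCCGeodesicOn lam (fun s => F (ε, s)) (Icc 0 σ) ∧
    (⟨F (ε, 0), velocity (fun s => F (ε, s)) (Icc 0 σ) 0⟩ : TangentBundle (𝓡 3) M)
      = ⟨Γ ε, δ • A.J (Γ ε) (velocity Γ I ε)⟩) ∧
  ContMDiffOn 𝓘(ℝ, ℝ × ℝ) (𝓡 3) 2 F (I ×ˢ Icc 0 σ) ∧
  ImmersiveOn F (I ×ˢ Icc 0 σ) ∧
  ∀ ε ∈ I, ∀ s ∈ Ioc 0 σ, A.η (F (ε, s)) (d₁ F (I ×ˢ Icc 0 σ) (ε, s)) ≠ 0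

/-- `F`, on the domain `I × [-σ,σ]`, parameterizes the `lam`-neighborhood of radius `σ` of the
horizontal curve `Γ : I → M`: the union of the two ruled surfaces `(ε,s) ↦ F(ε,s)` and
`(ε,s) ↦ F(ε,-s)`, `s ∈ [0,σ]`, with initial velocities `J(Γ̇)` and `-J(Γ̇)`, which are glued
along `Γ`. -/
def IsNeighborhood (I : Set ℝ) (Γ : ℝ → M) (lam σ : ℝ) (F : ℝ × ℝ → M) : Prop :=
  0 < σ ∧ A.IsRuledSide I Γ lam σ 1 F ∧
    A.IsRuledSide I Γ lam σ (-1) (fun x => F (x.1, -x.2))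

/-- The vertical variation `φ_r(p) = exp_p (r ρ(p) T_p)` of a parameterized surface. -/
def verticalVariation (f : ℝ × ℝ → M) (ρ : ℝ × ℝ → ℝ) (r : ℝ) (x : ℝ × ℝ) : M :=
  riemExp A.g (f x) ((r * ρ x) • A.T (f x))

end ContactSubRiemannian

end Riemannian

end SubRiem

end

open SubRiem

/-! The proof turns the area of the varied surface into an elementary integral.

In a Sasakian manifold the Reeb field is a unit Killing field. Along a geodesic both the squared
speed and the component `η` of the velocity are therefore constant. If the initial velocity is `c
T`, these constants are `c ^ 2` and `c`, so `|γ' - c T| ^ 2 = 0` throughout and the geodesic is an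
integral curve of `c T`. Hence `exp_p (c T_p)` is the Reeb flow at time `c` (`ReebFlow.riemExp_eq`),
and this flow preserves `η`, `T` and the horizontal metric.

The field `Z` is a nonzero multiple of `∂F/∂s` off `Γ`, so `Z(ρ) = 0` means that `ρ` depends on `ε`
only (`hasFDerivWithinAt_of_fieldZ`). With `p = ρ_Γ'`, the differential of `φ_r` is that of the flow
applied to `dF + r p dε ⊗ T`. So `φ_r` is still ruled by unit horizontal curves, and its component
`⟨∂/∂ε, T⟩` is `v + r p`, where `v = ⟨∂F/∂ε, T⟩`. For any such surface `|N_h| da = |⟨∂/∂ε, T⟩| dε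
ds` (`norm_normalH_mul_areaElement`), whence `A(r) = ∫ |v + r p|` (`exists_variation`).

The identity `dη = ⟨J(·), ·⟩` and `η(∂F/∂s) = 0` give `∂v/∂s = -2 ⟨J(∂F/∂ε), ∂F/∂s⟩`, which equals
`-2` on `Γ`, where `v = 0`. For a small radius `∂v/∂s < -1` over the compact support of `ρ_Γ`. Then
`v + r p` vanishes at most once on each ruling with `p ≠ 0`, and `A'(r) = ∫ p sign(v + r p)`
(`hasDerivAt_integral_abs`). On a ruling the integral of the sign is `2 s`, where `s` is the root of
`v = -r p`, and `2 s = r p + o(r)`. Dominated differentiation yields `A''(0) = ∫ p ^ 2`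
(`hasDerivAt_integral_mul_sign`), although `A` need not be of class `C^2`.

Finally `S` tends to `Γ̇` on the side `s > 0` and to `-Γ̇` on the side `s < 0` (`tendsto_fieldS`),
so `S(ρ) ^ 2 = p ^ 2` for both extensions. -/

noncomputable section

namespace SubRiem

/-! ### Differentiability of local flows with respect to the initial point. -/

section Flow

variable {E : Type*} [NormedAddCommGroup E] [NormedSpace ℝ E]

/-- The quadratic remainder estimate for maps with Lipschitz derivative. -/
lemma norm_sub_sub_fderiv_le {f : E → E} {s : Set E} (hs : Convex ℝ s) {K : NNReal}
    (hd : ∀ x ∈ s, DifferentiableAt ℝ f x) (hl : LipschitzOnWith K (fderiv ℝ f) s)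
    {x y : E} (hx : x ∈ s) (hy : y ∈ s) :
    ‖f y - f x - fderiv ℝ f x (y - x)‖ ≤ K * ‖y - x‖ ^ 2 := by
  have hseg : segment ℝ x y ⊆ s := hs.segment_subset hx hy
  -- Mean value inequality for `f` minus its linear part at `x`: on the segment the derivative of
  -- the difference is at most `K * ‖y - x‖`.
  have := Convex.norm_image_sub_le_of_norm_fderiv_le' (𝕜 := ℝ) (f := f) (C := K * ‖y - x‖)
    (φ := fderiv ℝ f x) (s := segment ℝ x y) (fun z hz => hd z (hseg hz)) ?_
    (convex_segment x y) (left_mem_segment ℝ x y) (right_mem_segment ℝ x y)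
  · calc _ ≤ _ := this
      _ = _ := by ring
  · intro z hz
    have h1 := hl.norm_sub_le (hseg hz) hx
    refine h1.trans ?_
    gcongr
    obtain ⟨a, b, ha, hb, hab, rfl⟩ := hz
    have : a • x + b • y - x = b • (y - x) := by
      have : a = 1 - b := by linarith
      subst this; module
    rw [this, norm_smul, Real.norm_of_nonneg hb]
    have hb1 : b ≤ 1 := by linarith
    nlinarith [norm_nonneg (y - x)]

/-- A trajectory of an autonomous equation, a nearby one and a solution of the linearized equation
differ by a quadratic quantity. -/
lemma norm_linearized_error_le {f : E → E} {s : Set E} (hs : Convex ℝ s) {K : NNReal} {C τ L : ℝ}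
    (hC : 0 < C) (hτ : 0 < τ)
    (hd : ∀ x ∈ s, DifferentiableAt ℝ f x) (hl : LipschitzOnWith K (fderiv ℝ f) s)
    (hb : ∀ x ∈ s, ‖fderiv ℝ f x‖ ≤ C)
    {a b : ℝ → E} {Y : ℝ → E →L[ℝ] E} {h : E}
    (ha : ∀ t ∈ Ioo (-τ) τ, a t ∈ s ∧ HasDerivAt a (f (a t)) t)
    (hb' : ∀ t ∈ Ioo (-τ) τ, b t ∈ s ∧ HasDerivAt b (f (b t)) t)
    (hY : ∀ t ∈ Ioo (-τ) τ, HasDerivAt Y ((fderiv ℝ f (a t)).comp (Y t)) t)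
    (h0 : b 0 - a 0 - Y 0 h = 0) (hL : ∀ t ∈ Ioo (-τ) τ, ‖b t - a t‖ ≤ L * ‖h‖)
    {t : ℝ} (ht : t ∈ Ioo (-τ) τ) :
    ‖b t - a t - Y t h‖ ≤ (τ * K * L ^ 2 / (τ * C) * (Real.exp (τ * C) - 1)) * ‖h‖ ^ 2 := by
  have hmem : ∀ u ∈ Icc (0 : ℝ) 1, u * t ∈ Ioo (-τ) τ := by
    intro u hu
    have ht' := abs_lt.2 ht
    refine abs_lt.1 ?_
    rw [abs_mul, abs_of_nonneg hu.1]
    nlinarith [abs_nonneg t, hu.2]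
  have htl : |t| ≤ τ := (abs_lt.2 ht).le
  -- Time is rescaled by `t`, so that one forward Gronwall argument on `[0,1]` covers both signs of
  -- `t`. The factor `|t| ≤ τ` turns the constant `C` into `τ * C`.
  set e : ℝ → E := fun u => b (u * t) - a (u * t) - Y (u * t) h with he
  set e' : ℝ → E := fun u => t • (f (b (u * t)) - f (a (u * t))
    - fderiv ℝ f (a (u * t)) (Y (u * t) h)) with he'
  have hder : ∀ u ∈ Icc (0 : ℝ) 1, HasDerivAt e (e' u) u := by
    intro u hu
    have hm := hmem u hu
    have hlin : HasDerivAt (fun u : ℝ => u * t) t u := by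
      simpa using (hasDerivAt_id u).mul_const t
    have h1 : HasDerivAt (fun u => b (u * t)) (t • f (b (u * t))) u :=
      HasDerivAt.scomp u (hb' _ hm).2 hlin
    have h2 : HasDerivAt (fun u => a (u * t)) (t • f (a (u * t))) u :=
      HasDerivAt.scomp u (ha _ hm).2 hlin
    have h3 : HasDerivAt (fun u => Y (u * t)) (t • (fderiv ℝ f (a (u * t))).comp (Y (u * t))) u :=
      HasDerivAt.scomp u (hY _ hm) hlin
    have h4 : HasDerivAt (fun u => Y (u * t) h) (t • fderiv ℝ f (a (u * t)) (Y (u * t) h)) u := by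
      simpa using h3.clm_apply (hasDerivAt_const u h)
    refine ((h1.sub h2).sub h4).congr_deriv ?_
    simp only [he', smul_sub]
  have key := norm_le_gronwallBound_of_norm_deriv_right_le (f := e) (f' := e') (δ := 0)
    (K := τ * C) (ε := τ * K * L ^ 2 * ‖h‖ ^ 2) (a := 0) (b := 1)
    (fun u hu => (hder u hu).continuousAt.continuousWithinAt)
    (fun u hu => (hder u ⟨hu.1, hu.2.le⟩).hasDerivWithinAt) (by simp [he, h0]) ?_ 1 (by simp)
  · simp only [he, one_mul] at key
    refine key.trans (le_of_eq ?_)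
    rw [gronwallBound_of_K_ne_0 (by positivity)]
    simp; ring
  · intro u hu
    have hm := hmem u ⟨hu.1, hu.2.le⟩
    simp only [he', he, norm_smul, Real.norm_eq_abs]
    have h1 := norm_sub_sub_fderiv_le hs hd hl (ha _ hm).1 (hb' _ hm).1
    have h2 := hb _ (ha _ hm).1
    have h3 := hL _ hm
    -- The derivative of the error splits into the linearized field applied to the error and a
    -- Taylor remainder, which is at most `K * (L * ‖h‖) ^ 2`.
    have h4 : f (b (u * t)) - f (a (u * t)) - fderiv ℝ f (a (u * t)) (Y (u * t) h)
        = fderiv ℝ f (a (u * t)) (b (u * t) - a (u * t) - Y (u * t) h)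
          + (f (b (u * t)) - f (a (u * t)) - fderiv ℝ f (a (u * t)) (b (u * t) - a (u * t))) := by
      simp only [map_sub]; abel
    have h5 : ‖fderiv ℝ f (a (u * t)) (b (u * t) - a (u * t) - Y (u * t) h)‖
        ≤ C * ‖b (u * t) - a (u * t) - Y (u * t) h‖ :=
      (ContinuousLinearMap.le_opNorm _ _).trans (by gcongr)
    have h6 : (K : ℝ) * ‖b (u * t) - a (u * t)‖ ^ 2 ≤ K * (L * ‖h‖) ^ 2 := by gcongr
    rw [h4]
    calc _ ≤ τ * (C * ‖b (u * t) - a (u * t) - Y (u * t) h‖ + K * (L * ‖h‖) ^ 2) := by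
          gcongr
          exact (norm_add_le _ _).trans (add_le_add h5 (h1.trans h6))
      _ = _ := by ring

variable [CompleteSpace E]

/-- The local flow of a vector field of class `C^2`, together with its space derivative, which
solves the linearized equation. -/
theorem exists_flow_with_fderiv {f : E → E} {x₀ : E} (hf : ContDiffAt ℝ 2 f x₀) {U : Set E}
    (hU : U ∈ 𝓝 x₀) :
    ∃ r > 0, ∃ τ > 0, ∃ (α : E → ℝ → E) (Y : E → ℝ → E →L[ℝ] E),
      ∀ x ∈ Metric.ball x₀ r, α x 0 = x ∧ Y x 0 = ContinuousLinearMap.id ℝ E ∧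
        ∀ t ∈ Ioo (-τ) τ, α x t ∈ U ∧ HasDerivAt (α x) (f (α x t)) t ∧
          HasDerivAt (Y x) ((fderiv ℝ f (α x t)).comp (Y x t)) t ∧
          HasFDerivAt (fun x' => α x' t) (Y x t) x ∧
          ContinuousAt (Function.uncurry α) (x, t) ∧ ContinuousAt (Function.uncurry Y) (x, t) := by
  -- The equation coupled with its linearization. Since `f` is of class `C^2`, this field is of
  -- class `C^1`, and one application of Picard-Lindelöf yields both the flow and the candidate `Y`
  -- for its derivative, with Lipschitz dependence on the initial value.
  set G : E × (E →L[ℝ] E) → E × (E →L[ℝ] E) :=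
    fun z => (f z.1, (fderiv ℝ f z.1).comp z.2) with hG
  set z₀ : E × (E →L[ℝ] E) := (x₀, ContinuousLinearMap.id ℝ E) with hz₀
  have hf' : ContDiffAt ℝ 1 (fderiv ℝ f) x₀ := hf.fderiv_right (by norm_num)
  have hGd : ContDiffAt ℝ 1 G z₀ := by
    have h1 : ContDiffAt ℝ 1 (fun z : E × (E →L[ℝ] E) => f z.1) z₀ :=
      ContDiffAt.comp z₀ (f := Prod.fst) (g := f) (hf.of_le (by norm_num)) contDiffAt_fst
    have h2 : ContDiffAt ℝ 1 (fun z : E × (E →L[ℝ] E) => fderiv ℝ f z.1) z₀ :=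
      ContDiffAt.comp z₀ (f := Prod.fst) (g := fderiv ℝ f) hf' contDiffAt_fst
    exact h1.prodMk (h2.clm_comp contDiffAt_snd)
  obtain ⟨ε, hε, a, r, L, K, hr, hpl⟩ := IsPicardLindelof.of_contDiffAt_one hGd
  obtain ⟨β, hβ, L', hβL⟩ :=
    (hpl 0).exists_forall_mem_closedBall_eq_hasDerivWithinAt_lipschitzOnWith
  have hβ1 : ∀ z ∈ Metric.closedBall z₀ r, β z 0 = z := fun z hz => (hβ z hz).1
  have hβ2 : ∀ z ∈ Metric.closedBall z₀ r, ∀ t ∈ Ioo (-ε) ε,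
      HasDerivAt (β z) (G (β z t)) t := by
    intro z hz t ht
    have := (hβ z hz).2 t ⟨by simpa using ht.1.le, by simpa using ht.2.le⟩
    refine this.hasDerivAt (Icc_mem_nhds (by simpa using ht.1) (by simpa using ht.2))
  have hcont : ContinuousOn (Function.uncurry β)
      (Metric.closedBall z₀ r ×ˢ Icc (0 - ε) (0 + ε)) := by
    apply continuousOn_prod_of_continuousOn_lipschitzOnWith _ L' _ hβL
    exact fun x hx ↦ HasDerivWithinAt.continuousOn (hβ x hx).2
  have hcont' : ∀ z ∈ Metric.ball z₀ r, ∀ t ∈ Ioo (-ε) ε,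
      ContinuousAt (Function.uncurry β) (z, t) := by
    intro z hz t ht
    refine hcont.continuousAt (prod_mem_nhds ?_ ?_)
    · exact mem_of_superset (Metric.isOpen_ball.mem_nhds hz) Metric.ball_subset_closedBall
    · exact Icc_mem_nhds (by simpa using ht.1) (by simpa using ht.2)
  obtain ⟨K₁, s₁, hs₁, hl₁⟩ := hf'.exists_lipschitzOnWith
  have hbd : ∀ᶠ x in 𝓝 x₀, ‖fderiv ℝ f x‖ < ‖fderiv ℝ f x₀‖ + 1 :=
    hf'.continuousAt.norm.eventually_lt_const (lt_add_one _)
  have hdiff : ∀ᶠ x in 𝓝 x₀, DifferentiableAt ℝ f x := by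
    filter_upwards [hf.eventually (by simp)] with x hx using hx.differentiableAt (by norm_num)
  obtain ⟨δ, hδ, hball⟩ := Metric.mem_nhds_iff.1
    (inter_mem (inter_mem hU hs₁) (hbd.and hdiff))
  have hz₀0 : ContinuousAt (Function.uncurry β) (z₀, 0) :=
    hcont' z₀ (Metric.mem_ball_self (by exact_mod_cast hr)) 0 ⟨by linarith, hε⟩
  have hev : ∀ᶠ p : E × ℝ in 𝓝 (x₀, 0), (β (p.1, ContinuousLinearMap.id ℝ E) p.2).1
      ∈ Metric.ball x₀ δ := by
    have hc : ContinuousAt (fun p : E × ℝ =>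
        (Function.uncurry β ((p.1, ContinuousLinearMap.id ℝ E), p.2)).1) (x₀, 0) := by
      refine continuousAt_fst.comp (ContinuousAt.comp (g := Function.uncurry β)
        (f := fun p : E × ℝ => ((p.1, ContinuousLinearMap.id ℝ E), p.2)) hz₀0 ?_)
      fun_prop
    refine hc.eventually_mem (Metric.isOpen_ball.mem_nhds ?_)
    have h := hβ1 z₀ (Metric.mem_closedBall_self r.2)
    rw [hz₀] at h
    simp [h, hδ]
  obtain ⟨ρ, hρ, hρb⟩ := Metric.mem_nhds_iff.1 hev
  refine ⟨min ρ r, lt_min hρ (by exact_mod_cast hr), min ρ ε, lt_min hρ hε,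
    fun x t => (β (x, ContinuousLinearMap.id ℝ E) t).1,
    fun x t => (β (x, ContinuousLinearMap.id ℝ E) t).2, ?_⟩
  have hin : ∀ x ∈ Metric.ball x₀ (min ρ r), (x, ContinuousLinearMap.id ℝ E) ∈
      Metric.ball z₀ r := by
    intro x hx
    rw [Metric.mem_ball] at hx ⊢
    simp only [hz₀, Prod.dist_eq, dist_self]
    rw [max_eq_left dist_nonneg]
    exact hx.trans_le (min_le_right _ _)
  have hτε : ∀ t ∈ Ioo (-(min ρ ε)) (min ρ ε), t ∈ Ioo (-ε) ε := fun t ht =>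
    ⟨by linarith [ht.1, min_le_right ρ ε], ht.2.trans_le (min_le_right _ _)⟩
  have hmem : ∀ x ∈ Metric.ball x₀ (min ρ r), ∀ t ∈ Ioo (-(min ρ ε)) (min ρ ε),
      (β (x, ContinuousLinearMap.id ℝ E) t).1 ∈ Metric.ball x₀ δ := by
    intro x hx t ht
    have : (x, t) ∈ Metric.ball ((x₀, 0) : E × ℝ) ρ := by
      rw [Metric.mem_ball, Prod.dist_eq, max_lt_iff]
      refine ⟨(Metric.mem_ball.1 hx).trans_le (min_le_left _ _), ?_⟩
      simp only [Real.dist_eq, sub_zero]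
      exact (abs_lt.2 ht).trans_le (min_le_left _ _)
    exact hρb this
  have hd1 : ∀ x ∈ Metric.ball x₀ (min ρ r), ∀ t ∈ Ioo (-(min ρ ε)) (min ρ ε),
      HasDerivAt (fun t => (β (x, ContinuousLinearMap.id ℝ E) t).1)
        (f (β (x, ContinuousLinearMap.id ℝ E) t).1) t := by
    intro x hx t ht
    have h := hβ2 _ (Metric.ball_subset_closedBall (hin x hx)) t (hτε t ht)
    exact (hasFDerivAt_fst (p := β (x, ContinuousLinearMap.id ℝ E) t)).comp_hasDerivAt t h
  have hd2 : ∀ x ∈ Metric.ball x₀ (min ρ r), ∀ t ∈ Ioo (-(min ρ ε)) (min ρ ε),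
      HasDerivAt (fun t => (β (x, ContinuousLinearMap.id ℝ E) t).2)
        ((fderiv ℝ f (β (x, ContinuousLinearMap.id ℝ E) t).1).comp
          (β (x, ContinuousLinearMap.id ℝ E) t).2) t := by
    intro x hx t ht
    have h := hβ2 _ (Metric.ball_subset_closedBall (hin x hx)) t (hτε t ht)
    exact (hasFDerivAt_snd (p := β (x, ContinuousLinearMap.id ℝ E) t)).comp_hasDerivAt t h
  intro x hx
  have hx0 := hβ1 _ (Metric.ball_subset_closedBall (hin x hx))
  refine ⟨by simp [hx0], by simp [hx0], fun t ht => ⟨(hball (hmem x hx t ht)).1.1, hd1 x hx t ht,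
    hd2 x hx t ht, ?_, ?_, ?_⟩⟩
  -- The candidate is the derivative because the linearization error is quadratic in the
  -- displacement of the initial point.
  · rw [hasFDerivAt_iff_isLittleO]
    have hO : (fun x' => (β (x', ContinuousLinearMap.id ℝ E) t).1 -
        (β (x, ContinuousLinearMap.id ℝ E) t).1 - (β (x, ContinuousLinearMap.id ℝ E) t).2 (x' - x))
        =O[𝓝 x] fun x' => ‖x' - x‖ ^ 2 := by
      refine Asymptotics.IsBigO.of_bound (min ρ ε * K₁ * L' ^ 2 /
        (min ρ ε * (‖fderiv ℝ f x₀‖ + 1)) * (Real.exp (min ρ ε * (‖fderiv ℝ f x₀‖ + 1)) - 1)) ?_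
      filter_upwards [Metric.isOpen_ball.mem_nhds hx] with x' hx'
      rw [norm_pow, norm_norm]
      have hx0' := hβ1 _ (Metric.ball_subset_closedBall (hin x' hx'))
      refine norm_linearized_error_le (convex_ball x₀ δ) (τ := min ρ ε) (L := L')
        (C := ‖fderiv ℝ f x₀‖ + 1) (K := K₁)
        (by positivity) (lt_min hρ hε) (fun y hy => (hball hy).2.2)
        (hl₁.mono fun y hy => (hball hy).1.2) (fun y hy => (hball hy).2.1.le)
        (fun t ht => ⟨hmem x hx t ht, hd1 x hx t ht⟩) (fun t ht => ⟨hmem x' hx' t ht, hd1 x' hx' t ht⟩)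
        (fun t ht => hd2 x hx t ht) (by simp [hx0, hx0']) ?_ ht
      intro t ht
      have ht' := hτε t ht
      have h := (hβL t ⟨by simpa using ht'.1.le, by simpa using ht'.2.le⟩).norm_sub_le
        (Metric.ball_subset_closedBall (hin x' hx')) (Metric.ball_subset_closedBall (hin x hx))
      refine (norm_fst_le (β (x', ContinuousLinearMap.id ℝ E) t
        - β (x, ContinuousLinearMap.id ℝ E) t)).trans (h.trans (le_of_eq ?_))
      simp [Prod.norm_def]
    refine hO.trans_isLittleO ?_
    have h := (Asymptotics.isLittleO_norm_pow_id (E' := E) one_lt_two).comp_tendsto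
      (show Tendsto (fun x' => x' - x) (𝓝 x) (𝓝 0) by
        exact Continuous.tendsto' (by fun_prop) x 0 (by simp))
    exact h
  · exact continuousAt_fst.comp (ContinuousAt.comp (g := Function.uncurry β)
        (f := fun p : E × ℝ => ((p.1, ContinuousLinearMap.id ℝ E), p.2))
        (hcont' _ (hin x hx) _ (hτε t ht)) (by fun_prop))
  · exact continuousAt_snd.comp (ContinuousAt.comp (g := Function.uncurry β)
        (f := fun p : E × ℝ => ((p.1, ContinuousLinearMap.id ℝ E), p.2))
        (hcont' _ (hin x hx) _ (hτε t ht)) (by fun_prop))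

end Flow

end SubRiem

namespace SubRiem

/-! ### The metric, the contact form and the Reeb field in a chart. -/

section ChartGeometry

variable {M : Type*} [TopologicalSpace M] [ChartedSpace E3 M]

/-- The preferred chart at `p`. -/
abbrev ch (p : M) : PartialEquiv M E3 := extChartAt (𝓡 3) p

/-- The coordinates, in the preferred chart at `p`, of the tangent vectors at `q`. -/
def chartFwd (p q : M) : TangentSpace (𝓡 3) q →L[ℝ] E3 :=
  mfderiv (𝓡 3) 𝓘(ℝ, E3) (ch p) q

/-- The tangent vector at the point of coordinates `y` with given components. -/
def chartInv (p : M) (y : E3) : E3 →L[ℝ] TangentSpace (𝓡 3) ((ch p).symm y) :=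
  mfderiv 𝓘(ℝ, E3) (𝓡 3) (ch p).symm y

/-- A constant vector field on the model space. -/
def constField (u : E3) : (y : E3) → TangentSpace 𝓘(ℝ, E3) y := fun _ => u

/-- The coordinate vector fields of the preferred chart at `p`. -/
def coordField (p : M) (u : E3) : VField M :=
  VectorField.mpullback (𝓡 3) 𝓘(ℝ, E3) (ch p) (constField u)

lemma isOpen_ch_target (p : M) : IsOpen (ch p).target := isOpen_extChartAt_target p

lemma isOpen_ch_source (p : M) : IsOpen (ch p).source := isOpen_extChartAt_source p

variable [IsManifold (𝓡 3) ∞ M]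

lemma chartFwd_chartInv (p : M) {y : E3} (hy : y ∈ (ch p).target) (u : E3) :
    chartFwd p ((ch p).symm y) (chartInv p y u) = u := by
  have h := mfderiv_extChartAt_comp_mfderivWithin_extChartAt_symm (I := 𝓡 3) hy
  rw [ModelWithCorners.range_eq_univ, mfderivWithin_univ] at h
  exact DFunLike.congr_fun h u

lemma chartInv_chartFwd (p : M) {y : E3} (hy : y ∈ (ch p).target)
    (v : TangentSpace (𝓡 3) ((ch p).symm y)) :
    chartInv p y (chartFwd p ((ch p).symm y) v) = v := by
  have h := mfderivWithin_extChartAt_symm_comp_mfderiv_extChartAt (I := 𝓡 3) hy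
  rw [ModelWithCorners.range_eq_univ, mfderivWithin_univ] at h
  exact DFunLike.congr_fun h v

lemma chartFwd_self (p : M) (v : TangentSpace (𝓡 3) p) : chartFwd p p v = v := by
  have := mfderiv_extChartAt_self (I := 𝓡 3) (x := p)
  exact DFunLike.congr_fun this v

lemma chartFwd_injective (p : M) {q : M} (hq : q ∈ (ch p).source) :
    Function.Injective (chartFwd p q) := by
  have h : (ch p).symm (ch p q) = q := (ch p).left_inv hq
  have hy := (ch p).map_source hq
  -- The point `q` is replaced by the image of a free coordinate vector `y`, so that tangent vectors
  -- at `q` and at the image of `y` live in the same space.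
  generalize ch p q = y at h hy
  subst h
  exact Function.LeftInverse.injective (g := chartInv p y) (chartInv_chartFwd p hy)

lemma coordField_symm (p : M) {y : E3} (hy : y ∈ (ch p).target) (u : E3) :
    coordField p u ((ch p).symm y) = chartInv p y u := by
  apply chartFwd_injective p ((ch p).map_target hy)
  rw [chartFwd_chartInv p hy, coordField, VectorField.mpullback_apply]
  have hinv := isInvertible_mfderiv_extChartAt (I := 𝓡 3) ((ch p).map_target hy)
  exact hinv.self_apply_inverse u

lemma coordField_smoothAt (p : M) (u : E3) {q : M} (hq : q ∈ (ch p).source) :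
    SmoothFieldAt (coordField p u) q := by
  refine ContMDiffAt.mpullback_vectorField_preimage (n := ∞) ?_ ?_ ?_ (by simp)
  · exact (contMDiffAt_vectorSpace_iff_contDiffAt (V := constField u)).2 contDiffAt_const
  · exact contMDiffAt_extChartAt' (by simpa using hq)
  · exact isInvertible_mfderiv_extChartAt hq

/-- Pullback commutes with the bracket, and constant fields commute. This removes the bracket term
from the formula for `dη`. -/
lemma mlieBracket_coordField (p : M) (u w : E3) {q : M} (hq : q ∈ (ch p).source) :
    VectorField.mlieBracket (𝓡 3) (coordField p u) (coordField p w) q = 0 := by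
  have : IsManifold (𝓡 3) (minSmoothness ℝ 2) M := by
    rw [minSmoothness_of_isRCLikeNormedField]; infer_instance
  have h := VectorField.mpullback_mlieBracket (I := 𝓡 3) (I' := 𝓘(ℝ, E3)) (𝕜 := ℝ) (n := ∞)
    (f := ch p) (V := constField u) (W := constField w) (x₀ := q) ?_ ?_
    (contMDiffAt_extChartAt' (by simpa using hq))
    (by rw [minSmoothness_of_isRCLikeNormedField]; exact ENat.LEInfty.out)
  · rw [coordField, coordField, ← h, VectorField.mpullback_apply]
    have : VectorField.mlieBracket 𝓘(ℝ, E3) (constField u) (constField w) = 0 := by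
      rw [← VectorField.mlieBracketWithin_univ,
        VectorField.mlieBracketWithin_eq_lieBracketWithin]
      change VectorField.lieBracketWithin ℝ (fun _ : E3 => u) (fun _ => w) univ = 0
      rw [VectorField.lieBracketWithin_univ]
      ext1 y
      simp [VectorField.lieBracket]
    rw [this]
    simp
  · exact ((contMDiffAt_vectorSpace_iff_contDiffAt (n := 1) (V := constField u)).2
      contDiffAt_const).mdifferentiableAt (by norm_num)
  · exact ((contMDiffAt_vectorSpace_iff_contDiffAt (n := 1) (V := constField w)).2
      contDiffAt_const).mdifferentiableAt (by norm_num)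

lemma contMDiffAt_inner (g : Metric3 M) {U V : VField M} {q : M} (hU : SmoothFieldAt U q)
    (hV : SmoothFieldAt V q) :
    ContMDiffAt (𝓡 3) 𝓘(ℝ, ℝ) ∞ (fun q => g.inner q (U q) (V q)) q := by
  have h : ContMDiffAt (𝓡 3) ((𝓡 3).prod 𝓘(ℝ, ℝ)) ∞
      (fun q => (⟨q, g.inner q (U q) (V q)⟩ : Bundle.TotalSpace ℝ (Bundle.Trivial M ℝ))) q :=
    ContMDiffAt.clm_bundle_apply₂ (F₁ := E3) (F₂ := E3) (F₃ := ℝ)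
      (b := fun q : M => q) (g.contMDiff q) hU hV
  simp only [Bundle.contMDiffAt_section] at h
  exact h

/-- The metric coefficients in the preferred chart at `p`. -/
def metricC (g : Metric3 M) (p : M) (y : E3) : E3 →L[ℝ] E3 →L[ℝ] ℝ :=
  ContinuousLinearMap.bilinearComp
    (show E3 →L[ℝ] E3 →L[ℝ] ℝ from g.inner ((ch p).symm y)) (chartInv p y) (chartInv p y)

lemma metricC_eq (g : Metric3 M) (p : M) (y u w : E3) :
    metricC g p y u w = metricInChart g p y u w := rfl

lemma contDiffOn_metricC (g : Metric3 M) (p : M) :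
    ContDiffOn ℝ ∞ (metricC g p) (ch p).target := by
  rw [contDiffOn_clm_apply]
  intro u
  rw [contDiffOn_clm_apply]
  intro w y hy
  have h1 := contMDiffAt_inner g (coordField_smoothAt p u ((ch p).map_target hy))
    (coordField_smoothAt p w ((ch p).map_target hy))
  have h2 : ContMDiffAt 𝓘(ℝ, E3) (𝓡 3) ∞ (ch p).symm y :=
    (contMDiffOn_extChartAt_symm p y hy).contMDiffAt ((isOpen_ch_target p).mem_nhds hy)
  have h3 := (h1.comp y h2).contDiffAt
  refine (h3.congr_of_eventuallyEq ?_).contDiffWithinAt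
  filter_upwards [(isOpen_ch_target p).mem_nhds hy] with z hz
  simp only [Function.comp, coordField_symm p hz]
  rfl

lemma metricC_symm (g : Metric3 M) (p : M) (y u w : E3) : metricC g p y u w = metricC g p y w u :=
  g.symm _ _ _

lemma contMDiffAt_ch_symm (p : M) {y : E3} (hy : y ∈ (ch p).target) :
    ContMDiffAt 𝓘(ℝ, E3) (𝓡 3) ∞ (ch p).symm y :=
  (contMDiffOn_extChartAt_symm p y hy).contMDiffAt ((isOpen_ch_target p).mem_nhds hy)

lemma dirDeriv_chartInv {φ : M → ℝ} (p : M) {y : E3} (hy : y ∈ (ch p).target)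
    (hφ : MDifferentiableAt (𝓡 3) 𝓘(ℝ, ℝ) φ ((ch p).symm y)) (u : E3) :
    dirDeriv φ ((ch p).symm y) (chartInv p y u) = fderiv ℝ (φ ∘ (ch p).symm) y u := by
  have h := mfderiv_comp (I := 𝓘(ℝ, E3)) (I' := 𝓡 3) (I'' := 𝓘(ℝ, ℝ)) y hφ
    ((contMDiffAt_ch_symm p hy).mdifferentiableAt (by simp))
  rw [mfderiv_eq_fderiv] at h
  rw [h]
  rfl

/-- In the coordinates at `p`, a vector at `q` is determined by, and has the same products as, its
components. -/
lemma inner_eq_metricC (g : Metric3 M) (p : M) {q : M} (hq : q ∈ (ch p).source)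
    (v w : TangentSpace (𝓡 3) q) :
    g.inner q v w = metricC g p (ch p q) (chartFwd p q v) (chartFwd p q w) := by
  have h : (ch p).symm (ch p q) = q := (ch p).left_inv hq
  have hy := (ch p).map_source hq
  generalize ch p q = y at h hy
  subst h
  change _ = g.inner _ (chartInv p y _) (chartInv p y _)
  rw [chartInv_chartFwd p hy, chartInv_chartFwd p hy]

namespace ContactSubRiemannian

variable (A : ContactSubRiemannian M)

/-- The components of the Reeb field in the preferred chart at `p`. -/
def reebC (p : M) (y : E3) : E3 := chartFwd p ((ch p).symm y) (A.T ((ch p).symm y))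

/-- The contact form in the preferred chart at `p`. -/
def etaC (p : M) (y : E3) : E3 →L[ℝ] ℝ := metricC A.g p y (A.reebC p y)

lemma chartInv_reebC (p : M) {y : E3} (hy : y ∈ (ch p).target) :
    chartInv p y (A.reebC p y) = A.T ((ch p).symm y) := chartInv_chartFwd p hy _

lemma etaC_apply (p : M) {y : E3} (hy : y ∈ (ch p).target) (u : E3) :
    A.etaC p y u = A.η ((ch p).symm y) (chartInv p y u) := by
  rw [← A.g_T, ← A.chartInv_reebC p hy]
  rfl

lemma chartFwd_T (p : M) {q : M} (hq : q ∈ (ch p).source) :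
    chartFwd p q (A.T q) = A.reebC p (ch p q) := by
  have h : (ch p).symm (ch p q) = q := (ch p).left_inv hq
  rw [reebC, h]

lemma eta_eq_etaC (p : M) {q : M} (hq : q ∈ (ch p).source) (v : TangentSpace (𝓡 3) q) :
    A.η q v = A.etaC p (ch p q) (chartFwd p q v) := by
  rw [← A.g_T, inner_eq_metricC A.g p hq, A.chartFwd_T p hq, etaC]

/-- In coordinates `T` is its pullback by the inverse chart, and pullbacks of smooth fields by local
diffeomorphisms are smooth. -/
lemma contDiffOn_reebC (p : M) : ContDiffOn ℝ ∞ (A.reebC p) (ch p).target := by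
  intro y hy
  have h : ContMDiffAt 𝓘(ℝ, E3) 𝓘(ℝ, E3).tangent ∞
      (fun y => (⟨y, VectorField.mpullback 𝓘(ℝ, E3) (𝓡 3) (ch p).symm A.T y⟩ :
        TangentBundle 𝓘(ℝ, E3) E3)) y := by
    refine ContMDiffAt.mpullback_vectorField_preimage (n := ∞) (A.T_smooth _)
      (contMDiffAt_ch_symm p hy) ?_ (by simp)
    have h := isInvertible_mfderivWithin_extChartAt_symm (I := 𝓡 3) hy
    rwa [ModelWithCorners.range_eq_univ, mfderivWithin_univ] at h
  rw [contMDiffAt_vectorSpace_iff_contDiffAt] at h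
  refine (h.congr_of_eventuallyEq ?_).contDiffWithinAt
  filter_upwards [(isOpen_ch_target p).mem_nhds hy] with z hz
  rw [VectorField.mpullback_apply]
  have h := isInvertible_mfderivWithin_extChartAt_symm (I := 𝓡 3) hz
  rw [ModelWithCorners.range_eq_univ, mfderivWithin_univ] at h
  rw [← A.chartInv_reebC p hz]
  exact (h.inverse_apply_self _).symm

lemma contDiffOn_etaC (p : M) : ContDiffOn ℝ ∞ (A.etaC p) (ch p).target :=
  (contDiffOn_metricC A.g p).clm_apply (A.contDiffOn_reebC p)

lemma etaC_reebC (p : M) {y : E3} (hy : y ∈ (ch p).target) : A.etaC p y (A.reebC p y) = 1 := by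
  rw [A.etaC_apply p hy, A.chartInv_reebC p hy, A.η_T]

lemma g_TT (p : M) : A.g.inner p (A.T p) (A.T p) = 1 := by rw [A.g_T, A.η_T]

/-- The form `⟨J(·),·⟩` in the preferred chart at `p`. -/
def areaC (p : M) (y : E3) (u w : E3) : ℝ :=
  A.g.inner ((ch p).symm y) (A.J _ (chartInv p y u)) (chartInv p y w)

lemma inner_J_eq_areaC (p : M) {q : M} (hq : q ∈ (ch p).source) (v w : TangentSpace (𝓡 3) q) :
    A.g.inner q (A.J q v) w = A.areaC p (ch p q) (chartFwd p q v) (chartFwd p q w) := by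
  have h : (ch p).symm (ch p q) = q := (ch p).left_inv hq
  have hy := (ch p).map_source hq
  rw [areaC]
  generalize ch p q = y at h hy
  subst h
  rw [chartInv_chartFwd p hy, chartInv_chartFwd p hy]

/-- The identity `dη = ⟨J(·),·⟩` in coordinates. -/
theorem fderiv_etaC_sub (p : M) {y : E3} (hy : y ∈ (ch p).target) (u w : E3) :
    fderiv ℝ (A.etaC p) y u w - fderiv ℝ (A.etaC p) y w u = 2 * A.areaC p y u w := by
  have hs := (ch p).map_target hy
  have hd := A.dη_eq ((ch p).symm y) (coordField p u) (coordField p w)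
    (coordField_smoothAt p u hs) (coordField_smoothAt p w hs)
  rw [mlieBracket_coordField p u w hs, coordField_symm p hy, coordField_symm p hy] at hd
  have key : ∀ a b : E3, dirDeriv (fun q => A.η q (coordField p b q)) ((ch p).symm y)
      (chartInv p y a) = fderiv ℝ (A.etaC p) y a b := by
    intro a b
    have hsm : ContMDiffAt (𝓡 3) 𝓘(ℝ, ℝ) ∞ (fun q => A.η q (coordField p b q))
        ((ch p).symm y) := by
      have := contMDiffAt_inner A.g (A.T_smooth ((ch p).symm y)) (coordField_smoothAt p b hs)
      simpa only [A.g_T] using this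
    rw [dirDeriv_chartInv p hy (hsm.mdifferentiableAt (by simp))]
    have he : (fun q => A.η q (coordField p b q)) ∘ (ch p).symm =ᶠ[𝓝 y]
        fun z => A.etaC p z b := by
      filter_upwards [(isOpen_ch_target p).mem_nhds hy] with z hz
      rw [Function.comp, coordField_symm p hz, A.etaC_apply p hz]
    rw [he.fderiv_eq]
    have hdf : DifferentiableAt ℝ (A.etaC p) y :=
      ((A.contDiffOn_etaC p).contDiffAt ((isOpen_ch_target p).mem_nhds hy)).differentiableAt
        (by simp)
    rw [fderiv_clm_apply hdf (differentiableAt_const b)]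
    simp
  rw [key, key] at hd
  rw [areaC, ← hd]
  simp only [map_zero]
  ring

/-- No regularity of `J` is part of the structure. It is recovered here from `dη`: the form
`⟨J(·),·⟩` is half the antisymmetrized derivative of a smooth form. -/
lemma continuousOn_areaC (p : M) :
    ContinuousOn (fun z : E3 × E3 × E3 => A.areaC p z.1 z.2.1 z.2.2) ((ch p).target ×ˢ univ) := by
  have h : ContinuousOn (fun z : E3 × E3 × E3 => (1 / 2 : ℝ) *
      (fderiv ℝ (A.etaC p) z.1 z.2.1 z.2.2 - fderiv ℝ (A.etaC p) z.1 z.2.2 z.2.1))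
      ((ch p).target ×ˢ univ) := by
    have hc : ContinuousOn (fun z : E3 × E3 × E3 => fderiv ℝ (A.etaC p) z.1)
        ((ch p).target ×ˢ univ) :=
      ((A.contDiffOn_etaC p).continuousOn_fderiv_of_isOpen (isOpen_ch_target p) (by simp)).comp
        continuousOn_fst (fun z hz => hz.1)
    have h1 : ContinuousOn (fun z : E3 × E3 × E3 => z.2.1) ((ch p).target ×ˢ univ) := by fun_prop
    have h2 : ContinuousOn (fun z : E3 × E3 × E3 => z.2.2) ((ch p).target ×ˢ univ) := by fun_prop
    exact continuousOn_const.mul (((hc.clm_apply h1).clm_apply h2).sub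
      ((hc.clm_apply h2).clm_apply h1))
  refine h.congr fun z hz => ?_
  beta_reduce
  rw [A.fderiv_etaC_sub p hz.1]
  ring

end ContactSubRiemannian

end ChartGeometry

end SubRiem

namespace SubRiem

/-! ### Linear algebra in a tangent space and the density of the sub-Riemannian area. -/

section Pointwise

variable {M : Type*} [TopologicalSpace M] [ChartedSpace E3 M] [IsManifold (𝓡 3) ∞ M]

lemma Metric3.eq_zero_of_inner_self (g : Metric3 M) {p : M} {u : TangentSpace (𝓡 3) p}
    (h : g.inner p u u = 0) : u = 0 := by
  by_contra hu
  exact (g.pos p u hu).ne' h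

namespace ContactSubRiemannian

variable (A : ContactSubRiemannian M) {p : M}

lemma g_T' (u : TangentSpace (𝓡 3) p) : A.g.inner p u (A.T p) = A.η p u := by
  rw [A.g.symm, A.g_T]

lemma inner_J_skew {u w : TangentSpace (𝓡 3) p} (hu : A.η p u = 0) (hw : A.η p w = 0) :
    A.g.inner p (A.J p u) w = -A.g.inner p u (A.J p w) := by
  have h1 := A.J_isometry p (A.J p u) w (A.J_horizontal p u) hw
  rw [A.J_sq p u hu] at h1
  rw [← h1]
  simp

lemma inner_J_self {u : TangentSpace (𝓡 3) p} (hu : A.η p u = 0) :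
    A.g.inner p (A.J p u) u = 0 := by
  have := A.inner_J_skew hu hu
  rw [A.g.symm p u] at this
  linarith

lemma inner_self_of_norm_eq_one {u : TangentSpace (𝓡 3) p} (h : A.norm p u = 1) :
    A.g.inner p u u = 1 := by
  rw [norm, Real.sqrt_eq_one] at h
  exact h

/-- The decomposition of a vector in the orthonormal basis `(w, J(w), T)`. -/
theorem eq_of_unit_horizontal {w : TangentSpace (𝓡 3) p} (hw : A.η p w = 0)
    (hw1 : A.g.inner p w w = 1) (u : TangentSpace (𝓡 3) p) :
    u = A.g.inner p u w • w + A.g.inner p u (A.J p w) • A.J p w + A.η p u • A.T p := by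
  set x := u - (A.g.inner p u w • w + A.g.inner p u (A.J p w) • A.J p w + A.η p u • A.T p)
    with hx
  have hJJ : A.g.inner p (A.J p w) (A.J p w) = 1 := by rw [A.J_isometry p w w hw hw, hw1]
  have hJw : A.g.inner p (A.J p w) w = 0 := A.inner_J_self hw
  have hwJ : A.g.inner p w (A.J p w) = 0 := by rw [A.g.symm, hJw]
  have hTJ : A.g.inner p (A.T p) (A.J p w) = 0 := by rw [A.g_T, A.J_horizontal]
  have hTw : A.g.inner p (A.T p) w = 0 := by rw [A.g_T, hw]
  have h1 : A.g.inner p x w = 0 := by simp [hx, hw1, hJw, hTw]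
  have h2 : A.g.inner p x (A.J p w) = 0 := by simp [hx, hwJ, hJJ, hTJ]
  have h3 : A.g.inner p x (A.T p) = 0 := by
    simp [hx, A.g_T', hw, A.J_horizontal, A.η_T]
  suffices x = 0 from sub_eq_zero.1 this
  by_contra hx0
  have hxx : A.g.inner p x x ≠ 0 := (A.g.pos p x hx0).ne'
  -- A nonzero remainder orthogonal to `w`, `J w` and `T` would give four independent vectors in
  -- dimension three.
  have hli : LinearIndependent ℝ ![w, A.J p w, A.T p, x] := by
    rw [Fintype.linearIndependent_iff]
    intro c hc
    simp only [Fin.sum_univ_four] at hc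
    have e1 := congrArg (fun z => A.g.inner p w z) hc
    have e2 := congrArg (fun z => A.g.inner p (A.J p w) z) hc
    have e3 := congrArg (fun z => A.g.inner p (A.T p) z) hc
    have e4 := congrArg (fun z => A.g.inner p x z) hc
    have h1' : A.g.inner p w x = 0 := by rw [A.g.symm, h1]
    have h2' : A.g.inner p (A.J p w) x = 0 := by rw [A.g.symm, h2]
    have h3' : A.g.inner p (A.T p) x = 0 := by rw [A.g.symm, h3]
    simp [hw1, hwJ, h1', A.g_T', hw] at e1
    simp [hJw, hJJ, h2', A.g_T', A.J_horizontal] at e2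
    simp [hTw, hTJ, h3', A.g_TT] at e3
    simp [h1, h2, h3, hxx] at e4
    intro i
    fin_cases i <;> simp [e1, e2, e3, e4]
  have := LinearIndependent.fintype_card_le_finrank (R := ℝ) (M := E3) hli
  simp at this

/-- Skew-symmetry of `J` extends to vectors `u` that are not horizontal, because `J T = 0`; the
vector `∂F/∂ε` is of this kind. -/
lemma inner_J_of_unit_horizontal {w : TangentSpace (𝓡 3) p} (hw : A.η p w = 0)
    (hw1 : A.g.inner p w w = 1) (u : TangentSpace (𝓡 3) p) :
    A.g.inner p (A.J p u) w = -A.g.inner p u (A.J p w) := by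
  have hJw : A.g.inner p (A.J p w) w = 0 := A.inner_J_self hw
  have h := congrArg (A.J p) (A.eq_of_unit_horizontal hw hw1 u)
  rw [h]
  simp [A.J_sq p w hw, A.J_T, hJw, hw1]

lemma inner_self_of_unit_horizontal {w : TangentSpace (𝓡 3) p} (hw : A.η p w = 0)
    (hw1 : A.g.inner p w w = 1) (u : TangentSpace (𝓡 3) p) :
    A.g.inner p u u
      = A.g.inner p u w ^ 2 + A.g.inner p (A.J p u) w ^ 2 + A.η p u ^ 2 := by
  have h := congrArg (fun z => A.g.inner p u z) (A.eq_of_unit_horizontal hw hw1 u)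
  simp only [map_add, map_smul, smul_eq_mul, A.g_T'] at h
  rw [h, A.inner_J_of_unit_horizontal hw hw1]
  ring

lemma cross_of_horizontal {u w : TangentSpace (𝓡 3) p} (hw : A.η p w = 0) :
    A.cross p u w = A.g.inner p (A.J p u) w • A.T p + A.η p u • A.J p w := by
  simp [cross, hw]

lemma norm_smul_eq (c : ℝ) (u : TangentSpace (𝓡 3) p) :
    A.norm p (c • u) = |c| * A.norm p u := by
  simp only [norm, map_smul, smul_apply, smul_eq_mul]
  rw [← mul_assoc, Real.sqrt_mul (mul_self_nonneg c), Real.sqrt_mul_self_eq_abs]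

lemma norm_J {w : TangentSpace (𝓡 3) p} (hw : A.η p w = 0) (hw1 : A.g.inner p w w = 1) :
    A.norm p (A.J p w) = 1 := by
  rw [norm, A.J_isometry p w w hw hw, hw1, Real.sqrt_one]

lemma norm_cross {u w : TangentSpace (𝓡 3) p} (hw : A.η p w = 0) (hw1 : A.g.inner p w w = 1) :
    A.norm p (A.cross p u w) = Real.sqrt (A.g.inner p (A.J p u) w ^ 2 + A.η p u ^ 2) := by
  have hJJ : A.g.inner p (A.J p w) (A.J p w) = 1 := by rw [A.J_isometry p w w hw hw, hw1]
  have hTJ : A.g.inner p (A.T p) (A.J p w) = 0 := by rw [A.g_T, A.J_horizontal]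
  have hJT : A.g.inner p (A.J p w) (A.T p) = 0 := by rw [A.g_T', A.J_horizontal]
  rw [norm, A.cross_of_horizontal hw]
  simp [hTJ, hJT, hJJ, A.g_TT]
  congr 1; ring

section Surface

variable {f : ℝ × ℝ → M} {D : Set (ℝ × ℝ)} {x : ℝ × ℝ}

lemma inner_normal_T (hw : A.η (f x) (d₂ f D x) = 0) :
    A.g.inner (f x) (A.normal f D x) (A.T (f x))
      = (A.norm (f x) (A.cross (f x) (d₁ f D x) (d₂ f D x)))⁻¹ *
        A.g.inner (f x) (A.J _ (d₁ f D x)) (d₂ f D x) := by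
  rw [normal]
  simp [A.g_T', A.cross_of_horizontal hw, A.η_T, A.J_horizontal]

lemma normalH_eq (hw : A.η (f x) (d₂ f D x) = 0) :
    A.normalH f D x = ((A.norm (f x) (A.cross (f x) (d₁ f D x) (d₂ f D x)))⁻¹ *
        A.η (f x) (d₁ f D x)) • A.J (f x) (d₂ f D x) := by
  rw [normalH, A.inner_normal_T hw, normal]
  nth_rw 2 [A.cross_of_horizontal hw]
  module

lemma norm_normalH (hw : A.η (f x) (d₂ f D x) = 0)
    (hw1 : A.g.inner (f x) (d₂ f D x) (d₂ f D x) = 1) :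
    A.norm (f x) (A.normalH f D x) = (A.norm (f x) (A.cross (f x) (d₁ f D x) (d₂ f D x)))⁻¹ *
        |A.η (f x) (d₁ f D x)| := by
  rw [A.normalH_eq hw, A.norm_smul_eq, A.norm_J hw hw1, mul_one, abs_mul, abs_inv,
    abs_of_nonneg (a := A.norm _ _) (Real.sqrt_nonneg _)]

lemma norm_cross_pos (hw : A.η (f x) (d₂ f D x) = 0)
    (hw1 : A.g.inner (f x) (d₂ f D x) (d₂ f D x) = 1) (hv : A.η (f x) (d₁ f D x) ≠ 0) :
    0 < A.norm (f x) (A.cross (f x) (d₁ f D x) (d₂ f D x)) := by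
  rw [A.norm_cross hw hw1]
  positivity

/-- The density of the sub-Riemannian area. -/
theorem norm_normalH_mul_areaElement (hw : A.η (f x) (d₂ f D x) = 0)
    (hw1 : A.g.inner (f x) (d₂ f D x) (d₂ f D x) = 1) :
    A.norm (f x) (A.normalH f D x) * A.areaElement f D x = |A.η (f x) (d₁ f D x)| := by
  -- Lagrange's identity: as `d₂` is unit and horizontal, `|d₁| ^ 2 - ⟨d₁, d₂⟩ ^ 2` is `⟨J d₁, d₂⟩ ^
  -- 2 + η(d₁) ^ 2`, the squared length of the cross product. This length then cancels against the
  -- denominator of `|N_h|`.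
  have hae : A.areaElement f D x = A.norm (f x) (A.cross (f x) (d₁ f D x) (d₂ f D x)) := by
    rw [areaElement, hw1, A.norm_cross hw hw1, A.inner_self_of_unit_horizontal hw hw1 (d₁ f D x)]
    congr 1; ring
  rw [A.norm_normalH hw hw1, hae]
  -- If `η(d₁) = 0` both sides are zero, even when the cross product vanishes and its inverse length
  -- takes the default value `0`.
  by_cases hv : A.η (f x) (d₁ f D x) = 0
  · simp [hv]
  · have := (A.norm_cross_pos hw hw1 hv).ne'
    field_simp

lemma gaussH_eq (hw : A.η (f x) (d₂ f D x) = 0)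
    (hw1 : A.g.inner (f x) (d₂ f D x) (d₂ f D x) = 1) (hv : A.η (f x) (d₁ f D x) ≠ 0) :
    A.gaussH f D x = (|A.η (f x) (d₁ f D x)|⁻¹ * A.η (f x) (d₁ f D x)) •
      A.J (f x) (d₂ f D x) := by
  have hc := (A.norm_cross_pos hw hw1 hv).ne'
  rw [gaussH, A.norm_normalH hw hw1, A.normalH_eq hw, smul_smul]
  congr 1
  field_simp

/-- The normal lies in the span of `T` and `J(d₂)`, so `ν_h = ± J(d₂)` and applying `J` once more
gives `∓ d₂`. The sign is that of `η(d₁)`. -/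
lemma fieldZ_eq (hw : A.η (f x) (d₂ f D x) = 0)
    (hw1 : A.g.inner (f x) (d₂ f D x) (d₂ f D x) = 1) (hv : A.η (f x) (d₁ f D x) ≠ 0) :
    A.fieldZ f D x = (-(|A.η (f x) (d₁ f D x)|⁻¹ * A.η (f x) (d₁ f D x))) • d₂ f D x := by
  rw [fieldZ, A.gaussH_eq hw hw1 hv, map_smul, A.J_sq _ _ hw]
  module

end Surface

end ContactSubRiemannian

end Pointwise

/-! ### Differentials of maps into the manifold, read in a chart. -/

section Coordinates

variable {M : Type*} [TopologicalSpace M] [ChartedSpace E3 M] [IsManifold (𝓡 3) ∞ M]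
  {X : Type*} [NormedAddCommGroup X] [NormedSpace ℝ X] {f : X → M} {s : Set X} {x : X}

lemma contDiffWithinAt_ch_comp (p : M) {n : ℕ∞} (hf : ContMDiffWithinAt 𝓘(ℝ, X) (𝓡 3) n f s x)
    (hx : f x ∈ (ch p).source) : ContDiffWithinAt ℝ n (ch p ∘ f) s x := by
  have h : ContMDiffAt (𝓡 3) 𝓘(ℝ, E3) n (ch p) (f x) :=
    contMDiffAt_extChartAt' (by simpa using hx)
  exact (h.comp_contMDiffWithinAt x hf).contDiffWithinAt

lemma hasFDerivWithinAt_ch_comp (p : M) {f' : X →L[ℝ] TangentSpace (𝓡 3) (f x)}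
    (hf : HasMFDerivWithinAt 𝓘(ℝ, X) (𝓡 3) f s x f') (hx : f x ∈ (ch p).source) :
    HasFDerivWithinAt (ch p ∘ f) ((chartFwd p (f x)).comp f') s x := by
  have h := (mdifferentiableAt_extChartAt (I := 𝓡 3) (x := p)
    (by simpa using hx)).hasMFDerivAt
  exact (h.comp_hasMFDerivWithinAt x hf).hasFDerivWithinAt

/-- The differential of a map, in coordinates. -/
lemma chartFwd_mfderivWithin (p : M) (hf : MDifferentiableWithinAt 𝓘(ℝ, X) (𝓡 3) f s x)
    (hs : UniqueDiffWithinAt ℝ s x) (hx : f x ∈ (ch p).source) (e : X) :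
    chartFwd p (f x) (mfderivWithin 𝓘(ℝ, X) (𝓡 3) f s x e) = fderivWithin ℝ (ch p ∘ f) s x e := by
  rw [(hasFDerivWithinAt_ch_comp p hf.hasMFDerivWithinAt hx).fderivWithin hs]
  rfl

lemma contMDiffWithinAt_of_ch_comp (p : M) {n : ℕ∞} (hf : ContinuousWithinAt f s x)
    (h : ContDiffWithinAt ℝ n (ch p ∘ f) s x) (hx : f x ∈ (ch p).source) :
    ContMDiffWithinAt 𝓘(ℝ, X) (𝓡 3) n f s x := by
  have h1 : ContMDiffAt 𝓘(ℝ, E3) (𝓡 3) n (ch p).symm ((ch p ∘ f) x) :=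
    (contMDiffAt_ch_symm p ((ch p).map_source hx)).of_le (mod_cast le_top)
  refine (h1.comp_contMDiffWithinAt x h.contMDiffWithinAt).congr_of_eventuallyEq ?_ ?_
  · filter_upwards [hf ((isOpen_ch_source p).mem_nhds hx)] with z hz
    exact ((ch p).left_inv hz).symm
  · exact ((ch p).left_inv hx).symm

end Coordinates

end SubRiem

/-! ### The Reeb field is geodesic and, in the Sasakian case, Killing. -/

namespace SubRiem

variable {M : Type*} [TopologicalSpace M] [ChartedSpace E3 M] [IsManifold (𝓡 3) ∞ M]

lemma hasFDerivAt_metricC (g : Metric3 M) (p : M) {y : E3} (hy : y ∈ (ch p).target) :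
    HasFDerivAt (metricC g p) (fderiv ℝ (metricC g p) y) y :=
  (((contDiffOn_metricC g p).contDiffAt ((isOpen_ch_target p).mem_nhds hy)).differentiableAt
    (by simp)).hasFDerivAt

lemma fderiv_metricInChart (g : Metric3 M) (p : M) {y : E3} (hy : y ∈ (ch p).target)
    (u v w : E3) :
    fderiv ℝ (fun y => metricInChart g p y u v) y w = fderiv ℝ (metricC g p) y w u v := by
  have h := ((hasFDerivAt_metricC g p hy).clm_apply (hasFDerivAt_const u y)).clm_apply
    (hasFDerivAt_const v y)
  simp only [← metricC_eq]
  rw [h.fderiv]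
  simp

lemma fderiv_metricC_symm (g : Metric3 M) (p : M) {y : E3} (hy : y ∈ (ch p).target)
    (u v w : E3) :
    fderiv ℝ (metricC g p) y w u v = fderiv ℝ (metricC g p) y w v u := by
  rw [← fderiv_metricInChart g p hy, ← fderiv_metricInChart g p hy]
  simp only [← metricC_eq]
  congr 1
  simp_rw [metricC_symm g p _ u v]

namespace ContactSubRiemannian

variable (A : ContactSubRiemannian M)

lemma hasFDerivAt_reebC (p : M) {y : E3} (hy : y ∈ (ch p).target) :
    HasFDerivAt (A.reebC p) (fderiv ℝ (A.reebC p) y) y :=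
  (((A.contDiffOn_reebC p).contDiffAt ((isOpen_ch_target p).mem_nhds hy)).differentiableAt
    (by simp)).hasFDerivAt

lemma hasFDerivAt_etaC (p : M) {y : E3} (hy : y ∈ (ch p).target) :
    HasFDerivAt (A.etaC p) (fderiv ℝ (A.etaC p) y) y :=
  (((A.contDiffOn_etaC p).contDiffAt ((isOpen_ch_target p).mem_nhds hy)).differentiableAt
    (by simp)).hasFDerivAt

lemma fderiv_etaC (p : M) {y : E3} (hy : y ∈ (ch p).target) (u w : E3) :
    fderiv ℝ (A.etaC p) y u w = fderiv ℝ (metricC A.g p) y u (A.reebC p y) w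
      + metricC A.g p y (fderiv ℝ (A.reebC p) y u) w := by
  have h := (hasFDerivAt_metricC A.g p hy).clm_apply (A.hasFDerivAt_reebC p hy)
  change fderiv ℝ (fun y => metricC A.g p y (A.reebC p y)) y u w = _
  rw [h.fderiv]
  simp [add_comm]

lemma areaC_reebC (p : M) {y : E3} (hy : y ∈ (ch p).target) (w : E3) :
    A.areaC p y (A.reebC p y) w = 0 := by
  rw [areaC, A.chartInv_reebC p hy, A.J_T]
  simp

/-- The Lie derivative of the contact form along the Reeb field vanishes. -/
lemma lieDeriv_etaC (p : M) {y : E3} (hy : y ∈ (ch p).target) (w : E3) :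
    fderiv ℝ (A.etaC p) y (A.reebC p y) w + A.etaC p y (fderiv ℝ (A.reebC p) y w) = 0 := by
  -- Cartan's formula: the contraction of `dη` with `T` vanishes because `J T = 0`, and the function
  -- `η(T) = 1` has zero differential.
  have h1 := A.fderiv_etaC_sub p hy (A.reebC p y) w
  rw [A.areaC_reebC p hy] at h1
  have h2 : HasFDerivAt (fun z => A.etaC p z (A.reebC p z)) (0 : E3 →L[ℝ] ℝ) y := by
    refine (hasFDerivAt_const (1 : ℝ) y).congr_of_eventuallyEq ?_
    filter_upwards [(isOpen_ch_target p).mem_nhds hy] with z hz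
    exact A.etaC_reebC p hz
  have h3 := ((A.hasFDerivAt_etaC p hy).clm_apply (A.hasFDerivAt_reebC p hy)).unique h2
  have h4 := DFunLike.congr_fun h3 w
  simp at h4
  linarith

/-- The Reeb field satisfies the geodesic equation. -/
lemma reebC_geodesic (p : M) {y : E3} (hy : y ∈ (ch p).target) (w : E3) :
    metricC A.g p y (fderiv ℝ (A.reebC p) y (A.reebC p y)) w
      + fderiv ℝ (metricC A.g p) y (A.reebC p y) (A.reebC p y) w
      - (1 / 2) * fderiv ℝ (metricC A.g p) y w (A.reebC p y) (A.reebC p y) = 0 := by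
  -- The invariance of `η = g(T, ·)` under `T` contains the term `g(T, DT w)`, which is expressed by
  -- differentiating `g(T, T) = 1` in the direction `w`. What remains is `∇_T T = 0`.
  have h1 := A.lieDeriv_etaC p hy w
  have h2 : HasFDerivAt (fun z => A.etaC p z (A.reebC p z)) (0 : E3 →L[ℝ] ℝ) y := by
    refine (hasFDerivAt_const (1 : ℝ) y).congr_of_eventuallyEq ?_
    filter_upwards [(isOpen_ch_target p).mem_nhds hy] with z hz
    exact A.etaC_reebC p hz
  have h3 := ((A.hasFDerivAt_etaC p hy).clm_apply (A.hasFDerivAt_reebC p hy)).unique h2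
  have h4 := DFunLike.congr_fun h3 w
  simp only [add_apply, ContinuousLinearMap.comp_apply, ContinuousLinearMap.flip_apply,
    A.fderiv_etaC p hy, zero_apply] at h4
  rw [A.fderiv_etaC p hy] at h1
  have h5 : A.etaC p y (fderiv ℝ (A.reebC p) y w)
      = metricC A.g p y (fderiv ℝ (A.reebC p) y w) (A.reebC p y) := by
    rw [etaC, metricC_symm]
  linarith

/-- A local flow of the Reeb field, in the preferred chart at `p`, together with its space
derivative. -/
structure ReebFlow (p : M) where
  /-- the radius of the set of initial values -/
  r : ℝ
  /-- the time of existence -/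
  τ : ℝ
  /-- the flow -/
  α : E3 → ℝ → E3
  /-- the space derivative of the flow -/
  Y : E3 → ℝ → E3 →L[ℝ] E3
  r_pos : 0 < r
  τ_pos : 0 < τ
  prop : ∀ x ∈ Metric.ball (ch p p) r, α x 0 = x ∧ Y x 0 = ContinuousLinearMap.id ℝ E3 ∧
    ∀ t ∈ Ioo (-τ) τ, α x t ∈ (ch p).target ∧ HasDerivAt (α x) (A.reebC p (α x t)) t ∧
      HasDerivAt (Y x) ((fderiv ℝ (A.reebC p) (α x t)).comp (Y x t)) t ∧
      HasFDerivAt (fun x' => α x' t) (Y x t) x ∧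
      ContinuousAt (Function.uncurry α) (x, t) ∧ ContinuousAt (Function.uncurry Y) (x, t)

lemma nonempty_reebFlow (p : M) : Nonempty (A.ReebFlow p) := by
  have hy : ch p p ∈ (ch p).target := (ch p).map_source (mem_extChartAt_source p)
  obtain ⟨r, hr, τ, hτ, α, Y, h⟩ := exists_flow_with_fderiv
    (((A.contDiffOn_reebC p).contDiffAt ((isOpen_ch_target p).mem_nhds hy)).of_le
      ENat.LEInfty.out) ((isOpen_ch_target p).mem_nhds hy)
  exact ⟨⟨r, τ, α, Y, hr, hτ, h⟩⟩

namespace ReebFlow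

variable {A} {p : M} (Φ : A.ReebFlow p)

/-- The initial points of the local flow. -/
def dom : Set M := (ch p).source ∩ ch p ⁻¹' Metric.ball (ch p p) Φ.r

/-- The time `t` map of the local flow. -/
def map (t : ℝ) (q : M) : M := (ch p).symm (Φ.α (ch p q) t)

lemma isOpen_dom : IsOpen Φ.dom :=
  (continuousOn_extChartAt p).isOpen_inter_preimage (isOpen_ch_source p) Metric.isOpen_ball

lemma mem_dom : p ∈ Φ.dom := ⟨mem_extChartAt_source p, Metric.mem_ball_self Φ.r_pos⟩

lemma zero_mem : (0 : ℝ) ∈ Ioo (-Φ.τ) Φ.τ := ⟨by linarith [Φ.τ_pos], Φ.τ_pos⟩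

variable {q : M} {t : ℝ}

lemma map_mem_source (hq : q ∈ Φ.dom) (ht : t ∈ Ioo (-Φ.τ) Φ.τ) : Φ.map t q ∈ (ch p).source :=
  (ch p).map_target ((Φ.prop _ hq.2).2.2 t ht).1

lemma ch_map (hq : q ∈ Φ.dom) (ht : t ∈ Ioo (-Φ.τ) Φ.τ) : ch p (Φ.map t q) = Φ.α (ch p q) t :=
  (ch p).right_inv ((Φ.prop _ hq.2).2.2 t ht).1

lemma map_zero (hq : q ∈ Φ.dom) : Φ.map 0 q = q := by
  rw [map, (Φ.prop _ hq.2).1]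
  exact (ch p).left_inv hq.1

lemma hasMFDerivAt_map (hq : q ∈ Φ.dom) (ht : t ∈ Ioo (-Φ.τ) Φ.τ) :
    HasMFDerivAt 𝓘(ℝ, ℝ) (𝓡 3) (fun t => Φ.map t q) t
      ((1 : ℝ →L[ℝ] ℝ).smulRight (A.T (Φ.map t q))) := by
  obtain ⟨hy, hd, -⟩ := (Φ.prop _ hq.2).2.2 t ht
  have h1 := ((contMDiffAt_ch_symm p hy).mdifferentiableAt (by simp)).hasMFDerivAt
  have h2 := h1.comp t hd.hasFDerivAt.hasMFDerivAt
  refine h2.congr_mfderiv ?_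
  ext
  change chartInv p (Φ.α (ch p q) t) ((1 : ℝ) • A.reebC p (Φ.α (ch p q) t))
    = (1 : ℝ) • A.T (Φ.map t q)
  rw [map_smul, A.chartInv_reebC p hy]
  rfl

/-- The flow preserves the contact form. -/
lemma etaC_Y (hq : q ∈ Φ.dom) (ht : t ∈ Ioo (-Φ.τ) Φ.τ) (u : E3) :
    A.etaC p (Φ.α (ch p q) t) (Φ.Y (ch p q) t u) = A.etaC p (ch p q) u := by
  obtain ⟨h0, hY0, h⟩ := Φ.prop _ hq.2
  -- The derivative in time is the Lie derivative of `η` along `T`, evaluated at the transported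
  -- vector.
  have hder : ∀ s ∈ Ioo (-Φ.τ) Φ.τ, HasDerivAt
      (fun s => A.etaC p (Φ.α (ch p q) s) (Φ.Y (ch p q) s u)) 0 s := by
    intro s hs
    obtain ⟨hy, hd, hYd, -⟩ := h s hs
    have h1 := (A.hasFDerivAt_etaC p hy).comp_hasDerivAt s hd
    have h2 := hYd.clm_apply (hasDerivAt_const s u)
    refine (h1.clm_apply h2).congr_deriv ?_
    simpa using A.lieDeriv_etaC p hy (Φ.Y (ch p q) s u)
  have := (convex_Ioo (-Φ.τ) Φ.τ).is_const_of_fderivWithin_eq_zero (𝕜 := ℝ)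
    (f := fun s => A.etaC p (Φ.α (ch p q) s) (Φ.Y (ch p q) s u))
    (fun s hs => (hder s hs).differentiableAt.differentiableWithinAt) (fun s hs => by
      rw [fderivWithin_of_isOpen isOpen_Ioo hs, (hder s hs).hasFDerivAt.fderiv]
      ext; simp) ht Φ.zero_mem
  beta_reduce at this
  rw [h0, hY0] at this
  exact this

lemma chartFwd_mfderiv_map (hq : q ∈ Φ.dom) (ht : t ∈ Ioo (-Φ.τ) Φ.τ)
    (u : TangentSpace (𝓡 3) q) :
    chartFwd p (Φ.map t q) (mfderiv (𝓡 3) (𝓡 3) (Φ.map t) q u)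
      = Φ.Y (ch p q) t (chartFwd p q u) := by
  obtain ⟨hy, -, -, hd, -⟩ := (Φ.prop _ hq.2).2.2 t ht
  have h1 := ((contMDiffAt_ch_symm p hy).mdifferentiableAt (by simp)).hasMFDerivAt
  have h0 := (mdifferentiableAt_extChartAt (I := 𝓡 3) (x := p) (y := q)
    (by simpa using hq.1)).hasMFDerivAt
  have h2 := HasMFDerivAt.comp q (g := fun y => Φ.α y t) hd.hasMFDerivAt h0
  have h3 := HasMFDerivAt.comp q (g := (ch p).symm) (f := fun q => Φ.α (ch p q) t) h1 h2
  have h4 : mfderiv (𝓡 3) (𝓡 3) (Φ.map t) q = _ := h3.mfderiv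
  rw [h4]
  exact chartFwd_chartInv p hy _

/-- The flow of a Sasakian manifold acts on the horizontal vectors by isometries. -/
lemma metricC_Y (hA : A.IsSasakian) (hq : q ∈ Φ.dom) (ht : t ∈ Ioo (-Φ.τ) Φ.τ) {u : E3}
    (hu : A.etaC p (ch p q) u = 0) :
    metricC A.g p (Φ.α (ch p q) t) (Φ.Y (ch p q) t u) (Φ.Y (ch p q) t u)
      = metricC A.g p (ch p q) u u := by
  -- The Sasakian hypothesis is applied to the time `t` map of the local flow; the integral curves
  -- that it requires are the flow lines.
  have hs := (hA t Φ.dom (Φ.map t) Φ.isOpen_dom ?_).2 q hq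
  · obtain ⟨v, rfl⟩ : ∃ v : TangentSpace (𝓡 3) q, chartFwd p q v = u := by
      have h : (ch p).symm (ch p q) = q := (ch p).left_inv hq.1
      have hy := (ch p).map_source hq.1
      generalize ch p q = y at h hy
      subst h
      exact ⟨chartInv p y u, chartFwd_chartInv p hy u⟩
    rw [← A.eta_eq_etaC p hq.1] at hu
    have h := (hs v v hu hu).2.1
    rwa [inner_eq_metricC A.g p (Φ.map_mem_source hq ht), inner_eq_metricC A.g p hq.1,
      Φ.chartFwd_mfderiv_map hq ht, Φ.ch_map hq ht] at h
  · intro q hq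
    refine ⟨fun s => Φ.map s q, Φ.map_zero hq, rfl, fun s hs => ?_⟩
    have : s ∈ Ioo (-Φ.τ) Φ.τ := (ordConnected_Ioo.uIcc_subset Φ.zero_mem ht) hs
    exact (Φ.hasMFDerivAt_map hq this).hasMFDerivWithinAt

end ReebFlow

/-- In a Sasakian manifold the Reeb field is a Killing field. -/
theorem killing (hA : A.IsSasakian) (p : M) (u : E3) :
    fderiv ℝ (metricC A.g p) (ch p p) (A.reebC p (ch p p)) u u
      + 2 * metricC A.g p (ch p p) (fderiv ℝ (A.reebC p) (ch p p) u) u = 0 := by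
  have hy : ch p p ∈ (ch p).target := (ch p).map_source (mem_extChartAt_source p)
  obtain ⟨Φ⟩ := A.nonempty_reebFlow p
  set y := ch p p with hydef
  set T := A.reebC p y
  -- For horizontal directions, the isometry property is differentiated at time zero.
  have hor : ∀ h : E3, A.etaC p y h = 0 → fderiv ℝ (metricC A.g p) y T h h
      + 2 * metricC A.g p y (fderiv ℝ (A.reebC p) y h) h = 0 := by
    intro h hh
    obtain ⟨h0, hY0, hp⟩ := Φ.prop y Φ.mem_dom.2
    obtain ⟨-, hd, hYd, -⟩ := hp 0 Φ.zero_mem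
    have hm : HasFDerivAt (metricC A.g p) (fderiv ℝ (metricC A.g p) y) (Φ.α y 0) := by
      rw [h0]; exact hasFDerivAt_metricC A.g p hy
    have h1 := HasFDerivAt.comp_hasDerivAt (𝕜 := ℝ) (f := Φ.α y) (l := metricC A.g p) (0 : ℝ) hm hd
    have h2 := hYd.clm_apply (hasDerivAt_const 0 h)
    have h3 := (h1.clm_apply h2).clm_apply h2
    have h4 : HasDerivAt (fun t => metricC A.g p (Φ.α y t) (Φ.Y y t h) (Φ.Y y t h)) 0 0 := by
      refine (hasDerivAt_const (0 : ℝ) (metricC A.g p y h h)).congr_of_eventuallyEq ?_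
      filter_upwards [isOpen_Ioo.mem_nhds Φ.zero_mem] with t ht
      exact Φ.metricC_Y hA Φ.mem_dom ht hh
    have h5 := h3.unique h4
    simp [h0, hY0] at h5
    rw [metricC_symm A.g p y h] at h5
    linarith
  -- The invariance of `η` says that the Lie derivative of `g` vanishes when one argument is `T`.
  -- Together with the horizontal case and `u = h + k T`, this covers all vectors.
  have hTw : ∀ w, fderiv ℝ (metricC A.g p) y T T w + metricC A.g p y (fderiv ℝ (A.reebC p) y T) w
      + metricC A.g p y T (fderiv ℝ (A.reebC p) y w) = 0 := by
    intro w
    have := A.lieDeriv_etaC p hy w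
    rwa [A.fderiv_etaC p hy] at this
  set k := A.etaC p y u
  have hu : u = (u - k • T) + k • T := by simp
  have h1 := hor (u - k • T) (by
    rw [map_sub, map_smul, A.etaC_reebC p hy]; simp [k])
  set h := u - k • T
  have h2 := hTw h
  have h3 := hTw T
  have h4 := fderiv_metricC_symm A.g p hy h T T
  rw [hu]
  simp only [map_add, map_smul, add_apply, smul_apply,
    smul_eq_mul]
  rw [metricC_symm A.g p y _ (fderiv ℝ (A.reebC p) y h)] at h2
  rw [metricC_symm A.g p y T] at h3
  linear_combination h1 + 2 * k * h2 + k ^ 2 * h3 + k * h4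

end ContactSubRiemannian

end SubRiem

/-! ### Geodesics that start in the direction of the Reeb field. -/

namespace SubRiem

variable {M : Type*} [TopologicalSpace M] [ChartedSpace E3 M] [IsManifold (𝓡 3) ∞ M]

/-- The geodesic equation, in the chart at the point. -/
lemma isCovAcceleration_zero_iff (g : Metric3 M) (γ : ℝ → M) (s : Set ℝ) (t : ℝ) (p : M)
    (hp : γ t = p) (x₁ x₂ : E3) (h₁ : derivWithin (ch p ∘ γ) s t = x₁)
    (h₂ : derivWithin (derivWithin (ch p ∘ γ) s) s t = x₂) :
    IsCovAcceleration g γ s t 0 ↔ ∀ w : E3, metricC g p (ch p p) x₂ w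
      + fderiv ℝ (metricC g p) (ch p p) x₁ x₁ w
      - (1 / 2) * fderiv ℝ (metricC g p) (ch p p) w x₁ x₁ = 0 := by
  subst hp h₁ h₂
  have hy : ch (γ t) (γ t) ∈ (ch (γ t)).target := (ch (γ t)).map_source (mem_extChartAt_source _)
  have hin : ∀ u w : TangentSpace (𝓡 3) (γ t), g.inner (γ t) u w
      = metricC g (γ t) (ch (γ t) (γ t)) u w := by
    intro u w
    rw [inner_eq_metricC g (γ t) (mem_extChartAt_source _), chartFwd_self, chartFwd_self]
  refine forall_congr' fun w => ?_
  have e1 := fderiv_metricInChart g (γ t) hy (derivWithin (ch (γ t) ∘ γ) s t) w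
    (derivWithin (ch (γ t) ∘ γ) s t)
  have e2 := fderiv_metricInChart g (γ t) hy (derivWithin (ch (γ t) ∘ γ) s t)
    (derivWithin (ch (γ t) ∘ γ) s t) w
  rw [← e1, ← e2]
  have e3 := hin (derivWithin (derivWithin (ch (γ t) ∘ γ) s) s t) w
  have e4 : g.inner (γ t) 0 w = 0 := by
    rw [map_zero]; rfl
  constructor
  · intro h
    exact (congrArg (fun z => z + _ - _) e3.symm).trans (h.symm.trans e4)
  · intro h
    exact e4.trans (h.symm.trans (congrArg (fun z => z + _ - _) e3.symm))

namespace ContactSubRiemannian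

variable (A : ContactSubRiemannian M)

/-- The curve `γ` follows the Reeb field at constant speed `c` on the set of times `O`. -/
def FollowsReeb (γ : ℝ → M) (c : ℝ) (O : Set ℝ) : Prop :=
  ∀ s ∈ O, HasMFDerivAt 𝓘(ℝ, ℝ) (𝓡 3) γ s ((1 : ℝ →L[ℝ] ℝ).smulRight (c • A.T (γ s)))

variable {A} {γ : ℝ → M} {c : ℝ} {O : Set ℝ}

lemma FollowsReeb.hasDerivAt_ch (h : A.FollowsReeb γ c O) {s : ℝ} (hs : s ∈ O) (p : M)
    (hp : γ s ∈ (ch p).source) :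
    HasDerivAt (ch p ∘ γ) (c • A.reebC p (ch p (γ s))) s := by
  have h1 := (mdifferentiableAt_extChartAt (I := 𝓡 3) (x := p) (by simpa using hp)).hasMFDerivAt
  have h2 : HasFDerivAt (ch p ∘ γ) ((chartFwd p (γ s)).comp
      ((1 : ℝ →L[ℝ] ℝ).smulRight (c • A.T (γ s)))) s := (h1.comp s (h s hs)).hasFDerivAt
  refine h2.hasDerivAt.congr_deriv ?_
  rw [← A.chartFwd_T p hp]
  change chartFwd p (γ s) ((1 : ℝ) • (c • A.T (γ s))) = c • chartFwd p (γ s) (A.T (γ s))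
  rw [one_smul]
  exact (chartFwd p (γ s)).map_smul c (A.T (γ s))

/-- Bootstrapping: in a chart the velocity is a smooth function of the position, so each degree of
regularity of the curve yields the next. -/
lemma FollowsReeb.contMDiffAt (h : A.FollowsReeb γ c O) (hO : IsOpen O) {t : ℝ} (ht : t ∈ O) :
    ContMDiffAt 𝓘(ℝ, ℝ) (𝓡 3) 2 γ t := by
  set p := γ t with hp
  have hcont : ContinuousOn γ O := fun s hs => (h s hs).continuousAt.continuousWithinAt
  set O' := O ∩ γ ⁻¹' (ch p).source
  have hO' : IsOpen O' := hcont.isOpen_inter_preimage hO (isOpen_ch_source p)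
  have htO : t ∈ O' := ⟨ht, mem_extChartAt_source p⟩
  have hd : ∀ s ∈ O', HasDerivAt (ch p ∘ γ) (c • A.reebC p ((ch p ∘ γ) s)) s :=
    fun s hs => h.hasDerivAt_ch hs.1 p hs.2
  have hdiff : DifferentiableOn ℝ (ch p ∘ γ) O' :=
    fun s hs => (hd s hs).differentiableAt.differentiableWithinAt
  have hmaps : MapsTo (ch p ∘ γ) O' (ch p).target := fun s hs => (ch p).map_source hs.2
  have step : ∀ n : ℕ, ContDiffOn ℝ n (ch p ∘ γ) O' → ContDiffOn ℝ (n + 1) (ch p ∘ γ) O' := by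
    intro n hn
    rw [contDiffOn_succ_iff_deriv_of_isOpen hO']
    refine ⟨hdiff, by simp, ?_⟩
    have : ContDiffOn ℝ n (fun s => c • A.reebC p ((ch p ∘ γ) s)) O' :=
      (((A.contDiffOn_reebC p).of_le (ENat.LEInfty.out)).comp hn hmaps).const_smul c
    exact this.congr fun s hs => (hd s hs).deriv
  have h2 : ContDiffOn ℝ 2 (ch p ∘ γ) O' := by
    have h0 : ContDiffOn ℝ ((0 : ℕ) : WithTop ℕ∞) (ch p ∘ γ) O' :=
      contDiffOn_zero.2 hdiff.continuousOn
    have h1 := step 0 h0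
    rw [Nat.cast_zero, zero_add, ← Nat.cast_one] at h1
    have := step 1 h1
    rwa [Nat.cast_one, one_add_one_eq_two] at this
  have := contMDiffWithinAt_of_ch_comp (n := 2) (s := univ) (x := t) p
    (h t ht).continuousAt.continuousWithinAt
    (h2.contDiffAt (hO'.mem_nhds htO)).contDiffWithinAt (mem_extChartAt_source p)
  exact this.contMDiffAt univ_mem

/-- The geodesic expression is quadratic in the speed, so for the speed `c` it is `c ^ 2` times the
one of `T`, which vanishes. -/
lemma FollowsReeb.isCovAcceleration (h : A.FollowsReeb γ c O) (hO : IsOpen O)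
    (hI : Icc 0 1 ⊆ O) {t : ℝ} (ht : t ∈ Icc (0 : ℝ) 1) :
    IsCovAcceleration A.g γ (Icc 0 1) t 0 := by
  set p := γ t with hpdef
  set x : ℝ → E3 := ch p ∘ γ with hx
  have hy : ch p p ∈ (ch p).target := (ch p).map_source (mem_extChartAt_source p)
  have hU : UniqueDiffOn ℝ (Icc (0 : ℝ) 1) := uniqueDiffOn_Icc zero_lt_one
  have hev : ∀ᶠ s in 𝓝 t, HasDerivAt x (c • A.reebC p (x s)) s := by
    filter_upwards [(h t (hI ht)).continuousAt ((isOpen_ch_source p).mem_nhds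
      (mem_extChartAt_source p)), hO.mem_nhds (hI ht)] with s hs hs'
    exact h.hasDerivAt_ch hs' p hs
  have hxt : x t = ch p p := rfl
  have hx₁ : derivWithin x (Icc 0 1) t = c • A.reebC p (ch p p) := by
    rw [← hxt]
    exact hev.self_of_nhds.hasDerivWithinAt.derivWithin (hU t ht)
  have hx₂ : derivWithin (derivWithin x (Icc 0 1)) (Icc 0 1) t = c • (fderiv ℝ (A.reebC p) (ch p p) (c • A.reebC p (ch p p))) := by
    have he : derivWithin x (Icc 0 1) =ᶠ[𝓝[Icc 0 1] t] fun s => c • A.reebC p (x s) := by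
      filter_upwards [nhdsWithin_le_nhds hev, self_mem_nhdsWithin] with s hs hs'
      exact hs.hasDerivWithinAt.derivWithin (hU s hs')
    have h1 : HasDerivAt (fun s => A.reebC p (x s))
        (fderiv ℝ (A.reebC p) (x t) (c • A.reebC p (x t))) t :=
      HasFDerivAt.comp_hasDerivAt (𝕜 := ℝ) (f := x) (l := A.reebC p) t
        (A.hasFDerivAt_reebC p hy) hev.self_of_nhds
    rw [he.derivWithin_eq (he.self_of_nhdsWithin ht)]
    exact (h1.const_smul c).hasDerivWithinAt.derivWithin (hU t ht)
  refine (isCovAcceleration_zero_iff A.g γ (Icc 0 1) t p rfl _ _ hx₁ hx₂).2 fun w => ?_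
  have hg := A.reebC_geodesic p hy w
  simp only [map_smul, smul_apply, smul_eq_mul]
  linear_combination c ^ 2 * hg

lemma FollowsReeb.isGeodesicFrom (h : A.FollowsReeb γ c O) (hO : IsOpen O)
    (hI : Icc 0 1 ⊆ O) : IsGeodesicFrom A.g (γ 0) (c • A.T (γ 0)) γ := by
  refine ⟨fun t ht => (h.contMDiffAt hO (hI ht)).contMDiffWithinAt,
    fun t ht => h.isCovAcceleration hO hI ht, ?_⟩
  have h0 : (0 : ℝ) ∈ Icc (0 : ℝ) 1 := by simp
  have : velocity γ (Icc 0 1) 0 = c • A.T (γ 0) := by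
    rw [velocity, (h 0 (hI h0)).hasMFDerivWithinAt.mfderivWithin
      ((uniqueDiffOn_Icc zero_lt_one).uniqueMDiffOn 0 h0)]
    change (1 : ℝ) • (c • A.T (γ 0)) = _
    rw [one_smul]
  rw [this]

lemma ReebFlow.followsReeb {p q : M} (Φ : A.ReebFlow p) (hq : q ∈ Φ.dom) (c : ℝ) :
    A.FollowsReeb (fun s => Φ.map (s * c) q) c {s | s * c ∈ Ioo (-Φ.τ) Φ.τ} := by
  intro s hs
  have h1 := Φ.hasMFDerivAt_map hq hs
  have h2 : HasDerivAt (fun s : ℝ => s * c) c s := by simpa using (hasDerivAt_id s).mul_const c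
  have h3 := HasMFDerivAt.comp s (g := fun t => Φ.map t q) h1 h2.hasFDerivAt.hasMFDerivAt
  refine h3.congr_mfderiv ?_
  ext
  change ((1 : ℝ) * c) • A.T (Φ.map (s * c) q) = (1 : ℝ) • (c • A.T (Φ.map (s * c) q))
  rw [one_mul, one_smul]

/-- A geodesic that leaves in the direction of the Reeb field of a Sasakian manifold follows it. -/
theorem velocity_of_isGeodesicFrom (hA : A.IsSasakian) {q : M}
    (h : IsGeodesicFrom A.g q (c • A.T q) γ) {t : ℝ} (ht : t ∈ Icc (0 : ℝ) 1) :
    velocity γ (Icc 0 1) t = c • A.T (γ t) := by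
  obtain ⟨h2, hacc, h0⟩ := h
  have hU : UniqueDiffOn ℝ (Icc (0 : ℝ) 1) := uniqueDiffOn_Icc zero_lt_one
  have hvel : ∀ p : M, ∀ s ∈ Icc (0 : ℝ) 1, γ s ∈ (ch p).source →
      chartFwd p (γ s) (velocity γ (Icc 0 1) s) = derivWithin (ch p ∘ γ) (Icc 0 1) s := by
    intro p s hs hp
    rw [velocity, chartFwd_mfderivWithin p ((h2 s hs).mdifferentiableWithinAt (by simp)) (hU s hs) hp]
    rfl
  -- Two conservation laws: the geodesic equation tested against the velocity preserves the energy,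
  -- and tested against `T` it preserves the vertical component, thanks to the Killing equation.
  have key : ∀ s ∈ Icc (0 : ℝ) 1,
      HasDerivWithinAt (fun s => A.g.inner (γ s) (velocity γ (Icc 0 1) s)
        (velocity γ (Icc 0 1) s)) 0 (Icc 0 1) s ∧
      HasDerivWithinAt (fun s => A.η (γ s) (velocity γ (Icc 0 1) s)) 0 (Icc 0 1) s := by
    intro t ht
    set p := γ t with hpdef
    have hps : γ t ∈ (ch p).source := mem_extChartAt_source p
    have hy : ch p p ∈ (ch p).target := (ch p).map_source (mem_extChartAt_source p)
    set x : ℝ → E3 := ch p ∘ γ with hx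
    have hxt : x t = ch p p := rfl
    have hc2 : ContDiffWithinAt ℝ 2 x (Icc 0 1) t :=
      contDiffWithinAt_ch_comp (n := 2) p (h2 t ht) hps
    have hd1 : HasDerivWithinAt x (derivWithin x (Icc 0 1) t) (Icc 0 1) t :=
      (hc2.differentiableWithinAt (by simp)).hasDerivWithinAt
    have hd2 : HasDerivWithinAt (derivWithin x (Icc 0 1))
        (derivWithin (derivWithin x (Icc 0 1)) (Icc 0 1) t) (Icc 0 1) t := by
      have hf : ContDiffWithinAt ℝ 1 (fderivWithin ℝ x (Icc 0 1)) (Icc 0 1) t :=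
        hc2.fderivWithin_right hU (by norm_num) ht
      have : ContDiffWithinAt ℝ 1 (derivWithin x (Icc 0 1)) (Icc 0 1) t :=
        hf.clm_apply contDiffWithinAt_const
      exact (this.differentiableWithinAt (by simp)).hasDerivWithinAt
    have hacc' := hacc t ht
    set x₁ := derivWithin x (Icc 0 1) t with hx₁
    set x₂ := derivWithin (derivWithin x (Icc 0 1)) (Icc 0 1) t with hx₂
    have heq : ∀ w : E3, metricC A.g p (ch p p) x₂ w + fderiv ℝ (metricC A.g p) (ch p p) x₁ x₁ w
        - (1 / 2) * fderiv ℝ (metricC A.g p) (ch p p) w x₁ x₁ = 0 :=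
      (isCovAcceleration_zero_iff A.g γ (Icc 0 1) t p rfl _ _ hx₁.symm hx₂.symm).1 hacc'
    have hsrc : ∀ᶠ s in 𝓝[Icc 0 1] t, γ s ∈ (ch p).source :=
      (h2 t ht).continuousWithinAt ((isOpen_ch_source p).mem_nhds hps)
    have hm : HasFDerivAt (metricC A.g p) (fderiv ℝ (metricC A.g p) (ch p p)) (x t) :=
      hasFDerivAt_metricC A.g p hy
    have he : HasFDerivAt (A.etaC p) (fderiv ℝ (A.etaC p) (ch p p)) (x t) :=
      A.hasFDerivAt_etaC p hy
    have hm1 : HasDerivWithinAt (fun s => metricC A.g p (x s))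
        (fderiv ℝ (metricC A.g p) (ch p p) x₁) (Icc 0 1) t :=
      HasFDerivAt.comp_hasDerivWithinAt (𝕜 := ℝ) (l := metricC A.g p) t hm hd1
    have he1 : HasDerivWithinAt (fun s => A.etaC p (x s))
        (fderiv ℝ (A.etaC p) (ch p p) x₁) (Icc 0 1) t :=
      HasFDerivAt.comp_hasDerivWithinAt (𝕜 := ℝ) (l := A.etaC p) t he hd1
    constructor
    · have hE := (hm1.clm_apply hd2).clm_apply hd2
      have e1 : (fun s => A.g.inner (γ s) (velocity γ (Icc 0 1) s) (velocity γ (Icc 0 1) s))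
          =ᶠ[𝓝[Icc 0 1] t] fun s => metricC A.g p (x s) (derivWithin x (Icc 0 1) s)
            (derivWithin x (Icc 0 1) s) := by
        filter_upwards [hsrc, self_mem_nhdsWithin] with s hs hs'
        rw [inner_eq_metricC A.g p hs, hvel p s hs' hs]
        rfl
      refine (hE.congr_of_eventuallyEq e1 (e1.self_of_nhdsWithin ht)).congr_deriv ?_
      have h := heq x₁
      simp only [add_apply, hxt]
      rw [metricC_symm A.g p _ (derivWithin x (Icc 0 1) t)]
      linear_combination 2 * h
    · have hE := he1.clm_apply hd2
      have e1 : (fun s => A.η (γ s) (velocity γ (Icc 0 1) s))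
          =ᶠ[𝓝[Icc 0 1] t] fun s => A.etaC p (x s) (derivWithin x (Icc 0 1) s) := by
        filter_upwards [hsrc, self_mem_nhdsWithin] with s hs hs'
        rw [A.eta_eq_etaC p hs, hvel p s hs' hs]
        rfl
      refine (hE.congr_of_eventuallyEq e1 (e1.self_of_nhdsWithin ht)).congr_deriv ?_
      have h := heq (A.reebC p (ch p p))
      have hk := A.killing hA p x₁
      have h3 := A.fderiv_etaC p hy x₁ x₁
      have h4 := fderiv_metricC_symm A.g p hy x₁ (A.reebC p (ch p p)) x₁
      have h5 := metricC_symm A.g p (ch p p) x₂ (A.reebC p (ch p p))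
      rw [hxt, ← hx₁, h3]
      change _ + metricC A.g p (ch p p) (A.reebC p (ch p p)) x₂ = 0
      linear_combination h + (1 / 2) * hk - h4 - h5
  have hE := constant_of_has_deriv_right_zero
    (fun s hs => (key s hs).1.continuousWithinAt)
    (fun s hs => ((key s ⟨hs.1, hs.2.le⟩).1.mono_of_mem_nhdsWithin (Icc_mem_nhdsGE_of_mem hs))) t ht
  have hk := constant_of_has_deriv_right_zero
    (fun s hs => (key s hs).2.continuousWithinAt)
    (fun s hs => ((key s ⟨hs.1, hs.2.le⟩).2.mono_of_mem_nhdsWithin (Icc_mem_nhdsGE_of_mem hs))) t ht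
  have hz : ∀ (q' : M) (v : TangentSpace (𝓡 3) q'),
      (⟨q', v⟩ : TangentBundle (𝓡 3) M) = ⟨q, c • A.T q⟩ →
      A.g.inner q' v v = c ^ 2 ∧ A.η q' v = c := by
    intro q' v h
    cases h
    simp [A.g_TT, A.η_T, sq]
  obtain ⟨hz1, hz2⟩ := hz _ _ h0
  beta_reduce at hE hk
  rw [hz1] at hE
  rw [hz2] at hk
  -- The squared norm of the difference is `c ^ 2 - 2 c * c + c ^ 2 = 0`. Uniqueness of geodesics is
  -- thus reduced to uniqueness of integral curves.
  rw [← sub_eq_zero]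
  apply A.g.eq_zero_of_inner_self
  simp only [map_sub, map_smul, sub_apply, smul_apply, smul_eq_mul, hE, A.g_T', A.g_T, hk, A.η_T]
  ring

end ContactSubRiemannian

end SubRiem

namespace SubRiem

variable {M : Type*} [TopologicalSpace M] [ChartedSpace E3 M] [IsManifold (𝓡 3) ∞ M]

namespace ContactSubRiemannian

variable {A : ContactSubRiemannian M}

/-- In a Sasakian manifold the geodesics that leave in the direction of the Reeb field are its
integral curves. -/
theorem ReebFlow.eqOn_of_isGeodesicFrom [T2Space M] (hA : A.IsSasakian) {p q : M}
    (Φ : A.ReebFlow p) (hq : q ∈ Φ.dom) {c : ℝ} (hc : c ∈ Ioo (-Φ.τ) Φ.τ) {γ : ℝ → M}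
    (h : IsGeodesicFrom A.g q (c • A.T q) γ) :
    EqOn γ (fun s => Φ.map (s * c) q) (Icc 0 1) := by
  set β : ℝ → M := fun s => Φ.map (s * c) q with hβ
  set O : Set ℝ := {s | s * c ∈ Ioo (-Φ.τ) Φ.τ} with hOdef
  have hO : IsOpen O := isOpen_Ioo.preimage (by fun_prop)
  have hsub : Icc (0 : ℝ) 1 ⊆ O := by
    intro s hs
    have hc' := abs_lt.2 hc
    refine abs_lt.1 ?_
    rw [abs_mul, abs_of_nonneg hs.1]
    nlinarith [abs_nonneg c, hs.2]
  have hβf : A.FollowsReeb β c O := Φ.followsReeb hq c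
  have hγ : ∀ s ∈ Icc (0 : ℝ) 1, HasMFDerivWithinAt 𝓘(ℝ, ℝ) (𝓡 3) γ (Icc 0 1) s
      ((1 : ℝ →L[ℝ] ℝ).smulRight (c • A.T (γ s))) := by
    intro s hs
    refine ((h.1 s hs).mdifferentiableWithinAt (by simp)).hasMFDerivWithinAt.congr_mfderiv ?_
    have hv := velocity_of_isGeodesicFrom hA h hs
    ext
    change velocity γ (Icc 0 1) s = (1 : ℝ) • (c • A.T (γ s))
    rw [hv, one_smul]
  have h00 : γ 0 = β 0 := by
    have h1 : γ 0 = q := congrArg Bundle.TotalSpace.proj h.2.2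
    simp [hβ, h1, Φ.map_zero hq]
  obtain ⟨δ, hδ, hδO⟩ : ∃ δ > 0, Ioo (-δ) 1 ⊆ O := by
    obtain ⟨δ, hδ, hb⟩ := Metric.isOpen_iff.1 hO 0 (hsub (by simp))
    refine ⟨δ, hδ, fun s hs => ?_⟩
    by_cases h0 : 0 ≤ s
    · exact hsub ⟨h0, hs.2.le⟩
    · refine hb ?_
      rw [Metric.mem_ball, Real.dist_eq, sub_zero, abs_of_neg (not_le.1 h0)]
      linarith [hs.1]
  -- The geodesic lives on `[0,1]`, while uniqueness of integral curves is applied on an open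
  -- interval around the initial time. The curve is prolonged to negative times by the flow line
  -- itself; at `0` the two one-sided derivatives agree.
  set γ' : ℝ → M := fun s => if s ≤ 0 then β s else γ s with hγ'
  have hval : ∀ s, 0 ≤ s → γ' s = γ s := by
    intro s hs
    rcases hs.eq_or_lt with rfl | hs
    · simp [hγ', h00]
    · simp [hγ', hs]
  have hint' : IsMIntegralCurveOn γ' (fun q => c • A.T q) (Ioo (-δ) 1) := by
    intro s hs
    refine HasMFDerivAt.hasMFDerivWithinAt ?_
    have hR : 0 ≤ s → HasMFDerivWithinAt 𝓘(ℝ, ℝ) (𝓡 3) γ' (Icc 0 1) s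
        ((1 : ℝ →L[ℝ] ℝ).smulRight (c • A.T (γ' s))) := by
      intro h0
      have h1 := (hγ s ⟨h0, hs.2.le⟩).congr_of_eventuallyEq (f₁ := γ')
        (eventuallyEq_nhdsWithin_of_eqOn fun t ht => hval t ht.1) (hval s h0)
      rw [← hval s h0] at h1
      exact h1
    have hL : s ≤ 0 → HasMFDerivWithinAt 𝓘(ℝ, ℝ) (𝓡 3) γ' (Iic 0) s
        ((1 : ℝ →L[ℝ] ℝ).smulRight (c • A.T (γ' s))) := by
      intro h0
      have e : ∀ t ≤ 0, γ' t = β t := fun t ht => by simp [hγ', ht]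
      have h1 := (hβf s (hδO hs)).hasMFDerivWithinAt.congr_of_eventuallyEq (f₁ := γ') (s := Iic 0)
        (eventuallyEq_nhdsWithin_of_eqOn fun t ht => e t ht) (e s h0)
      rw [← e s h0] at h1
      exact h1
    rcases lt_trichotomy s 0 with h0 | h0 | h0
    · exact (hL h0.le).hasMFDerivAt (Iic_mem_nhds h0)
    · refine ((hL h0.le).union (hR h0.ge)).hasMFDerivAt ?_
      have : Iio (1 : ℝ) ⊆ Iic 0 ∪ Icc 0 1 := by
        intro t ht
        rcases le_total t 0 with h | h
        · exact Or.inl h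
        · exact Or.inr ⟨h, (mem_Iio.1 ht).le⟩
      exact mem_of_superset (Iio_mem_nhds hs.2) this
    · exact (hR h0.le).hasMFDerivAt (Icc_mem_nhds h0 hs.2)
  have hintβ : IsMIntegralCurveOn β (fun q => c • A.T q) (Ioo (-δ) 1) :=
    fun s hs => (hβf s (hδO hs)).hasMFDerivWithinAt
  have hsm : ContMDiff (𝓡 3) (𝓡 3).tangent 1
      (fun q => (⟨q, c • A.T q⟩ : TangentBundle (𝓡 3) M)) := by
    intro q
    have h1 : ContMDiffAt (𝓡 3) (𝓡 3).tangent 1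
        (fun q => (⟨q, A.T q⟩ : TangentBundle (𝓡 3) M)) q :=
      (A.T_smooth q).of_le (ENat.LEInfty.out)
    exact h1.const_smul_section
  have heq := isMIntegralCurveOn_Ioo_eqOn_of_contMDiff_boundaryless (t₀ := 0)
    (show (0 : ℝ) ∈ Ioo (-δ) 1 from ⟨by linarith, one_pos⟩) hsm hint' hintβ (by simp [hγ'])
  have hIco : EqOn γ β (Ico 0 1) := by
    intro s hs
    rw [← hval s hs.1]
    exact heq ⟨by linarith [hs.1], hs.2⟩
  -- The endpoint `1`, at which the exponential map is evaluated, is reached by continuity.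
  have hcl := hIco.of_subset_closure h.1.continuousOn
    (fun s hs => (hβf s (hsub hs)).continuousAt.continuousWithinAt) Ico_subset_Icc_self
    (by rw [closure_Ico zero_ne_one])
  exact hcl

theorem ReebFlow.expDefined {p q : M} (Φ : A.ReebFlow p) (hq : q ∈ Φ.dom) {c : ℝ}
    (hc : c ∈ Ioo (-Φ.τ) Φ.τ) : ExpDefined A.g q (c • A.T q) := by
  refine ⟨fun s => Φ.map (s * c) q, ?_⟩
  have h := (Φ.followsReeb hq c).isGeodesicFrom (isOpen_Ioo.preimage (by fun_prop)) ?_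
  · have h0 : Φ.map (0 * c) q = q := by rw [zero_mul, Φ.map_zero hq]
    beta_reduce at h
    rwa [h0] at h
  · intro s hs
    have hc' := abs_lt.2 hc
    refine abs_lt.1 ?_
    rw [abs_mul, abs_of_nonneg hs.1]
    nlinarith [abs_nonneg c, hs.2]

/-- In a Sasakian manifold the flow of the Reeb field is its Riemannian exponential. -/
theorem ReebFlow.riemExp_eq [T2Space M] (hA : A.IsSasakian) {p q : M} (Φ : A.ReebFlow p)
    (hq : q ∈ Φ.dom) {c : ℝ} (hc : c ∈ Ioo (-Φ.τ) Φ.τ) :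
    riemExp A.g q (c • A.T q) = Φ.map c q := by
  have h := Φ.expDefined hq hc
  -- Every admissible geodesic coincides with the flow line, so the one selected by choice in
  -- `riemExp` does too.
  rw [riemExp, dif_pos h, Φ.eqOn_of_isGeodesicFrom hA hq hc h.choose_spec ⟨zero_le_one, le_rfl⟩]
  beta_reduce
  rw [one_mul]

end ContactSubRiemannian

end SubRiem

/-! ### Displacement of a map along the Reeb flow by a variable time. -/

namespace SubRiem

variable {M : Type*} [TopologicalSpace M] [ChartedSpace E3 M] [IsManifold (𝓡 3) ∞ M]

lemma hasDerivAt_comp_mul_const {E : Type*} [NormedAddCommGroup E] [NormedSpace ℝ E]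
    {f : ℝ → E} {f' : E} {u t : ℝ} (hf : HasDerivAt f f' (u * t)) :
    HasDerivAt (fun u => f (u * t)) (t • f') u := by
  have h : HasDerivAt (fun u : ℝ => u * t) t u := by simpa using (hasDerivAt_id u).mul_const t
  exact HasDerivAt.scomp u hf h

namespace ContactSubRiemannian

variable {A : ContactSubRiemannian M}

namespace ReebFlow

variable {p q : M} (Φ : A.ReebFlow p) {t : ℝ}

/-- Both partial derivatives exist and are continuous, hence the flow is differentiable jointly in
space and time. -/
lemma hasFDerivAt_uncurry {y : E3} (hy : y ∈ Metric.ball (ch p p) Φ.r)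
    (ht : t ∈ Ioo (-Φ.τ) Φ.τ) :
    HasFDerivAt (Function.uncurry Φ.α)
      ((Φ.Y y t).coprod ((1 : ℝ →L[ℝ] ℝ).smulRight (A.reebC p (Φ.α y t)))) (y, t) := by
  have hO : IsOpen (Metric.ball (ch p p) Φ.r ×ˢ Ioo (-Φ.τ) Φ.τ) :=
    Metric.isOpen_ball.prod isOpen_Ioo
  have hev : ∀ᶠ z : E3 × ℝ in 𝓝 (y, t), z ∈ Metric.ball (ch p p) Φ.r ×ˢ Ioo (-Φ.τ) Φ.τ :=
    hO.mem_nhds ⟨hy, ht⟩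
  have hp := (Φ.prop y hy).2.2 t ht
  have hc : ContinuousAt (fun z : E3 × ℝ => A.reebC p (Φ.α z.1 z.2)) (y, t) := by
    have h1 : ContinuousAt (A.reebC p) (Φ.α y t) := (A.hasFDerivAt_reebC p hp.1).continuousAt
    exact ContinuousAt.comp (g := A.reebC p) (f := Function.uncurry Φ.α) h1 hp.2.2.2.2.1
  refine (hasStrictFDerivAt_uncurry_coprod (𝕜 := ℝ) (u := (y, t)) (f := Φ.α) (f₁ := Φ.Y)
    (f₂ := fun y t => (1 : ℝ →L[ℝ] ℝ).smulRight (A.reebC p (Φ.α y t))) ?_ ?_ ?_ ?_).hasFDerivAt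
  · filter_upwards [hev] with z hz using ((Φ.prop _ hz.1).2.2 _ hz.2).2.2.2.1
  · filter_upwards [hev] with z hz using ((Φ.prop _ hz.1).2.2 _ hz.2).2.1.hasFDerivAt
  · exact hp.2.2.2.2.2
  · exact ((ContinuousLinearMap.smulRightL ℝ ℝ E3 1).continuous.continuousAt).comp hc

lemma contDiffAt_uncurry {y : E3} (hy : y ∈ Metric.ball (ch p p) Φ.r)
    (ht : t ∈ Ioo (-Φ.τ) Φ.τ) : ContDiffAt ℝ 1 (Function.uncurry Φ.α) (y, t) := by
  have hO : IsOpen (Metric.ball (ch p p) Φ.r ×ˢ Ioo (-Φ.τ) Φ.τ) :=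
    Metric.isOpen_ball.prod isOpen_Ioo
  rw [contDiffAt_one_iff]
  refine ⟨_, _, hO.mem_nhds ⟨hy, ht⟩, ?_, fun z hz => Φ.hasFDerivAt_uncurry hz.1 hz.2⟩
  intro z hz
  have hp := (Φ.prop z.1 hz.1).2.2 z.2 hz.2
  have hc : ContinuousAt (fun z : E3 × ℝ => A.reebC p (Φ.α z.1 z.2)) z := by
    have h1 : ContinuousAt (A.reebC p) (Φ.α z.1 z.2) := (A.hasFDerivAt_reebC p hp.1).continuousAt
    exact ContinuousAt.comp (g := A.reebC p) (f := Function.uncurry Φ.α) h1 hp.2.2.2.2.1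
  have hc2 : ContinuousAt (fun z : E3 × ℝ =>
      (1 : ℝ →L[ℝ] ℝ).smulRight (A.reebC p (Φ.α z.1 z.2))) z :=
    ((ContinuousLinearMap.smulRightL ℝ ℝ E3 1).continuous.continuousAt).comp hc
  have hc1 : ContinuousAt (fun z : E3 × ℝ => Φ.Y z.1 z.2) z := hp.2.2.2.2.2
  have h3 := (ContinuousLinearMap.coprodEquivL ℝ (E := E3) (F := ℝ) (G := E3)).continuous.continuousAt.comp
    (hc1.prodMk hc2)
  exact h3.continuousWithinAt

/-- The flow preserves the Reeb field. -/
lemma Y_reebC {y : E3} (hy : y ∈ Metric.ball (ch p p) Φ.r) (ht : t ∈ Ioo (-Φ.τ) Φ.τ) :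
    Φ.Y y t (A.reebC p y) = A.reebC p (Φ.α y t) := by
  obtain ⟨h0, hY0, hp⟩ := Φ.prop y hy
  have hmem : ∀ u ∈ Icc (0 : ℝ) 1, u * t ∈ Ioo (-Φ.τ) Φ.τ := by
    intro u hu
    have ht' := abs_lt.2 ht
    refine abs_lt.1 ?_
    rw [abs_mul, abs_of_nonneg hu.1]
    nlinarith [abs_nonneg t, hu.2]
  -- The transported vector `Y T` and `T` along the trajectory solve the same linear equation with
  -- the same initial value, so their difference `Z` vanishes by Gronwall's inequality. Time is
  -- again rescaled to `[0,1]`.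
  set Z : ℝ → E3 := fun u => Φ.Y y (u * t) (A.reebC p y) - A.reebC p (Φ.α y (u * t)) with hZ
  have hder : ∀ u ∈ Icc (0 : ℝ) 1,
      HasDerivAt Z (t • fderiv ℝ (A.reebC p) (Φ.α y (u * t)) (Z u)) u := by
    intro u hu
    obtain ⟨hm, hd, hYd, -⟩ := hp _ (hmem u hu)
    have h1 : HasDerivAt (fun s => Φ.Y y s (A.reebC p y))
        (fderiv ℝ (A.reebC p) (Φ.α y (u * t)) (Φ.Y y (u * t) (A.reebC p y))) (u * t) := by
      simpa using hYd.clm_apply (hasDerivAt_const (u * t) (A.reebC p y))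
    have h2 : HasDerivAt (fun u => Φ.α y (u * t)) (t • A.reebC p (Φ.α y (u * t))) u :=
      hasDerivAt_comp_mul_const hd
    have h3 : HasDerivAt (fun u => A.reebC p (Φ.α y (u * t)))
        (fderiv ℝ (A.reebC p) (Φ.α y (u * t)) (t • A.reebC p (Φ.α y (u * t)))) u :=
      HasFDerivAt.comp_hasDerivAt (𝕜 := ℝ) (l := A.reebC p) u (A.hasFDerivAt_reebC p hm) h2
    have h4 : HasDerivAt (fun u => Φ.Y y (u * t) (A.reebC p y))
        (t • (fderiv ℝ (A.reebC p) (Φ.α y (u * t)) (Φ.Y y (u * t) (A.reebC p y)))) u :=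
      hasDerivAt_comp_mul_const h1
    refine (h4.sub h3).congr_deriv ?_
    simp only [hZ, map_sub, map_smul, smul_sub]
  have hcont : ContinuousOn Z (Icc 0 1) := fun u hu =>
    (hder u hu).continuousAt.continuousWithinAt
  obtain ⟨C, hC⟩ := isCompact_Icc.exists_bound_of_continuousOn (s := Icc (0 : ℝ) 1)
    (f := fun u => fderiv ℝ (A.reebC p) (Φ.α y (u * t))) (by
      refine ((A.contDiffOn_reebC p).continuousOn_fderiv_of_isOpen (isOpen_ch_target p)
        (by simp)).comp (fun u hu => ?_) (fun u hu => (hp _ (hmem u hu)).1)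
      have h1 : ContinuousAt (Φ.α y) (u * t) := (hp _ (hmem u hu)).2.1.continuousAt
      exact (ContinuousAt.comp (f := fun u : ℝ => u * t) h1 (by fun_prop)).continuousWithinAt)
  have := eq_zero_of_abs_deriv_le_mul_abs_self_of_eq_zero_right (K := |t| * C) hcont
    (fun u hu => (hder u ⟨hu.1, hu.2.le⟩).hasDerivWithinAt) (by simp [hZ, h0, hY0]) (by
      intro u hu
      rw [norm_smul, Real.norm_eq_abs, mul_assoc]
      gcongr
      exact (ContinuousLinearMap.le_opNorm _ _).trans (by gcongr; exact hC u ⟨hu.1, hu.2.le⟩))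
    1 (by simp)
  simpa [hZ, sub_eq_zero] using this

section Comp

variable {X : Type*} [NormedAddCommGroup X] [NormedSpace ℝ X] {a : X → ℝ} {f : X → M}
  {s : Set X} {x : X}

lemma ch_comp_map_eventuallyEq (hf : ContinuousWithinAt f s x) (ha : ContinuousWithinAt a s x)
    (hx : f x ∈ Φ.dom) (hax : a x ∈ Ioo (-Φ.τ) Φ.τ) :
    ch p ∘ (fun z => Φ.map (a z) (f z)) =ᶠ[𝓝[s] x]
      fun z => Function.uncurry Φ.α ((ch p ∘ f) z, a z) := by
  filter_upwards [hf (Φ.isOpen_dom.mem_nhds hx), ha (isOpen_Ioo.mem_nhds hax)] with z hz hz'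
  exact Φ.ch_map hz hz'

lemma contMDiffWithinAt_comp (hf : ContMDiffWithinAt 𝓘(ℝ, X) (𝓡 3) 1 f s x)
    (ha : ContDiffWithinAt ℝ 1 a s x) (hx : f x ∈ Φ.dom) (hax : a x ∈ Ioo (-Φ.τ) Φ.τ) :
    ContMDiffWithinAt 𝓘(ℝ, X) (𝓡 3) 1 (fun z => Φ.map (a z) (f z)) s x := by
  have h1 : ContDiffWithinAt ℝ 1 (ch p ∘ f) s x := contDiffWithinAt_ch_comp (n := 1) p hf hx.1
  have h2 : ContDiffWithinAt ℝ 1 (fun z => Function.uncurry Φ.α ((ch p ∘ f) z, a z)) s x :=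
    ContDiffAt.comp_contDiffWithinAt x (g := Function.uncurry Φ.α)
      (f := fun z => ((ch p ∘ f) z, a z)) (Φ.contDiffAt_uncurry hx.2 hax) (h1.prodMk ha)
  have h3 : ContMDiffAt 𝓘(ℝ, E3) (𝓡 3) 1 (ch p).symm (Function.uncurry Φ.α ((ch p ∘ f) x, a x)) :=
    (contMDiffAt_ch_symm p ((Φ.prop _ hx.2).2.2 _ hax).1).of_le ENat.LEInfty.out
  exact h3.comp_contMDiffWithinAt x h2.contMDiffWithinAt

/-- The differential of a displacement along the flow, in coordinates. -/
lemma chartFwd_mfderivWithin_comp (hf : MDifferentiableWithinAt 𝓘(ℝ, X) (𝓡 3) f s x)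
    (ha : DifferentiableWithinAt ℝ a s x) (hs : UniqueDiffWithinAt ℝ s x)
    (hx : f x ∈ Φ.dom) (hax : a x ∈ Ioo (-Φ.τ) Φ.τ) (e : X) :
    chartFwd p (Φ.map (a x) (f x))
        (mfderivWithin 𝓘(ℝ, X) (𝓡 3) (fun z => Φ.map (a z) (f z)) s x e)
      = Φ.Y (ch p (f x)) (a x) (chartFwd p (f x) (mfderivWithin 𝓘(ℝ, X) (𝓡 3) f s x e)
        + fderivWithin ℝ a s x e • A.reebC p (ch p (f x))) := by
  have h1 := hasFDerivWithinAt_ch_comp p hf.hasMFDerivWithinAt hx.1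
  have h2 : HasFDerivWithinAt (fun z => Function.uncurry Φ.α ((ch p ∘ f) z, a z)) _ s x :=
    HasFDerivAt.comp_hasFDerivWithinAt x (g := Function.uncurry Φ.α)
      (f := fun z => ((ch p ∘ f) z, a z)) (Φ.hasFDerivAt_uncurry hx.2 hax)
      (h1.prodMk ha.hasFDerivWithinAt)
  have hev := Φ.ch_comp_map_eventuallyEq hf.continuousWithinAt ha.continuousWithinAt hx hax
  have hxx : (ch p ∘ fun z => Φ.map (a z) (f z)) x
      = Function.uncurry Φ.α ((ch p ∘ f) x, a x) := Φ.ch_map hx hax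
  have h3 := h2.congr_of_eventuallyEq hev hxx
  have hmd : MDifferentiableWithinAt 𝓘(ℝ, X) (𝓡 3) (fun z => Φ.map (a z) (f z)) s x := by
    have h4 := ((contMDiffAt_ch_symm p ((Φ.prop _ hx.2).2.2 _ hax).1).mdifferentiableAt
      (by simp)).comp_mdifferentiableWithinAt x h2.differentiableWithinAt.mdifferentiableWithinAt
    exact h4
  rw [chartFwd_mfderivWithin p hmd hs (Φ.map_mem_source hx hax), h3.fderivWithin hs]
  simp only [map_add, map_smul, Φ.Y_reebC hx.2 hax]
  rfl

/-- A variable flow time adds `da(e) T` to the vector before it is transported; since the flow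
preserves `η` and `η(T) = 1`, the contribution is exactly `da(e)`. -/
lemma eta_mfderivWithin_comp (hf : MDifferentiableWithinAt 𝓘(ℝ, X) (𝓡 3) f s x)
    (ha : DifferentiableWithinAt ℝ a s x) (hs : UniqueDiffWithinAt ℝ s x)
    (hx : f x ∈ Φ.dom) (hax : a x ∈ Ioo (-Φ.τ) Φ.τ) (e : X) :
    A.η (Φ.map (a x) (f x))
        (mfderivWithin 𝓘(ℝ, X) (𝓡 3) (fun z => Φ.map (a z) (f z)) s x e)
      = A.η (f x) (mfderivWithin 𝓘(ℝ, X) (𝓡 3) f s x e) + fderivWithin ℝ a s x e := by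
  rw [A.eta_eq_etaC p (Φ.map_mem_source hx hax), Φ.chartFwd_mfderivWithin_comp hf ha hs hx hax,
    Φ.ch_map hx hax, Φ.etaC_Y hx hax, map_add, map_smul, ← A.eta_eq_etaC p hx.1,
    A.etaC_reebC p ((ch p).map_source hx.1)]
  simp

/-- The isometry property `metricC_Y` concerns horizontal vectors, whence the condition that the
corrected vector be horizontal. It holds for the rulings and for the vectors tested in the proof
that the variation is an immersion. -/
lemma inner_mfderivWithin_comp (hA : A.IsSasakian)
    (hf : MDifferentiableWithinAt 𝓘(ℝ, X) (𝓡 3) f s x)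
    (ha : DifferentiableWithinAt ℝ a s x) (hs : UniqueDiffWithinAt ℝ s x)
    (hx : f x ∈ Φ.dom) (hax : a x ∈ Ioo (-Φ.τ) Φ.τ) (e : X)
    (he : A.η (f x) (mfderivWithin 𝓘(ℝ, X) (𝓡 3) f s x e) + fderivWithin ℝ a s x e = 0) :
    A.g.inner (Φ.map (a x) (f x))
        (mfderivWithin 𝓘(ℝ, X) (𝓡 3) (fun z => Φ.map (a z) (f z)) s x e)
        (mfderivWithin 𝓘(ℝ, X) (𝓡 3) (fun z => Φ.map (a z) (f z)) s x e)
      = A.g.inner (f x)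
        (mfderivWithin 𝓘(ℝ, X) (𝓡 3) f s x e + fderivWithin ℝ a s x e • A.T (f x))
        (mfderivWithin 𝓘(ℝ, X) (𝓡 3) f s x e + fderivWithin ℝ a s x e • A.T (f x)) := by
  have hfw : chartFwd p (f x) (mfderivWithin 𝓘(ℝ, X) (𝓡 3) f s x e)
        + fderivWithin ℝ a s x e • A.reebC p (ch p (f x))
      = chartFwd p (f x)
        (mfderivWithin 𝓘(ℝ, X) (𝓡 3) f s x e + fderivWithin ℝ a s x e • A.T (f x)) := by
    rw [← A.chartFwd_T p hx.1, map_add]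
    congr 1
    exact ((chartFwd p (f x)).map_smul _ _).symm
  rw [inner_eq_metricC A.g p (Φ.map_mem_source hx hax),
    Φ.chartFwd_mfderivWithin_comp hf ha hs hx hax,
    Φ.ch_map hx hax, Φ.metricC_Y hA hx hax, hfw, ← inner_eq_metricC A.g p hx.1]
  rw [hfw, ← A.eta_eq_etaC p hx.1, map_add, map_smul, A.η_T, smul_eq_mul, mul_one, he]

end Comp

end ReebFlow

end ContactSubRiemannian

end SubRiem

/-! ### Strips: coordinate fields, reflection and gluing along the central curve. -/

namespace SubRiem

section Sets

lemma uniqueDiffOn_of_ordConnected {I : Set ℝ} (hI : I.OrdConnected) (hI' : I.Nontrivial) :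
    UniqueDiffOn ℝ I := by
  refine uniqueDiffOn_convex hI.convex ?_
  obtain ⟨a, ha, b, hb, hab⟩ := hI'.exists_lt
  refine ⟨(a + b) / 2, mem_interior.2 ⟨Ioo a b, ?_, isOpen_Ioo, ?_⟩⟩
  · exact Ioo_subset_Icc_self.trans (hI.out ha hb)
  · constructor <;> linarith

lemma uniqueDiffOn_prod_Icc {I : Set ℝ} (hI : UniqueDiffOn ℝ I) {a b : ℝ} (hab : a < b) :
    UniqueDiffOn ℝ (I ×ˢ Icc a b) := hI.prod (uniqueDiffOn_Icc hab)

variable {Y : Type*} [TopologicalSpace Y]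

/-- Both halves are relatively closed, so a point outside one of them imposes no condition there. -/
lemma continuousWithinAt_of_halves {f : ℝ × ℝ → Y} {S : Set (ℝ × ℝ)} {x : ℝ × ℝ}
    (h1 : 0 ≤ x.2 → ContinuousWithinAt f (S ∩ {y | 0 ≤ y.2}) x)
    (h2 : x.2 ≤ 0 → ContinuousWithinAt f (S ∩ {y | y.2 ≤ 0}) x) : ContinuousWithinAt f S x := by
  have hS : S = S ∩ {y | 0 ≤ y.2} ∪ S ∩ {y | y.2 ≤ 0} := by
    ext y; rcases le_total 0 y.2 with h | h <;> simp [h] <;> tauto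
  rw [hS]
  have key : ∀ T : Set (ℝ × ℝ), IsClosed T → x ∉ T → ContinuousWithinAt f (S ∩ T) x := by
    intro T hT hx
    refine continuousWithinAt_of_notMem_closure fun h => hx ?_
    exact hT.closure_subset_iff.2 inter_subset_right h
  refine ContinuousWithinAt.union ?_ ?_
  · by_cases h : 0 ≤ x.2
    · exact h1 h
    · exact key _ (isClosed_le continuous_const continuous_snd) h
  · by_cases h : x.2 ≤ 0
    · exact h2 h
    · exact key _ (isClosed_le continuous_snd continuous_const) h

lemma strip_inter_nonneg {I : Set ℝ} {σ : ℝ} (hσ : 0 < σ) :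
    strip I σ ∩ {y | 0 ≤ y.2} = I ×ˢ Icc 0 σ := by
  ext y
  simp only [strip, mem_inter_iff, mem_prod, mem_Icc, mem_ofPred_eq]
  constructor
  · rintro ⟨⟨h, h1, h2⟩, h3⟩; exact ⟨h, h3, h2⟩
  · rintro ⟨h, h1, h2⟩; exact ⟨⟨h, by linarith, h2⟩, h1⟩

lemma strip_inter_nonpos {I : Set ℝ} {σ : ℝ} (hσ : 0 < σ) :
    strip I σ ∩ {y | y.2 ≤ 0} = I ×ˢ Icc (-σ) 0 := by
  ext y
  simp only [strip, mem_inter_iff, mem_prod, mem_Icc, mem_ofPred_eq]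
  constructor
  · rintro ⟨⟨h, h1, h2⟩, h3⟩; exact ⟨h, h1, h3⟩
  · rintro ⟨h, h1, h2⟩; exact ⟨⟨h, h1, by linarith⟩, h2⟩

end Sets

section Derivatives

variable {M : Type*} [TopologicalSpace M] [ChartedSpace E3 M]
  {X : Type*} [NormedAddCommGroup X] [NormedSpace ℝ X]

lemma mfderivWithin_totalSpace_congr {f g : X → M} {s : Set X} {x : X} (hfg : EqOn f g s)
    (hx : x ∈ s) (e : X) :
    (⟨f x, mfderivWithin 𝓘(ℝ, X) (𝓡 3) f s x e⟩ : TangentBundle (𝓡 3) M)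
      = ⟨g x, mfderivWithin 𝓘(ℝ, X) (𝓡 3) g s x e⟩ := by
  refine Bundle.TotalSpace.ext (hfg hx) (heq_of_eq ?_)
  have h := mfderivWithin_congr (I := 𝓘(ℝ, X)) (I' := 𝓡 3) (f := g) (f₁ := f) (s := s) (x := x)
    (fun y hy => hfg hy) (hfg hx)
  exact DFunLike.congr_fun h e

variable {f : ℝ × ℝ → M} {I S : Set ℝ} {x : ℝ × ℝ}

lemma velocity_fst_eq_d₁ (hI : UniqueDiffOn ℝ I)
    (hf : MDifferentiableWithinAt 𝓘(ℝ, ℝ × ℝ) (𝓡 3) f (I ×ˢ S) x) (hx : x ∈ I ×ˢ S) :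
    velocity (fun ε => f (ε, x.2)) I x.1 = d₁ f (I ×ˢ S) x := by
  have h1 : HasMFDerivWithinAt 𝓘(ℝ, ℝ) 𝓘(ℝ, ℝ × ℝ) (fun ε : ℝ => (ε, x.2)) I x.1
      ((ContinuousLinearMap.id ℝ ℝ).prod 0) := by
    have : HasFDerivWithinAt (fun ε : ℝ => (ε, x.2)) ((ContinuousLinearMap.id ℝ ℝ).prod 0) I x.1 :=
      (hasFDerivWithinAt_id _ _).prodMk (hasFDerivWithinAt_const _ _ _)
    exact this.hasMFDerivWithinAt
  have h2 := HasMFDerivWithinAt.comp (g := f) (f := fun ε : ℝ => (ε, x.2)) x.1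
    hf.hasMFDerivWithinAt h1 (fun ε hε => ⟨hε, hx.2⟩)
  have h3 := h2.mfderivWithin (hI x.1 hx.1).uniqueMDiffWithinAt
  exact DFunLike.congr_fun h3 (1 : ℝ)

lemma velocity_snd_eq_d₂ (hS : UniqueDiffOn ℝ S)
    (hf : MDifferentiableWithinAt 𝓘(ℝ, ℝ × ℝ) (𝓡 3) f (I ×ˢ S) x) (hx : x ∈ I ×ˢ S) :
    velocity (fun s => f (x.1, s)) S x.2 = d₂ f (I ×ˢ S) x := by
  have h1 : HasMFDerivWithinAt 𝓘(ℝ, ℝ) 𝓘(ℝ, ℝ × ℝ) (fun s : ℝ => (x.1, s)) S x.2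
      (ContinuousLinearMap.prod 0 (ContinuousLinearMap.id ℝ ℝ)) := by
    have : HasFDerivWithinAt (fun s : ℝ => (x.1, s))
        (ContinuousLinearMap.prod 0 (ContinuousLinearMap.id ℝ ℝ)) S x.2 :=
      (hasFDerivWithinAt_const _ _ _).prodMk (hasFDerivWithinAt_id _ _)
    exact this.hasMFDerivWithinAt
  have h2 := HasMFDerivWithinAt.comp (g := f) (f := fun s : ℝ => (x.1, s)) x.2
    hf.hasMFDerivWithinAt h1 (fun s hs => ⟨hx.1, hs⟩)
  have h3 := h2.mfderivWithin (hS x.2 hx.2).uniqueMDiffWithinAt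
  exact DFunLike.congr_fun h3 (1 : ℝ)

/-- The reflection `(ε, s) ↦ (ε, -s)`. -/
def reflCLM : ℝ × ℝ →L[ℝ] ℝ × ℝ :=
  (ContinuousLinearMap.fst ℝ ℝ ℝ).prod (-ContinuousLinearMap.snd ℝ ℝ ℝ)

lemma reflCLM_apply (x : ℝ × ℝ) : reflCLM x = (x.1, -x.2) := rfl

lemma reflCLM_mem {σ : ℝ} (hx : x ∈ I ×ˢ Icc (-σ) 0) : reflCLM x ∈ I ×ˢ Icc 0 σ :=
  ⟨hx.1, by simp [reflCLM_apply]; exact ⟨hx.2.2, by linarith [hx.2.1]⟩⟩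

lemma comp_reflCLM_reflCLM {Y : Type*} (f : ℝ × ℝ → Y) : (fun x => f (x.1, -x.2)) ∘ reflCLM = f := by
  funext x; simp [reflCLM_apply]

lemma hasMFDerivWithinAt_of_refl {σ : ℝ} {L : ℝ × ℝ →L[ℝ] E3}
    (hf : HasMFDerivWithinAt 𝓘(ℝ, ℝ × ℝ) (𝓡 3) (fun x => f (x.1, -x.2)) (I ×ˢ Icc 0 σ)
      (reflCLM x) L) :
    HasMFDerivWithinAt 𝓘(ℝ, ℝ × ℝ) (𝓡 3) f (I ×ˢ Icc (-σ) 0) x (L.comp reflCLM) := by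
  have h := HasMFDerivWithinAt.comp (g := fun x : ℝ × ℝ => f (x.1, -x.2)) (f := reflCLM) x hf
    (reflCLM.hasFDerivWithinAt (s := I ×ˢ Icc (-σ) 0)).hasMFDerivWithinAt
    (fun y hy => reflCLM_mem hy)
  have h2 : ∀ g : ℝ × ℝ → M, g = f → HasMFDerivWithinAt 𝓘(ℝ, ℝ × ℝ) (𝓡 3) g (I ×ˢ Icc (-σ) 0) x
      (show ℝ × ℝ →L[ℝ] E3 from L.comp reflCLM) → HasMFDerivWithinAt 𝓘(ℝ, ℝ × ℝ) (𝓡 3) f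
      (I ×ˢ Icc (-σ) 0) x (show ℝ × ℝ →L[ℝ] E3 from L.comp reflCLM) := by
    rintro g rfl hg; exact hg
  exact h2 _ (comp_reflCLM_reflCLM f) h

lemma contMDiffOn_of_refl {σ : ℝ} {n : ℕ∞}
    (hf : ContMDiffOn 𝓘(ℝ, ℝ × ℝ) (𝓡 3) n (fun x => f (x.1, -x.2)) (I ×ˢ Icc 0 σ)) :
    ContMDiffOn 𝓘(ℝ, ℝ × ℝ) (𝓡 3) n f (I ×ˢ Icc (-σ) 0) := by
  have h := hf.comp (reflCLM.contDiff.contMDiff.contMDiffOn (s := I ×ˢ Icc (-σ) 0))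
    (fun y hy => reflCLM_mem hy)
  rwa [comp_reflCLM_reflCLM] at h

end Derivatives

end SubRiem

namespace SubRiem

section Continuity

variable {M : Type*} [TopologicalSpace M] [ChartedSpace E3 M] [IsManifold (𝓡 3) ∞ M]
  {X : Type*} [NormedAddCommGroup X] [NormedSpace ℝ X] {f : X → M} {s : Set X} {x : X}

lemma contDiffWithinAt_chartFwd_mfderivWithin (p : M) {n : ℕ∞}
    (hf : ContMDiffOn 𝓘(ℝ, X) (𝓡 3) (n + 1 : ℕ∞) f s)
    (hs : UniqueDiffOn ℝ s) (hxs : x ∈ s) (hx : f x ∈ (ch p).source) (e : X) :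
    ContDiffWithinAt ℝ n
      (fun z => (chartFwd p (f z) (mfderivWithin 𝓘(ℝ, X) (𝓡 3) f s z e) : E3)) s x := by
  have h1 := (contDiffWithinAt_ch_comp p (hf x hxs) hx).fderivWithin_right (m := n) hs
    (by simp) hxs
  refine (h1.clm_apply (contDiffWithinAt_const (c := e))).congr_of_eventuallyEq ?_ ?_
  · filter_upwards [(hf x hxs).continuousWithinAt ((isOpen_ch_source p).mem_nhds hx),
      self_mem_nhdsWithin] with z hz hzs
    exact chartFwd_mfderivWithin p ((hf z hzs).mdifferentiableWithinAt (by simp)) (hs z hzs) hz e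
  · exact chartFwd_mfderivWithin p ((hf x hxs).mdifferentiableWithinAt (by simp)) (hs x hxs) hx e

end Continuity

section Glue

variable {M : Type*} [TopologicalSpace M] [ChartedSpace E3 M] [IsManifold (𝓡 3) ∞ M]
  {I : Set ℝ} {σ : ℝ} {F : ℝ × ℝ → M} {x : ℝ × ℝ}

lemma mfderivWithin_refl (hI : UniqueDiffOn ℝ I) (hσ : 0 < σ)
    (hF : MDifferentiableOn 𝓘(ℝ, ℝ × ℝ) (𝓡 3) (fun x => F (x.1, -x.2)) (I ×ˢ Icc 0 σ))
    (hx : x ∈ I ×ˢ Icc (-σ) 0) (e : ℝ × ℝ) :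
    (⟨F x, mfderivWithin 𝓘(ℝ, ℝ × ℝ) (𝓡 3) F (I ×ˢ Icc (-σ) 0) x e⟩ : TangentBundle (𝓡 3) M)
      = ⟨F ((reflCLM x).1, -(reflCLM x).2), mfderivWithin 𝓘(ℝ, ℝ × ℝ) (𝓡 3)
          (fun x => F (x.1, -x.2)) (I ×ˢ Icc 0 σ) (reflCLM x) (reflCLM e)⟩ := by
  have h := (hasMFDerivWithinAt_of_refl (hF _ (reflCLM_mem hx)).hasMFDerivWithinAt).mfderivWithin
    (uniqueDiffOn_prod_Icc hI (by linarith) x hx).uniqueMDiffWithinAt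
  refine Bundle.TotalSpace.ext ?_ (heq_of_eq ?_)
  · simp [reflCLM_apply]
  · exact DFunLike.congr_fun h e

lemma clm_ext_prod {E : Type*} [NormedAddCommGroup E] [NormedSpace ℝ E] {L L' : ℝ × ℝ →L[ℝ] E}
    (h1 : L (1, 0) = L' (1, 0)) (h2 : L (0, 1) = L' (0, 1)) : L = L' := by
  ext
  · simpa using h1
  · simpa using h2

/-- Gluing of the differentials of the two halves of a strip. -/
lemma hasMFDerivWithinAt_strip (hσ : 0 < σ)
    (hp : MDifferentiableOn 𝓘(ℝ, ℝ × ℝ) (𝓡 3) F (I ×ˢ Icc 0 σ))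
    (hm : MDifferentiableOn 𝓘(ℝ, ℝ × ℝ) (𝓡 3) F (I ×ˢ Icc (-σ) 0))
    (h0 : ∀ ε ∈ I, mfderivWithin 𝓘(ℝ, ℝ × ℝ) (𝓡 3) F (I ×ˢ Icc 0 σ) (ε, 0)
      = mfderivWithin 𝓘(ℝ, ℝ × ℝ) (𝓡 3) F (I ×ˢ Icc (-σ) 0) (ε, 0)) (hx : x ∈ strip I σ) :
    (0 ≤ x.2 → HasMFDerivWithinAt 𝓘(ℝ, ℝ × ℝ) (𝓡 3) F (strip I σ) x
      (mfderivWithin 𝓘(ℝ, ℝ × ℝ) (𝓡 3) F (I ×ˢ Icc 0 σ) x)) ∧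
    (x.2 ≤ 0 → HasMFDerivWithinAt 𝓘(ℝ, ℝ × ℝ) (𝓡 3) F (strip I σ) x
      (mfderivWithin 𝓘(ℝ, ℝ × ℝ) (𝓡 3) F (I ×ˢ Icc (-σ) 0) x)) := by
  have hp' : 0 ≤ x.2 → HasMFDerivWithinAt 𝓘(ℝ, ℝ × ℝ) (𝓡 3) F (I ×ˢ Icc 0 σ) x
      (mfderivWithin 𝓘(ℝ, ℝ × ℝ) (𝓡 3) F (I ×ˢ Icc 0 σ) x) := fun h =>
    (hp x ⟨hx.1, h, hx.2.2⟩).hasMFDerivWithinAt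
  have hm' : x.2 ≤ 0 → HasMFDerivWithinAt 𝓘(ℝ, ℝ × ℝ) (𝓡 3) F (I ×ˢ Icc (-σ) 0) x
      (mfderivWithin 𝓘(ℝ, ℝ × ℝ) (𝓡 3) F (I ×ˢ Icc (-σ) 0) x) := fun h =>
    (hm x ⟨hx.1, hx.2.1, h⟩).hasMFDerivWithinAt
  have hU : strip I σ = I ×ˢ Icc 0 σ ∪ I ×ˢ Icc (-σ) 0 := by
    rw [← prod_union, union_comm, Icc_union_Icc_eq_Icc (by linarith) hσ.le, strip]
  rcases lt_trichotomy x.2 0 with h | h | h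
  · refine ⟨fun h' => absurd h' (not_le.2 h), fun _ => (hm' h.le).mono_of_mem_nhdsWithin ?_⟩
    rw [← strip_inter_nonpos hσ]
    exact inter_mem_nhdsWithin _ (continuous_snd.continuousAt.preimage_mem_nhds (Iic_mem_nhds h))
  · obtain ⟨ε, s⟩ := x
    obtain rfl : s = 0 := h
    have hu : HasMFDerivWithinAt 𝓘(ℝ, ℝ × ℝ) (𝓡 3) F (strip I σ) (ε, 0)
        (mfderivWithin 𝓘(ℝ, ℝ × ℝ) (𝓡 3) F (I ×ˢ Icc 0 σ) (ε, 0)) := by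
      rw [hU]
      refine (hp' le_rfl).union ?_
      rw [h0 ε hx.1]
      exact hm' le_rfl
    refine ⟨fun _ => hu, fun _ => ?_⟩
    rw [← h0 ε hx.1]
    exact hu
  · refine ⟨fun _ => (hp' h.le).mono_of_mem_nhdsWithin ?_, fun h' => absurd h' (not_le.2 h)⟩
    rw [← strip_inter_nonneg hσ]
    exact inter_mem_nhdsWithin _ (continuous_snd.continuousAt.preimage_mem_nhds (Ici_mem_nhds h))

/-- A map of class `C^1` on the two halves of a strip and with the same differential along the
common boundary is of class `C^1`. -/
lemma contMDiffOn_strip (hI : UniqueDiffOn ℝ I) (hσ : 0 < σ)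
    (hp : ContMDiffOn 𝓘(ℝ, ℝ × ℝ) (𝓡 3) 1 F (I ×ˢ Icc 0 σ))
    (hm : ContMDiffOn 𝓘(ℝ, ℝ × ℝ) (𝓡 3) 1 F (I ×ˢ Icc (-σ) 0))
    (h0 : ∀ ε ∈ I, mfderivWithin 𝓘(ℝ, ℝ × ℝ) (𝓡 3) F (I ×ˢ Icc 0 σ) (ε, 0)
      = mfderivWithin 𝓘(ℝ, ℝ × ℝ) (𝓡 3) F (I ×ˢ Icc (-σ) 0) (ε, 0)) :
    ContMDiffOn 𝓘(ℝ, ℝ × ℝ) (𝓡 3) 1 F (strip I σ) := by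
  have hd := fun {x} (hx : x ∈ strip I σ) => hasMFDerivWithinAt_strip hσ
    (hp.mdifferentiableOn (by simp)) (hm.mdifferentiableOn (by simp)) h0 hx
  have huD : UniqueDiffOn ℝ (strip I σ) := uniqueDiffOn_prod_Icc hI (by linarith)
  have hmd : MDifferentiableOn 𝓘(ℝ, ℝ × ℝ) (𝓡 3) F (strip I σ) := by
    intro x hx
    rcases le_total 0 x.2 with h | h
    · exact ((hd hx).1 h).mdifferentiableWithinAt
    · exact ((hd hx).2 h).mdifferentiableWithinAt
  intro x hx
  refine contMDiffWithinAt_of_ch_comp (F x) (n := 1) (hmd x hx).continuousWithinAt ?_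
    (mem_extChartAt_source _)
  have hsrc : F ⁻¹' (ch (F x)).source ∈ 𝓝[strip I σ] x :=
    (hmd x hx).continuousWithinAt ((isOpen_ch_source _).mem_nhds (mem_extChartAt_source _))
  -- Class `C^1` amounts to continuity of the differential in a chart. On each half the differential
  -- of the glued map is the one-sided differential, which is continuous.
  rw [show ((1 : ℕ∞) : ℕ∞ω) = 0 + 1 by simp, contDiffWithinAt_succ_iff_hasFDerivWithinAt' (by simp)]
  refine ⟨strip I σ ∩ F ⁻¹' (ch (F x)).source, ?_, ?_, by simp,
    fderivWithin ℝ (ch (F x) ∘ F) (strip I σ), ?_, ?_⟩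
  · rw [insert_eq_of_mem hx]
    exact Filter.inter_mem self_mem_nhdsWithin hsrc
  · exact inter_subset_left.trans (subset_insert _ _)
  · intro y hy
    exact (hasFDerivWithinAt_ch_comp (F x) (hmd y hy.1).hasMFDerivWithinAt
      hy.2).differentiableWithinAt.hasFDerivWithinAt
  rw [contDiffWithinAt_zero hx]
  refine ⟨_, hsrc, ?_⟩
  intro y hy
  have hval : ∀ z ∈ strip I σ ∩ F ⁻¹' (ch (F x)).source, ∀ S : Set (ℝ × ℝ), UniqueDiffOn ℝ S →
      z ∈ S → MDifferentiableOn 𝓘(ℝ, ℝ × ℝ) (𝓡 3) F S →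
      HasMFDerivWithinAt 𝓘(ℝ, ℝ × ℝ) (𝓡 3) F (strip I σ) z
        (mfderivWithin 𝓘(ℝ, ℝ × ℝ) (𝓡 3) F S z) →
      fderivWithin ℝ (ch (F x) ∘ F) (strip I σ) z = fderivWithin ℝ (ch (F x) ∘ F) S z := by
    intro z hz S hS hzS hFS h
    rw [(hasFDerivWithinAt_ch_comp (F x) h hz.2).fderivWithin (huD z hz.1),
      (hasFDerivWithinAt_ch_comp (F x) (hFS z hzS).hasMFDerivWithinAt hz.2).fderivWithin (hS z hzS)]
  have key : ∀ a b : ℝ, a < b → ContMDiffOn 𝓘(ℝ, ℝ × ℝ) (𝓡 3) 1 F (I ×ˢ Icc a b) →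
      (∀ z ∈ strip I σ ∩ (I ×ˢ Icc a b), HasMFDerivWithinAt 𝓘(ℝ, ℝ × ℝ) (𝓡 3) F (strip I σ) z
        (mfderivWithin 𝓘(ℝ, ℝ × ℝ) (𝓡 3) F (I ×ˢ Icc a b) z)) → y ∈ I ×ˢ Icc a b →
      ContinuousWithinAt (fderivWithin ℝ (ch (F x) ∘ F) (strip I σ))
        (strip I σ ∩ F ⁻¹' (ch (F x)).source ∩ I ×ˢ Icc a b) y := by
    intro a b hab hF h hyS
    have hS := uniqueDiffOn_prod_Icc hI hab
    have h1 := ((contDiffWithinAt_ch_comp (n := 1) (F x) (hF y hyS) hy.2).fderivWithin_right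
      (m := 0) hS (by simp) hyS).continuousWithinAt
    refine (h1.mono inter_subset_right).congr (fun z hz => ?_) ?_
    · exact hval z hz.1 _ hS hz.2 (hF.mdifferentiableOn (by simp)) (h z ⟨hz.1.1, hz.2⟩)
    · exact hval y hy _ hS hyS (hF.mdifferentiableOn (by simp)) (h y ⟨hy.1, hyS⟩)
  refine continuousWithinAt_of_halves (fun h => ?_) (fun h => ?_)
  · rw [inter_right_comm, strip_inter_nonneg hσ]
    refine (key 0 σ hσ hp (fun z hz => (hd hz.1).1 hz.2.2.1) ⟨hy.1.1, h, hy.1.2.2⟩).mono ?_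
    rintro z ⟨hz, hz'⟩
    exact ⟨⟨⟨hz.1, by linarith [hz.2.1], hz.2.2⟩, hz'⟩, hz⟩
  · rw [inter_right_comm, strip_inter_nonpos hσ]
    refine (key (-σ) 0 (by linarith) hm (fun z hz => (hd hz.1).2 hz.2.2.2)
      ⟨hy.1.1, hy.1.2.1, h⟩).mono ?_
    rintro z ⟨hz, hz'⟩
    exact ⟨⟨⟨hz.1, hz.2.1, by linarith [hz.2.2]⟩, hz'⟩, hz⟩

end Glue

end SubRiem

/-! ### The neighborhood as a ruled surface of class `C^1`. -/

namespace SubRiem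

variable {M : Type*} [TopologicalSpace M] [ChartedSpace E3 M] [IsManifold (𝓡 3) ∞ M]

namespace ContactSubRiemannian

variable (A : ContactSubRiemannian M)

/-- Base points such as `F (ε, 0)` and `Γ ε` are equal but not by definition, so vectors over them
are compared as elements of the tangent bundle. -/
lemma eta_totalSpace_congr {a b : TangentBundle (𝓡 3) M} (h : a = b) :
    A.η a.1 a.2 = A.η b.1 b.2 := by rw [h]

lemma inner_totalSpace_congr {a b : TangentBundle (𝓡 3) M} (h : a = b) :
    A.g.inner a.1 a.2 a.2 = A.g.inner b.1 b.2 b.2 := by rw [h]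

section Side

variable {A} {I : Set ℝ} {Γ : ℝ → M} {lam σ δ : ℝ} {G : ℝ × ℝ → M}

lemma IsRuledSide.d₂_unit_horizontal (h : A.IsRuledSide I Γ lam σ δ G) (hσ : 0 < σ)
    {x : ℝ × ℝ} (hx : x ∈ I ×ˢ Icc 0 σ) :
    A.η (G x) (d₂ G (I ×ˢ Icc 0 σ) x) = 0 ∧
      A.g.inner (G x) (d₂ G (I ×ˢ Icc 0 σ) x) (d₂ G (I ×ˢ Icc 0 σ) x) = 1 := by
  have h1 := velocity_snd_eq_d₂ (uniqueDiffOn_Icc hσ)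
    (h.2.1.mdifferentiableOn (by simp) x hx) hx
  have h2 := (h.1 x.1 hx.1).1.2.1 x.2 hx.2
  rw [h1] at h2
  exact ⟨h2.1, A.inner_self_of_norm_eq_one h2.2⟩

lemma IsRuledSide.d₂_zero (h : A.IsRuledSide I Γ lam σ δ G) (hσ : 0 < σ) {ε : ℝ} (hε : ε ∈ I) :
    (⟨G (ε, 0), d₂ G (I ×ˢ Icc 0 σ) (ε, 0)⟩ : TangentBundle (𝓡 3) M)
      = ⟨Γ ε, δ • A.J (Γ ε) (velocity Γ I ε)⟩ := by
  have hx : ((ε, 0) : ℝ × ℝ) ∈ I ×ˢ Icc 0 σ := ⟨hε, le_rfl, hσ.le⟩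
  have h1 := velocity_snd_eq_d₂ (uniqueDiffOn_Icc hσ)
    (h.2.1.mdifferentiableOn (by simp) _ hx) hx
  rw [← (h.1 ε hε).2, ← h1]

lemma IsRuledSide.d₁_zero (h : A.IsRuledSide I Γ lam σ δ G) (hσ : 0 < σ)
    (hI : UniqueDiffOn ℝ I) {ε : ℝ} (hε : ε ∈ I) :
    (⟨G (ε, 0), d₁ G (I ×ˢ Icc 0 σ) (ε, 0)⟩ : TangentBundle (𝓡 3) M)
      = ⟨Γ ε, velocity Γ I ε⟩ := by
  have hx : ((ε, 0) : ℝ × ℝ) ∈ I ×ˢ Icc 0 σ := ⟨hε, le_rfl, hσ.le⟩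
  have h1 := velocity_fst_eq_d₁ hI (h.2.1.mdifferentiableOn (by simp) _ hx) hx
  rw [← h1]
  exact mfderivWithin_totalSpace_congr (f := fun ε => G (ε, 0)) (g := Γ)
    (fun ε hε => congrArg Bundle.TotalSpace.proj (h.1 ε hε).2) hε 1

end Side

/-- A map of class `C^1` on the strip `I × [-σ,σ]`, ruled by horizontal curves parameterized by
arc-length that meet the horizontal curve `Γ` orthogonally, and of class `C^2` away from `Γ`. -/
structure IsRuledSurface (I : Set ℝ) (Γ : ℝ → M) (σ : ℝ) (F : ℝ × ℝ → M) : Prop where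
  contMDiffOn : ContMDiffOn 𝓘(ℝ, ℝ × ℝ) (𝓡 3) 1 F (strip I σ)
  contMDiffAt : ∀ x ∈ interior I ×ˢ Ioo (-σ) σ, x.2 ≠ 0 →
    ContMDiffAt 𝓘(ℝ, ℝ × ℝ) (𝓡 3) 2 F x
  eta_d₂ : ∀ x ∈ strip I σ, A.η (F x) (d₂ F (strip I σ) x) = 0
  inner_d₂ : ∀ x ∈ strip I σ,
    A.g.inner (F x) (d₂ F (strip I σ) x) (d₂ F (strip I σ) x) = 1
  d₁_zero : ∀ ε ∈ I, (⟨F (ε, 0), d₁ F (strip I σ) (ε, 0)⟩ : TangentBundle (𝓡 3) M)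
    = ⟨Γ ε, velocity Γ I ε⟩
  d₂_zero : ∀ ε ∈ I, (⟨F (ε, 0), d₂ F (strip I σ) (ε, 0)⟩ : TangentBundle (𝓡 3) M)
    = ⟨Γ ε, A.J (Γ ε) (velocity Γ I ε)⟩
  eta_d₁_ne : ∀ x ∈ strip I σ, x.2 ≠ 0 → A.η (F x) (d₁ F (strip I σ) x) ≠ 0
  immersiveOn : ImmersiveOn F (strip I σ)

variable {A} {I : Set ℝ} {Γ : ℝ → M} {lam σ : ℝ} {F : ℝ × ℝ → M}

/-- The two sides meet in a `C^1` way: along `Γ` both have `∂/∂ε = Γ̇`. The second side leaves with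
velocity `-J(Γ̇)` in the reversed parameter `-s`, so its derivative in `s` is again `J(Γ̇)`. -/
theorem IsNeighborhood.isRuledSurface (h : A.IsNeighborhood I Γ lam σ F)
    (hI : UniqueDiffOn ℝ I) : A.IsRuledSurface I Γ σ F := by
  obtain ⟨hσ, hp, hm⟩ := h
  set Dp := I ×ˢ Icc 0 σ with hDp
  set Dm := I ×ˢ Icc (-σ) 0 with hDm
  have huD : UniqueDiffOn ℝ (strip I σ) := uniqueDiffOn_prod_Icc hI (by linarith)
  have hmD := contMDiffOn_of_refl (n := 2) hm.2.1
  have hpd := hp.2.1.mdifferentiableOn (by simp)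
  have hmd := hmD.mdifferentiableOn (by simp)
  have hrefl := fun {x : ℝ × ℝ} (hx : x ∈ Dm) (e : ℝ × ℝ) => mfderivWithin_refl hI hσ
    (hm.2.1.mdifferentiableOn (by simp)) hx e
  have hr1 : reflCLM (1, 0) = (1, 0) := by simp [reflCLM_apply]
  have hr2 : reflCLM (0, 1) = -(0, 1) := by simp [reflCLM_apply]
  have h0mem : ∀ ε ∈ I, ((ε, 0) : ℝ × ℝ) ∈ Dm := fun ε hε => ⟨hε, by simp [hσ.le]⟩
  have hneg : ∀ {p q : M} {u : TangentSpace (𝓡 3) p} {w : TangentSpace (𝓡 3) q},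
      (⟨p, u⟩ : TangentBundle (𝓡 3) M) = ⟨q, w⟩ → (⟨p, -u⟩ : TangentBundle (𝓡 3) M) = ⟨q, -w⟩ := by
    rintro p q u w h
    obtain ⟨rfl, h⟩ := Bundle.TotalSpace.mk.inj h
    rw [eq_of_heq h]
  have hr0 : ∀ ε : ℝ, reflCLM (ε, 0) = (ε, 0) := fun ε => by simp [reflCLM_apply]
  have hmr1 : ∀ x ∈ Dm, (⟨F x, d₁ F Dm x⟩ : TangentBundle (𝓡 3) M)
      = ⟨F ((reflCLM x).1, -(reflCLM x).2), d₁ (fun x => F (x.1, -x.2)) Dp (reflCLM x)⟩ := by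
    intro x hx
    have := hrefl hx (1, 0)
    rwa [hr1] at this
  have hmr2 : ∀ x ∈ Dm, (⟨F x, d₂ F Dm x⟩ : TangentBundle (𝓡 3) M)
      = ⟨F ((reflCLM x).1, -(reflCLM x).2), -d₂ (fun x => F (x.1, -x.2)) Dp (reflCLM x)⟩ := by
    intro x hx
    refine (hrefl hx (0, 1)).trans (congrArg (Bundle.TotalSpace.mk _) ?_)
    set L : ℝ × ℝ →L[ℝ] E3 :=
      mfderivWithin 𝓘(ℝ, ℝ × ℝ) (𝓡 3) (fun x => F (x.1, -x.2)) Dp (reflCLM x)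
    exact (congrArg L hr2).trans (map_neg L (0, 1))
  have hm1 : ∀ ε ∈ I, (⟨F (ε, 0), d₁ F Dm (ε, 0)⟩ : TangentBundle (𝓡 3) M)
      = ⟨Γ ε, velocity Γ I ε⟩ := by
    intro ε hε
    have := hmr1 _ (h0mem ε hε)
    rw [hr0] at this
    exact this.trans (hm.d₁_zero hσ hI hε)
  have hm2 : ∀ ε ∈ I, (⟨F (ε, 0), d₂ F Dm (ε, 0)⟩ : TangentBundle (𝓡 3) M)
      = ⟨Γ ε, A.J (Γ ε) (velocity Γ I ε)⟩ := by
    intro ε hε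
    have h1 := hneg (hm.d₂_zero hσ hε)
    rw [neg_smul, neg_neg, one_smul] at h1
    have := hmr2 _ (h0mem ε hε)
    rw [hr0] at this
    exact this.trans h1
  have hp1 := fun {ε} (hε : ε ∈ I) => hp.d₁_zero hσ hI hε
  have hp2 := fun {ε} (hε : ε ∈ I) => hp.d₂_zero hσ hε
  simp only [one_smul] at hp2
  have h0 : ∀ ε ∈ I, mfderivWithin 𝓘(ℝ, ℝ × ℝ) (𝓡 3) F Dp (ε, 0)
      = mfderivWithin 𝓘(ℝ, ℝ × ℝ) (𝓡 3) F Dm (ε, 0) := by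
    intro ε hε
    refine clm_ext_prod (E := E3) ?_ ?_
    · exact eq_of_heq (Bundle.TotalSpace.mk.inj ((hp1 hε).trans (hm1 ε hε).symm)).2
    · exact eq_of_heq (Bundle.TotalSpace.mk.inj ((hp2 hε).trans (hm2 ε hε).symm)).2
  have hd := fun {x} (hx : x ∈ strip I σ) => hasMFDerivWithinAt_strip hσ hpd hmd h0 hx
  have hdp : ∀ x ∈ strip I σ, 0 ≤ x.2 → mfderivWithin 𝓘(ℝ, ℝ × ℝ) (𝓡 3) F (strip I σ) x
      = mfderivWithin 𝓘(ℝ, ℝ × ℝ) (𝓡 3) F Dp x := fun x hx h =>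
    ((hd hx).1 h).mfderivWithin (huD x hx).uniqueMDiffWithinAt
  have hdm : ∀ x ∈ strip I σ, x.2 ≤ 0 → mfderivWithin 𝓘(ℝ, ℝ × ℝ) (𝓡 3) F (strip I σ) x
      = mfderivWithin 𝓘(ℝ, ℝ × ℝ) (𝓡 3) F Dm x := fun x hx h =>
    ((hd hx).2 h).mfderivWithin (huD x hx).uniqueMDiffWithinAt
  have hcase : ∀ x ∈ strip I σ, (0 ≤ x.2 ∧ x ∈ Dp) ∨ (x.2 ≤ 0 ∧ x ∈ Dm) := by
    intro x hx
    rcases le_total 0 x.2 with h | h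
    · exact Or.inl ⟨h, hx.1, h, hx.2.2⟩
    · exact Or.inr ⟨h, hx.1, hx.2.1, h⟩
  refine ⟨contMDiffOn_strip hI hσ (hp.2.1.of_le (by norm_num)) (hmD.of_le (by norm_num)) h0,
    ?_, ?_, ?_, ?_, ?_, ?_, ?_⟩
  · intro x hx hx0
    have hI0 : interior I ∈ 𝓝 x.1 := isOpen_interior.mem_nhds hx.1
    rcases lt_or_gt_of_ne hx0 with h | h
    · refine (hmD x ⟨interior_subset hx.1, hx.2.1.le, h.le⟩).contMDiffAt ?_
      exact prod_mem_nhds (mem_of_superset hI0 interior_subset) (Icc_mem_nhds hx.2.1 h)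
    · refine (hp.2.1 x ⟨interior_subset hx.1, h.le, hx.2.2.le⟩).contMDiffAt ?_
      exact prod_mem_nhds (mem_of_superset hI0 interior_subset) (Icc_mem_nhds h hx.2.2)
  · intro x hx
    rcases hcase x hx with ⟨h, h'⟩ | ⟨h, h'⟩
    · rw [d₂, hdp x hx h]
      exact (hp.d₂_unit_horizontal hσ h').1
    · rw [d₂, hdm x hx h]
      refine (A.eta_totalSpace_congr (hmr2 x h')).trans ?_
      rw [map_neg, neg_eq_zero]
      exact (hm.d₂_unit_horizontal hσ (reflCLM_mem h')).1
  · intro x hx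
    rcases hcase x hx with ⟨h, h'⟩ | ⟨h, h'⟩
    · rw [d₂, hdp x hx h]
      exact (hp.d₂_unit_horizontal hσ h').2
    · rw [d₂, hdm x hx h]
      refine (A.inner_totalSpace_congr (hmr2 x h')).trans ?_
      have := (hm.d₂_unit_horizontal hσ (reflCLM_mem h')).2
      simpa using this
  · intro ε hε
    rw [d₁, hdp (ε, 0) ⟨hε, by simp [hσ.le]⟩ le_rfl]
    exact hp1 hε
  · intro ε hε
    rw [d₂, hdp (ε, 0) ⟨hε, by simp [hσ.le]⟩ le_rfl]
    exact hp2 hε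
  · intro x hx hx0
    rcases hcase x hx with ⟨h, h'⟩ | ⟨h, h'⟩
    · rw [d₁, hdp x hx h]
      exact hp.2.2.2 x.1 hx.1 x.2 ⟨lt_of_le_of_ne h hx0.symm, hx.2.2⟩
    · rw [d₁, hdm x hx h]
      refine (A.eta_totalSpace_congr (hmr1 x h')).trans_ne ?_
      exact hm.2.2.2 x.1 hx.1 (-x.2) ⟨by linarith [lt_of_le_of_ne h hx0], by linarith [hx.2.1]⟩
  · intro x hx
    rcases hcase x hx with ⟨h, h'⟩ | ⟨h, h'⟩
    · rw [hdp x hx h]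
      exact hp.2.2.1 x h'
    · rw [hdm x hx h]
      intro a b hab
      have ha := hrefl h' a
      have hb := hrefl h' b
      beta_reduce at hab
      rw [hab] at ha
      have h2 := eq_of_heq (Bundle.TotalSpace.mk.inj (ha.symm.trans hb)).2
      have h3 := hm.2.2.1 _ (reflCLM_mem h') h2
      obtain ⟨h4, h5⟩ := Prod.mk.inj (show ((a : ℝ × ℝ).1, -(a : ℝ × ℝ).2)
        = ((b : ℝ × ℝ).1, -(b : ℝ × ℝ).2) from h3)
      exact Prod.ext h4 (neg_inj.1 h5)

end ContactSubRiemannian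

end SubRiem

/-! ### The Reeb component `v = ⟨∂F/∂ε, T⟩` and its derivative along the rulings. -/

namespace SubRiem

variable {M : Type*} [TopologicalSpace M] [ChartedSpace E3 M] [IsManifold (𝓡 3) ∞ M]

lemma surfaceDeriv_mfderivWithin {F : ℝ × ℝ → M} {D : Set (ℝ × ℝ)} (hF : ImmersiveOn F D)
    {x : ℝ × ℝ} (hx : x ∈ D) (ρ : ℝ × ℝ → ℝ) (e : ℝ × ℝ) :
    surfaceDeriv F D ρ x (mfderivWithin 𝓘(ℝ, ℝ × ℝ) (𝓡 3) F D x e) = fderivWithin ℝ ρ D x e := by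
  have h := Function.leftInverse_invFun (hF x hx) e
  rw [surfaceDeriv]
  exact congrArg _ h

namespace ContactSubRiemannian

variable (A : ContactSubRiemannian M)

/-- The function `⟨∂f/∂ε, T⟩`. -/
def reebComponent (f : ℝ × ℝ → M) (D : Set (ℝ × ℝ)) (x : ℝ × ℝ) : ℝ := A.η (f x) (d₁ f D x)

/-- The derivative of `⟨∂f/∂ε, T⟩` along the rulings of a surface ruled by horizontal curves. -/
def reebComponentDeriv (f : ℝ × ℝ → M) (D : Set (ℝ × ℝ)) (x : ℝ × ℝ) : ℝ :=
  -2 * A.g.inner (f x) (A.J (f x) (d₁ f D x)) (d₂ f D x)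

variable {A}

section General

variable {f : ℝ × ℝ → M} {D : Set (ℝ × ℝ)}

lemma continuousOn_reebComponent (hf : ContMDiffOn 𝓘(ℝ, ℝ × ℝ) (𝓡 3) 1 f D)
    (hD : UniqueDiffOn ℝ D) : ContinuousOn (A.reebComponent f D) D := by
  intro x hx
  have hsx : f x ∈ (ch (f x)).source := mem_extChartAt_source _
  have h1 := (contDiffWithinAt_chartFwd_mfderivWithin (n := 0) (f x) hf hD hx hsx
    (1, 0)).continuousWithinAt
  have h0 := (contDiffWithinAt_ch_comp (n := 1) (f x) (hf x hx) hsx).continuousWithinAt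
  have he : ContinuousAt (A.etaC (f x)) (ch (f x) (f x)) :=
    (A.hasFDerivAt_etaC (f x) ((ch (f x)).map_source hsx)).continuousAt
  have h2 := (ContinuousAt.comp_continuousWithinAt (g := A.etaC (f x)) (f := ch (f x) ∘ f)
    he h0).clm_apply h1
  refine h2.congr_of_eventuallyEq ?_ ?_
  · filter_upwards [(hf x hx).continuousWithinAt ((isOpen_ch_source _).mem_nhds hsx)] with z hz
    exact A.eta_eq_etaC (f x) hz _
  · exact A.eta_eq_etaC (f x) hsx _

lemma continuousOn_reebComponentDeriv (hf : ContMDiffOn 𝓘(ℝ, ℝ × ℝ) (𝓡 3) 1 f D)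
    (hD : UniqueDiffOn ℝ D) : ContinuousOn (A.reebComponentDeriv f D) D := by
  intro x hx
  have hsx : f x ∈ (ch (f x)).source := mem_extChartAt_source _
  have h1 := (contDiffWithinAt_chartFwd_mfderivWithin (n := 0) (f x) hf hD hx hsx
    (1, 0)).continuousWithinAt
  have h2 := (contDiffWithinAt_chartFwd_mfderivWithin (n := 0) (f x) hf hD hx hsx
    (0, 1)).continuousWithinAt
  have h0 := (contDiffWithinAt_ch_comp (n := 1) (f x) (hf x hx) hsx).continuousWithinAt
  have hy := (ch (f x)).map_source hsx
  have he := (A.continuousOn_areaC (f x)).continuousAt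
    (x := ((ch (f x) ∘ f) x, (chartFwd (f x) (f x) (d₁ f D x), chartFwd (f x) (f x) (d₂ f D x))))
    (((isOpen_ch_target (f x)).prod isOpen_univ).mem_nhds ⟨hy, mem_univ _⟩)
  have h3 := ContinuousWithinAt.const_mul (ContinuousAt.comp_continuousWithinAt (x := x) he
    (h0.prodMk (h1.prodMk h2))) (-2)
  refine h3.congr_of_eventuallyEq ?_ ?_
  · filter_upwards [(hf x hx).continuousWithinAt ((isOpen_ch_source _).mem_nhds hsx)] with z hz
    exact congrArg (-2 * ·) (A.inner_J_eq_areaC (f x) hz _ _)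
  · exact congrArg (-2 * ·) (A.inner_J_eq_areaC (f x) hsx _ _)

end General

variable {I : Set ℝ} {Γ : ℝ → M} {σ : ℝ} {F : ℝ × ℝ → M}

namespace IsRuledSurface

variable (h : A.IsRuledSurface I Γ σ F) (hI : UniqueDiffOn ℝ I) (hσ : 0 < σ)
include h

lemma reebComponent_zero (hΓ : A.IsUnitHorizontalOn Γ I) {ε : ℝ} (hε : ε ∈ I) :
    A.reebComponent F (strip I σ) (ε, 0) = 0 :=
  (A.eta_totalSpace_congr (h.d₁_zero ε hε)).trans (hΓ ε hε).1

lemma reebComponentDeriv_zero (hΓ : A.IsUnitHorizontalOn Γ I) {ε : ℝ} (hε : ε ∈ I) :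
    A.reebComponentDeriv F (strip I σ) (ε, 0) = -2 := by
  have h1 := h.d₁_zero ε hε
  have h2 := h.d₂_zero ε hε
  obtain ⟨h3, h4⟩ := hΓ ε hε
  have h5 := A.inner_self_of_norm_eq_one h4
  have key : ∀ (p q : M) (u w : TangentSpace (𝓡 3) p) (z : TangentSpace (𝓡 3) q),
      (⟨p, u⟩ : TangentBundle (𝓡 3) M) = ⟨q, z⟩ → (⟨p, w⟩ : TangentBundle (𝓡 3) M) = ⟨q, A.J q z⟩ →
      A.g.inner p (A.J p u) w = A.g.inner q (A.J q z) (A.J q z) := by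
    intro p q u w z e1 e2
    obtain ⟨rfl, e1⟩ := Bundle.TotalSpace.mk.inj e1
    obtain ⟨-, e2⟩ := Bundle.TotalSpace.mk.inj e2
    rw [eq_of_heq e1, eq_of_heq e2]
  rw [reebComponentDeriv, key _ _ _ _ _ h1 h2, A.J_isometry _ _ _ h3 h3, h5]
  norm_num

omit h in
lemma strip_mem_nhds {x : ℝ × ℝ} (hx : x ∈ interior I ×ˢ Ioo (-σ) σ) : strip I σ ∈ 𝓝 x :=
  prod_mem_nhds (mem_of_superset (isOpen_interior.mem_nhds hx.1) interior_subset)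
    (Icc_mem_nhds hx.2.1 hx.2.2)

/-- Off `Γ` the map is of class `C^2`, so its second derivatives commute and `∂_s η(F_ε) - ∂_ε
η(F_s)` is `dη` up to the factor `2`, that is `2 ⟨J F_s, F_ε⟩`. The second term is zero because the
rulings are horizontal. -/
lemma hasDerivAt_reebComponent_of_ne {ε s : ℝ} (hε : ε ∈ interior I) (hs : s ∈ Ioo (-σ) σ)
    (hs0 : s ≠ 0) :
    HasDerivAt (fun s => A.reebComponent F (strip I σ) (ε, s))
      (A.reebComponentDeriv F (strip I σ) (ε, s)) s := by
  set D := strip I σ with hD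
  set x : ℝ × ℝ := (ε, s) with hx
  have hxm : x ∈ interior I ×ˢ Ioo (-σ) σ := ⟨hε, hs⟩
  have hDn : D ∈ 𝓝 x := strip_mem_nhds hxm
  have hxD : x ∈ D := mem_of_mem_nhds hDn
  set q := F x with hq
  have hsx : q ∈ (ch q).source := mem_extChartAt_source _
  set φ := ch q ∘ F with hφ
  have hc2 : ContDiffAt ℝ 2 φ x :=
    contDiffWithinAt_ch_comp (n := 2) (s := univ) q (h.contMDiffAt x hxm hs0) hsx
  have hφ1 : HasFDerivAt φ (fderiv ℝ φ x) x := (hc2.differentiableAt (by simp)).hasFDerivAt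
  have hφ2 : HasFDerivAt (fderiv ℝ φ) (fderiv ℝ (fderiv ℝ φ) x) x :=
    ((hc2.fderiv_right (m := 1) (by norm_num)).differentiableAt (by simp)).hasFDerivAt
  have hsymm : ∀ a b, fderiv ℝ (fderiv ℝ φ) x a b = fderiv ℝ (fderiv ℝ φ) x b a :=
    hc2.isSymmSndFDerivAt (by simp)
  have hη : HasFDerivAt (A.etaC q) (fderiv ℝ (A.etaC q) (φ x)) (φ x) :=
    A.hasFDerivAt_etaC q ((ch q).map_source hsx)
  have hηφ : HasFDerivAt (fun y => A.etaC q (φ y)) _ x := hη.comp x hφ1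
  have hval : ∀ e : ℝ × ℝ, ∀ᶠ y in 𝓝 x, A.η (F y) (mfderivWithin 𝓘(ℝ, ℝ × ℝ) (𝓡 3) F D y e)
      = A.etaC q (φ y) (fderiv ℝ φ y e) := by
    intro e
    have hc : ContinuousAt F x := (h.contMDiffAt x hxm hs0).continuousAt
    filter_upwards [hc ((isOpen_ch_source q).mem_nhds hsx), eventually_mem_nhds_iff.2 hDn]
      with y hy hyD
    rw [A.eta_eq_etaC q hy, chartFwd_mfderivWithin q
      (h.contMDiffOn.mdifferentiableOn (by simp) y (mem_of_mem_nhds hyD))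
      (uniqueDiffWithinAt_of_mem_nhds hyD) hy, fderivWithin_of_mem_nhds hyD]
    rfl
  have hder : ∀ e : ℝ × ℝ, HasFDerivAt (fun y => A.etaC q (φ y) (fderiv ℝ φ y e)) _ x := fun e =>
    hηφ.clm_apply (hφ2.clm_apply (hasFDerivAt_const e x))
  have hD1 := (hder (1, 0)).congr_of_eventuallyEq (hval (1, 0))
  -- The function `η(∂F/∂s)` vanishes identically, so the formula for its differential must give
  -- zero in the direction of `ε`.
  have hD2 : HasFDerivAt (fun _ : ℝ × ℝ => (0 : ℝ)) _ x :=
    (hder (0, 1)).congr_of_eventuallyEq (by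
      filter_upwards [hval (0, 1), hDn] with y hy hyD
      rw [← hy]
      exact (h.eta_d₂ y hyD).symm)
  have hzero := DFunLike.congr_fun (hD2.unique (hasFDerivAt_const 0 x)) (1, 0)
  have hline : HasDerivAt (fun s : ℝ => (ε, s)) (0, 1) s :=
    (hasDerivAt_const s ε).prodMk (hasDerivAt_id s)
  have hres := HasFDerivAt.comp_hasDerivAt s hD1 hline
  refine hres.congr_deriv ?_
  have harea := A.fderiv_etaC_sub q ((ch q).map_source hsx) (fderiv ℝ φ x (0, 1))
    (fderiv ℝ φ x (1, 0))
  have hd : ∀ e : ℝ × ℝ, fderiv ℝ φ x e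
      = chartFwd q q (mfderivWithin 𝓘(ℝ, ℝ × ℝ) (𝓡 3) F D x e) := by
    intro e
    rw [chartFwd_mfderivWithin q (h.contMDiffOn.mdifferentiableOn (by simp) x hxD)
      (uniqueDiffWithinAt_of_mem_nhds hDn) hsx, fderivWithin_of_mem_nhds hDn]
  have harea2 : A.areaC q (ch q q) (fderiv ℝ φ x (0, 1)) (fderiv ℝ φ x (1, 0))
      = A.g.inner q (A.J q (d₂ F D x)) (d₁ F D x) := by
    rw [A.inner_J_eq_areaC q hsx, hd, hd]
    rfl
  have hskew : A.g.inner q (A.J q (d₂ F D x)) (d₁ F D x)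
      = -A.g.inner q (A.J q (d₁ F D x)) (d₂ F D x) := by
    rw [A.inner_J_of_unit_horizontal (h.eta_d₂ x hxD) (h.inner_d₂ x hxD), neg_neg, A.g.symm]
  rw [harea2, hskew] at harea
  have hs12 := hsymm (0, 1) (1, 0)
  have hφx : φ x = ch q q := rfl
  simp at hzero ⊢
  rw [hφx] at hzero ⊢
  rw [reebComponentDeriv, hs12]
  change _ = -2 * A.g.inner q (A.J q (d₁ F D x)) (d₂ F D x)
  linarith

end IsRuledSurface

/-- Extends the derivative of `v` across `Γ`, where the surface is only known to be of class `C^1`: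
a continuous function whose derivative has a limit at a point is differentiable there. -/
lemma hasDerivAt_of_hasDerivAt_of_ne_of_mem {f g : ℝ → ℝ} {U : Set ℝ} {a : ℝ} (hU : U ∈ 𝓝 a)
    (hd : ∀ y ∈ U, y ≠ a → HasDerivAt f (g y) y) (hf : ContinuousAt f a) (hg : ContinuousAt g a) :
    HasDerivAt f (g a) a := by
  have hdiff : DifferentiableOn ℝ f (U \ {a}) := fun y hy =>
    (hd y hy.1 hy.2).differentiableAt.differentiableWithinAt
  have hmem : U \ {a} ∈ 𝓝[≠] a := sdiff_mem_nhdsWithin_compl hU _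
  have hgt : 𝓝[>] a ≤ 𝓝[≠] a := nhdsWithin_mono _ fun y hy => ne_of_gt hy
  have hlt : 𝓝[<] a ≤ 𝓝[≠] a := nhdsWithin_mono _ fun y hy => ne_of_lt hy
  have hlim : Tendsto (fun y => deriv f y) (𝓝[≠] a) (𝓝 (g a)) := by
    refine (hg.tendsto.mono_left nhdsWithin_le_nhds).congr' ?_
    filter_upwards [hmem] with y hy using ((hd y hy.1 hy.2).deriv).symm
  have h1 := hasDerivWithinAt_Ici_of_tendsto_deriv hdiff hf.continuousWithinAt (hgt hmem)
    (hlim.mono_left hgt)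
  have h2 := hasDerivWithinAt_Iic_of_tendsto_deriv hdiff hf.continuousWithinAt (hlt hmem)
    (hlim.mono_left hlt)
  have h3 := h1.union h2
  rwa [Ici_union_Iic, hasDerivWithinAt_univ] at h3

namespace IsRuledSurface

variable (h : A.IsRuledSurface I Γ σ F) (hI : UniqueDiffOn ℝ I) (hσ : 0 < σ)
include h hI hσ

lemma hasDerivAt_reebComponent {ε s : ℝ} (hε : ε ∈ interior I) (hs : s ∈ Ioo (-σ) σ) :
    HasDerivAt (fun s => A.reebComponent F (strip I σ) (ε, s))
      (A.reebComponentDeriv F (strip I σ) (ε, s)) s := by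
  by_cases hs0 : s = 0
  · subst hs0
    have hD : UniqueDiffOn ℝ (strip I σ) := uniqueDiffOn_prod_Icc hI (by linarith)
    have hn : strip I σ ∈ 𝓝 (ε, (0 : ℝ)) := strip_mem_nhds ⟨hε, hs⟩
    refine hasDerivAt_of_hasDerivAt_of_ne_of_mem (U := Ioo (-σ) σ)
      (g := fun s => A.reebComponentDeriv F (strip I σ) (ε, s))
      (isOpen_Ioo.mem_nhds hs) (fun y hy hy0 => h.hasDerivAt_reebComponent_of_ne hε hy hy0) ?_ ?_
    · exact ContinuousAt.comp (f := fun s : ℝ => (ε, s))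
        ((continuousOn_reebComponent h.contMDiffOn hD).continuousAt hn) (by fun_prop)
    · exact ContinuousAt.comp (f := fun s : ℝ => (ε, s))
        ((continuousOn_reebComponentDeriv h.contMDiffOn hD).continuousAt hn) (by fun_prop)
  · exact h.hasDerivAt_reebComponent_of_ne hε hs hs0

lemma mfderivWithin_mono {σ₀ : ℝ} (h0 : 0 < σ₀) (h1 : σ₀ ≤ σ) {x : ℝ × ℝ}
    (hx : x ∈ strip I σ₀) : mfderivWithin 𝓘(ℝ, ℝ × ℝ) (𝓡 3) F (strip I σ₀) x
      = mfderivWithin 𝓘(ℝ, ℝ × ℝ) (𝓡 3) F (strip I σ) x := by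
  have hsub : strip I σ₀ ⊆ strip I σ := prod_mono_right (Icc_subset_Icc (by linarith) h1)
  exact ((h.contMDiffOn.mdifferentiableOn (by simp) x (hsub hx)).hasMFDerivWithinAt.mono
    hsub).mfderivWithin (uniqueDiffOn_prod_Icc hI (by linarith) x hx).uniqueMDiffWithinAt

theorem mono {σ₀ : ℝ} (h0 : 0 < σ₀) (h1 : σ₀ ≤ σ) : A.IsRuledSurface I Γ σ₀ F := by
  have hsub : strip I σ₀ ⊆ strip I σ := prod_mono_right (Icc_subset_Icc (by linarith) h1)
  have hd := fun {x} (hx : x ∈ strip I σ₀) => h.mfderivWithin_mono hI hσ h0 h1 hx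
  have hz : ∀ ε ∈ I, ((ε, 0) : ℝ × ℝ) ∈ strip I σ₀ := fun ε hε => ⟨hε, by simp [h0.le]⟩
  refine ⟨h.contMDiffOn.mono hsub, fun x hx => h.contMDiffAt x
    ⟨hx.1, Ioo_subset_Ioo (by linarith) h1 hx.2⟩, ?_, ?_, ?_, ?_, ?_, ?_⟩
  · intro x hx
    rw [d₂, hd hx]
    exact h.eta_d₂ x (hsub hx)
  · intro x hx
    rw [d₂, hd hx]
    exact h.inner_d₂ x (hsub hx)
  · intro ε hε
    rw [d₁, hd (hz ε hε)]
    exact h.d₁_zero ε hε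
  · intro ε hε
    rw [d₂, hd (hz ε hε)]
    exact h.d₂_zero ε hε
  · intro x hx
    rw [d₁, hd hx]
    exact h.eta_d₁_ne x (hsub hx)
  · intro x hx
    rw [hd hx]
    exact h.immersiveOn x (hsub hx)

/-- A function that is constant along the characteristic curves depends only on the foot point. -/
theorem hasFDerivWithinAt_of_fieldZ {ρ : ℝ × ℝ → ℝ} (hρ : ContDiffOn ℝ 1 ρ (strip I σ))
    (hZ : ∀ x ∈ strip I σ, x.2 ≠ 0 →
      surfaceDeriv F (strip I σ) ρ x (A.fieldZ F (strip I σ) x) = 0) :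
    ∀ x ∈ strip I σ, ρ x = ρ (x.1, 0) ∧ HasFDerivWithinAt ρ
      (derivWithin (fun ε => ρ (ε, 0)) I x.1 • ContinuousLinearMap.fst ℝ ℝ ℝ) (strip I σ) x := by
  have hD : UniqueDiffOn ℝ (strip I σ) := uniqueDiffOn_prod_Icc hI (by linarith)
  -- Off `Γ` the field `Z` is a nonzero multiple of `∂F/∂s`.
  have hne : ∀ x ∈ strip I σ, x.2 ≠ 0 → fderivWithin ℝ ρ (strip I σ) x (0, 1) = 0 := by
    intro x hx hx0
    have hv := h.eta_d₁_ne x hx hx0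
    have h1 := hZ x hx hx0
    set c : ℝ := -(|A.η (F x) (d₁ F (strip I σ) x)|⁻¹ * A.η (F x) (d₁ F (strip I σ) x)) with hc
    have hc0 : c ≠ 0 := neg_ne_zero.2 (mul_ne_zero (inv_ne_zero (abs_ne_zero.2 hv)) hv)
    rw [A.fieldZ_eq (h.eta_d₂ x hx) (h.inner_d₂ x hx) hv, ← hc] at h1
    have h2 := surfaceDeriv_mfderivWithin h.immersiveOn hx ρ (c • (0, 1))
    have hL : mfderivWithin 𝓘(ℝ, ℝ × ℝ) (𝓡 3) F (strip I σ) x (c • ((0, 1) : ℝ × ℝ))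
        = c • d₂ F (strip I σ) x :=
      ContinuousLinearMap.map_smul (show ℝ × ℝ →L[ℝ] E3 from
        mfderivWithin 𝓘(ℝ, ℝ × ℝ) (𝓡 3) F (strip I σ) x) c (0, 1)
    rw [hL, h1, map_smul] at h2
    exact (smul_eq_zero.1 h2.symm).resolve_left hc0
  have hcont := hρ.continuousOn_fderivWithin hD (by simp)
  have hdρ := hρ.differentiableOn (by simp)
  have hall : ∀ x ∈ strip I σ, fderivWithin ℝ ρ (strip I σ) x (0, 1) = 0 := by
    intro x hx
    by_cases hx0 : x.2 = 0
    · obtain ⟨ε, s⟩ := x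
      obtain rfl : s = 0 := hx0
      -- On `Γ` the derivative of `ρ` in `s` is the limit of its zero values at `s > 0`, because `ρ`
      -- is of class `C^1` up to `Γ`.
      have hline : Tendsto (fun s : ℝ => (ε, s)) (𝓝[Ioc 0 σ] 0) (𝓝[strip I σ] (ε, 0)) := by
        refine tendsto_nhdsWithin_iff.2 ⟨?_, ?_⟩
        · exact Tendsto.mono_left (by
            have : Continuous fun s : ℝ => (ε, s) := by fun_prop
            exact this.tendsto 0) nhdsWithin_le_nhds
        · filter_upwards [self_mem_nhdsWithin] with s hs
          exact ⟨hx.1, by linarith [hs.1], hs.2⟩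
      have h1 := ((hcont _ hx).clm_apply
        (continuousWithinAt_const (b := ((0, 1) : ℝ × ℝ)))).tendsto.comp hline
      have h2 : Tendsto ((fun x => fderivWithin ℝ ρ (strip I σ) x (0, 1)) ∘ fun s => (ε, s))
          (𝓝[Ioc 0 σ] 0) (𝓝 0) := by
        refine tendsto_const_nhds.congr' ?_
        filter_upwards [self_mem_nhdsWithin] with s hs
        exact (hne (ε, s) ⟨hx.1, by linarith [hs.1], hs.2⟩ hs.1.ne').symm
      have : (𝓝[Ioc 0 σ] (0 : ℝ)).NeBot := by
        rw [nhdsWithin_Ioc_eq_nhdsGT hσ]; infer_instance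
      exact tendsto_nhds_unique h1 h2
    · exact hne x hx hx0
  have hconst : ∀ x ∈ strip I σ, ρ x = ρ (x.1, 0) := by
    rintro ⟨ε, s⟩ hx
    have hder : ∀ t ∈ Icc (-σ) σ, HasDerivWithinAt (fun t => ρ (ε, t)) 0 (Icc (-σ) σ) t := by
      intro t ht
      have hxt : ((ε, t) : ℝ × ℝ) ∈ strip I σ := ⟨hx.1, ht⟩
      have hl : HasDerivWithinAt (fun t : ℝ => (ε, t)) (0, 1) (Icc (-σ) σ) t :=
        (hasDerivWithinAt_const _ _ _).prodMk (hasDerivWithinAt_id _ _)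
      have h1 := (hdρ _ hxt).hasFDerivWithinAt.comp_hasDerivWithinAt t hl
        (fun u hu => ⟨hx.1, hu⟩)
      rwa [hall _ hxt] at h1
    have hint := (convex_Icc (-σ) σ).norm_image_sub_le_of_norm_hasDerivWithin_le (C := 0) hder
      (by simp) (show (0 : ℝ) ∈ Icc (-σ) σ by simp [hσ.le]) hx.2
    simpa [sub_eq_zero] using hint
  intro x hx
  refine ⟨hconst x hx, ?_⟩
  have hz : ((x.1, 0) : ℝ × ℝ) ∈ strip I σ := ⟨hx.1, by simp [hσ.le]⟩
  have hΓd : DifferentiableWithinAt ℝ (fun ε => ρ (ε, 0)) I x.1 := by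
    refine DifferentiableWithinAt.comp (g := ρ) (f := fun ε : ℝ => (ε, (0 : ℝ))) x.1
      (t := strip I σ) (hdρ _ hz) ?_ (fun ε hε => ⟨hε, by simp [hσ.le]⟩)
    fun_prop
  have hfst : HasFDerivWithinAt (fun y : ℝ × ℝ => y.1) (ContinuousLinearMap.fst ℝ ℝ ℝ)
      (strip I σ) x := hasFDerivWithinAt_fst
  have h1 := hΓd.hasDerivWithinAt.comp_hasFDerivWithinAt x hfst (fun y hy => hy.1)
  exact h1.congr (fun y hy => hconst y hy) (hconst x hx)

end IsRuledSurface

end ContactSubRiemannian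

end SubRiem

/-! ### The vertical variation and its area density. -/

namespace SubRiem

lemma mfderivWithin_totalSpace_congr_of_eventuallyEq {M : Type*} [TopologicalSpace M]
    [ChartedSpace E3 M] {X : Type*} [NormedAddCommGroup X] [NormedSpace ℝ X]
    {f g : X → M} {s : Set X} {x : X} (hfg : f =ᶠ[𝓝[s] x] g) (hx : f x = g x) (e : X) :
    (⟨f x, mfderivWithin 𝓘(ℝ, X) (𝓡 3) f s x e⟩ : TangentBundle (𝓡 3) M)
      = ⟨g x, mfderivWithin 𝓘(ℝ, X) (𝓡 3) g s x e⟩ := by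
  refine Bundle.TotalSpace.ext hx (heq_of_eq ?_)
  have h := Filter.EventuallyEq.mfderivWithin_eq (I := 𝓘(ℝ, X)) (I' := 𝓡 3) hfg hx
  exact DFunLike.congr_fun h e

variable {M : Type*} [TopologicalSpace M] [ChartedSpace E3 M] [IsManifold (𝓡 3) ∞ M]

namespace ContactSubRiemannian

variable {A : ContactSubRiemannian M} {I : Set ℝ} {Γ : ℝ → M} {σ : ℝ} {F : ℝ × ℝ → M}

/-- A uniform lower bound for the time of existence of the Reeb flow near a compact set. -/
lemma exists_reebFlow_of_isCompact (A : ContactSubRiemannian M) {X : Type*} [TopologicalSpace X]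
    {f : X → M} {D S : Set X} (hf : ContinuousOn f D) (hS : IsCompact S) (hSD : S ⊆ D) :
    ∃ τ > 0, ∀ x ∈ S, ∃ (p : M) (Φ : A.ReebFlow p), f x ∈ Φ.dom ∧ τ ≤ Φ.τ := by
  refine hS.induction_on (p := fun S => ∃ τ > 0, ∀ x ∈ S, ∃ (p : M) (Φ : A.ReebFlow p),
    f x ∈ Φ.dom ∧ τ ≤ Φ.τ) ⟨1, one_pos, by simp⟩ ?_ ?_ ?_
  · rintro s t hst ⟨τ, hτ, h⟩
    exact ⟨τ, hτ, fun x hx => h x (hst hx)⟩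
  · rintro s t ⟨τ, hτ, h⟩ ⟨τ', hτ', h'⟩
    refine ⟨min τ τ', lt_min hτ hτ', ?_⟩
    rintro x (hx | hx)
    · obtain ⟨p, Φ, h1, h2⟩ := h x hx
      exact ⟨p, Φ, h1, (min_le_left _ _).trans h2⟩
    · obtain ⟨p, Φ, h1, h2⟩ := h' x hx
      exact ⟨p, Φ, h1, (min_le_right _ _).trans h2⟩
  · intro x hx
    obtain ⟨Φ⟩ := A.nonempty_reebFlow (f x)
    refine ⟨f ⁻¹' Φ.dom, ?_, Φ.τ, Φ.τ_pos, fun y hy => ⟨f x, Φ, hy, le_rfl⟩⟩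
    exact nhdsWithin_mono _ hSD ((hf x (hSD hx)) (Φ.isOpen_dom.mem_nhds Φ.mem_dom))

section Variation

variable [T2Space M] {ρ : ℝ × ℝ → ℝ} {p : ℝ → ℝ}

lemma verticalVariation_eventuallyEq (hA : A.IsSasakian) {X : Type*} [TopologicalSpace X]
    {a : X → ℝ} {y : X → ℝ × ℝ} {s : Set X} {x : X} {q : M} (Φ : A.ReebFlow q)
    (hf : ContinuousWithinAt (fun z => F (y z)) s x)
    (ha : ContinuousWithinAt (fun z => a z * ρ (y z)) s x)
    (hx : F (y x) ∈ Φ.dom) (hax : a x * ρ (y x) ∈ Ioo (-Φ.τ) Φ.τ) :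
    (fun z => A.verticalVariation F ρ (a z) (y z))
      =ᶠ[𝓝[s] x] fun z => Φ.map (a z * ρ (y z)) (F (y z)) := by
  filter_upwards [hf (Φ.isOpen_dom.mem_nhds hx), ha (isOpen_Ioo.mem_nhds hax)] with z hz hz'
  exact Φ.riemExp_eq hA hz hz'

namespace IsRuledSurface

/-- Near each point `φ_r` is the Reeb flow at time `r ρ`. Condition `hV` serves the immersion
property: it forbids the vertical displacement from cancelling a tangent vector of the surface where
`p ≠ 0`. -/
theorem exists_variation (hA : A.IsSasakian) (h : A.IsRuledSurface I Γ σ F)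
    (hI : UniqueDiffOn ℝ I) (hσ : 0 < σ)
    (hρ : ContDiffOn ℝ 1 ρ (strip I σ))
    (hp : ∀ x ∈ strip I σ, HasFDerivWithinAt ρ (p x.1 • ContinuousLinearMap.fst ℝ ℝ ℝ)
      (strip I σ) x) {K : Set ℝ} (hK : IsCompact K) (hKI : K ⊆ I)
    (hρK : ∀ x ∈ strip I σ, x.1 ∉ K → ρ x = 0)
    (hV : ∀ x ∈ strip I σ, A.reebComponentDeriv F (strip I σ) x ≠ 0 ∨ p x.1 = 0) :
    ∃ r₀ > 0, (∀ r ∈ Ioo (-r₀) r₀, ∀ x ∈ strip I σ,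
        ExpDefined A.g (F x) ((r * ρ x) • A.T (F x))) ∧
      ContMDiffOn 𝓘(ℝ, ℝ × ℝ × ℝ) (𝓡 3) 1
        (fun y : ℝ × ℝ × ℝ => A.verticalVariation F ρ y.1 y.2)
        (Ioo (-r₀) r₀ ×ˢ strip I σ) ∧
      ∀ r ∈ Ioo (-r₀) r₀, ImmersiveOn (A.verticalVariation F ρ r) (strip I σ) ∧
        ∀ x ∈ strip I σ,
          A.norm _ (A.normalH (A.verticalVariation F ρ r) (strip I σ) x)
            * A.areaElement (A.verticalVariation F ρ r) (strip I σ) x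
          = |A.reebComponent F (strip I σ) x + r * p x.1| := by
  have hD : UniqueDiffOn ℝ (strip I σ) := uniqueDiffOn_prod_Icc hI (by linarith)
  have hS : IsCompact (K ×ˢ Icc (-σ) σ) := hK.prod isCompact_Icc
  have hSD : K ×ˢ Icc (-σ) σ ⊆ strip I σ := prod_mono_left hKI
  obtain ⟨τ, hτ, hτΦ⟩ := exists_reebFlow_of_isCompact A h.contMDiffOn.continuousOn hS hSD
  obtain ⟨B, hB⟩ := hS.exists_bound_of_continuousOn (hρ.continuousOn.mono hSD)
  have hB1 : 0 < |B| + 1 := by positivity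
  -- Over `K` the displacement `r ρ` stays below the uniform existence time `τ`; the summand `1`
  -- avoids a division by zero. Outside `K` the displacement is zero.
  have hflow : ∀ r ∈ Ioo (-(τ / (|B| + 1))) (τ / (|B| + 1)), ∀ x ∈ strip I σ,
      ∃ (q : M) (Φ : A.ReebFlow q), F x ∈ Φ.dom ∧ r * ρ x ∈ Ioo (-Φ.τ) Φ.τ := by
    intro r hr x hx
    by_cases hxK : x.1 ∈ K
    · obtain ⟨q, Φ, h1, h2⟩ := hτΦ x ⟨hxK, hx.2⟩
      refine ⟨q, Φ, h1, abs_lt.1 (lt_of_lt_of_le ?_ h2)⟩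
      rw [abs_mul]
      have h3 : |ρ x| ≤ |B| := (hB x ⟨hxK, hx.2⟩).trans (le_abs_self B)
      have h4 := (lt_div_iff₀ hB1).1 (abs_lt.2 hr)
      nlinarith [abs_nonneg r]
    · obtain ⟨Φ⟩ := A.nonempty_reebFlow (F x)
      refine ⟨F x, Φ, Φ.mem_dom, ?_⟩
      rw [hρK x hx hxK, mul_zero]
      exact Φ.zero_mem
  refine ⟨τ / (|B| + 1), by positivity, ?_, ?_, ?_⟩
  · intro r hr x hx
    obtain ⟨q, Φ, h1, h2⟩ := hflow r hr x hx
    exact Φ.expDefined h1 h2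
  · rintro ⟨r, x⟩ ⟨hr, hx⟩
    obtain ⟨q, Φ, h1, h2⟩ := hflow r hr x hx
    have hF : ContMDiffWithinAt 𝓘(ℝ, ℝ × ℝ × ℝ) (𝓡 3) 1 (fun y : ℝ × ℝ × ℝ => F y.2)
        (Ioo (-(τ / (|B| + 1))) (τ / (|B| + 1)) ×ˢ strip I σ) (r, x) :=
      ContMDiffWithinAt.comp (g := F) (f := fun y : ℝ × ℝ × ℝ => y.2) (r, x)
        (h.contMDiffOn x hx) contDiff_snd.contMDiff.contMDiffAt.contMDiffWithinAt
        (fun y hy => hy.2)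
    have ha : ContDiffWithinAt ℝ 1 (fun y : ℝ × ℝ × ℝ => y.1 * ρ y.2)
        (Ioo (-(τ / (|B| + 1))) (τ / (|B| + 1)) ×ˢ strip I σ) (r, x) :=
      contDiffWithinAt_fst.mul (ContDiffWithinAt.comp (g := ρ) (f := fun y : ℝ × ℝ × ℝ => y.2)
        (r, x) (hρ x hx) contDiffWithinAt_snd (fun y hy => hy.2))
    exact (Φ.contMDiffWithinAt_comp hF ha h1 h2).congr_of_eventuallyEq
      (verticalVariation_eventuallyEq hA Φ hF.continuousWithinAt ha.continuousWithinAt h1 h2)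
      (Φ.riemExp_eq hA h1 h2)
  intro r hr
  have hmain : ∀ x ∈ strip I σ, ∀ e : ℝ × ℝ,
      A.η _ (mfderivWithin 𝓘(ℝ, ℝ × ℝ) (𝓡 3) (A.verticalVariation F ρ r) (strip I σ) x e)
        = A.η _ (mfderivWithin 𝓘(ℝ, ℝ × ℝ) (𝓡 3) F (strip I σ) x e) + r * p x.1 * e.1 ∧
      (A.η _ (mfderivWithin 𝓘(ℝ, ℝ × ℝ) (𝓡 3) F (strip I σ) x e) + r * p x.1 * e.1 = 0 →
      A.g.inner _
        (mfderivWithin 𝓘(ℝ, ℝ × ℝ) (𝓡 3) (A.verticalVariation F ρ r) (strip I σ) x e)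
        (mfderivWithin 𝓘(ℝ, ℝ × ℝ) (𝓡 3) (A.verticalVariation F ρ r) (strip I σ) x e)
      = A.g.inner (F x)
        (mfderivWithin 𝓘(ℝ, ℝ × ℝ) (𝓡 3) F (strip I σ) x e + (r * p x.1 * e.1) • A.T (F x))
        (mfderivWithin 𝓘(ℝ, ℝ × ℝ) (𝓡 3) F (strip I σ) x e + (r * p x.1 * e.1) • A.T (F x))) := by
    intro x hx e
    obtain ⟨q, Φ, h1, h2⟩ := hflow r hr x hx
    have hF := h.contMDiffOn.mdifferentiableOn (by simp) x hx
    have ha : HasFDerivWithinAt (fun z => r * ρ z)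
        (r • p x.1 • ContinuousLinearMap.fst ℝ ℝ ℝ) (strip I σ) x := (hp x hx).const_mul r
    have hfd : fderivWithin ℝ (fun z => r * ρ z) (strip I σ) x e = r * p x.1 * e.1 := by
      rw [ha.fderivWithin (hD x hx)]
      simp [mul_assoc]
    have hcong := mfderivWithin_totalSpace_congr_of_eventuallyEq
      (verticalVariation_eventuallyEq (a := fun _ => r) (y := fun z => z) hA Φ
        hF.continuousWithinAt ha.continuousWithinAt h1 h2)
      (Φ.riemExp_eq hA h1 h2) e
    have he := Φ.eta_mfderivWithin_comp hF ha.differentiableWithinAt (hD x hx) h1 h2 e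
    have hi := Φ.inner_mfderivWithin_comp hA hF ha.differentiableWithinAt (hD x hx) h1 h2 e
    rw [hfd] at he hi
    exact ⟨(A.eta_totalSpace_congr hcong).trans he,
      fun h0 => (A.inner_totalSpace_congr hcong).trans (hi h0)⟩
  refine ⟨fun x hx => ?_, fun x hx => ?_⟩
  · set L : ℝ × ℝ →L[ℝ] E3 :=
      mfderivWithin 𝓘(ℝ, ℝ × ℝ) (𝓡 3) (A.verticalVariation F ρ r) (strip I σ) x with hL
    refine (injective_iff_map_eq_zero L).2 fun e he => ?_
    obtain ⟨h1, h2⟩ := hmain x hx e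
    have he' : mfderivWithin 𝓘(ℝ, ℝ × ℝ) (𝓡 3) (A.verticalVariation F ρ r) (strip I σ) x e = 0 :=
      he
    rw [he', map_zero] at h1
    have h3 := h2 h1.symm
    rw [he', map_zero] at h3
    have h4 := A.g.eq_zero_of_inner_self h3.symm
    have hsplit : mfderivWithin 𝓘(ℝ, ℝ × ℝ) (𝓡 3) F (strip I σ) x e
        = e.1 • d₁ F (strip I σ) x + e.2 • d₂ F (strip I σ) x := by
      set L' : ℝ × ℝ →L[ℝ] E3 := mfderivWithin 𝓘(ℝ, ℝ × ℝ) (𝓡 3) F (strip I σ) x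
      have : e = e.1 • ((1, 0) : ℝ × ℝ) + e.2 • ((0, 1) : ℝ × ℝ) := by ext <;> simp
      calc L' e = L' (e.1 • ((1, 0) : ℝ × ℝ) + e.2 • ((0, 1) : ℝ × ℝ)) := by rw [← this]
        _ = e.1 • L' (1, 0) + e.2 • L' (0, 1) := by rw [map_add, map_smul, map_smul]
    by_cases hc : r * p x.1 * e.1 = 0
    · rw [hc, zero_smul, add_zero] at h4
      have h5 := h.immersiveOn x hx (a₁ := e) (a₂ := (0 : ℝ × ℝ))
      refine h5 (h4.trans ?_)
      exact (map_zero (show ℝ × ℝ →L[ℝ] E3 from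
        mfderivWithin 𝓘(ℝ, ℝ × ℝ) (𝓡 3) F (strip I σ) x)).symm
    -- Here `dF(e)` is a nonzero multiple of `T`. Applying `J` and pairing with `d₂` leaves `e.1 *
    -- ⟨J d₁, d₂⟩ = 0` with `e.1 ≠ 0`, against `hV`.
    · exfalso
      have he1 : e.1 ≠ 0 := right_ne_zero_of_mul hc
      have hp0 : p x.1 ≠ 0 := right_ne_zero_of_mul (left_ne_zero_of_mul hc)
      refine ((hV x hx).resolve_right hp0) ?_
      have h5 := congrArg (fun u => A.g.inner (F x) (A.J (F x) u) (d₂ F (strip I σ) x)) h4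
      simp only [hsplit, map_add, map_smul, A.J_T, smul_zero, add_zero, map_zero,
        FunLike.coe_add, FunLike.coe_smul, Pi.add_apply, Pi.smul_apply,
        A.inner_J_self (h.eta_d₂ x hx), smul_eq_mul, FunLike.coe_zero, Pi.zero_apply] at h5
      have h6 : A.g.inner (F x) (A.J (F x) (d₁ F (strip I σ) x)) (d₂ F (strip I σ) x) = 0 := by
        simpa [he1] using h5
      rw [reebComponentDeriv, h6, mul_zero]
  -- The correction term contains the factor `e.1`, which vanishes on the rulings. Their images
  -- therefore remain unit and horizontal, and the formula for the area density applies.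
  · obtain ⟨h1, h2⟩ := hmain x hx (0, 1)
    have h3 : A.η (F x) (mfderivWithin 𝓘(ℝ, ℝ × ℝ) (𝓡 3) F (strip I σ) x (0, 1)) = 0 :=
      h.eta_d₂ x hx
    have h4 := h2 (by rw [h3]; simp)
    simp only [mul_zero, add_zero, zero_smul] at h1 h4
    rw [A.norm_normalH_mul_areaElement (h1.trans h3) (h4.trans (h.inner_d₂ x hx))]
    congr 1
    refine (hmain x hx (1, 0)).1.trans ?_
    simp [reebComponent, d₁]

end IsRuledSurface

end Variation

end ContactSubRiemannian

end SubRiem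

/-! ### Integrals of the sign of a decreasing function. -/

namespace SubRiem

lemma measurable_sign_real : Measurable fun x : ℝ => (SignType.sign x : ℝ) := by
  have : (fun x : ℝ => (SignType.sign x : ℝ)) =
      fun x => if 0 < x then 1 else if x < 0 then -1 else 0 := by
    funext x
    rw [sign_apply]
    split_ifs <;> simp
  rw [this]
  exact Measurable.ite measurableSet_Ioi measurable_const
    (Measurable.ite measurableSet_Iio measurable_const measurable_const)

lemma abs_sign_real_le (x : ℝ) : |(SignType.sign x : ℝ)| ≤ 1 := by
  rcases lt_trichotomy x 0 with h | h | h <;> simp [h]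

section SignIntegral

variable {a : ℝ} {w : ℝ → ℝ}

/-- The integral of the sign of a translate of a decreasing function is twice its root. -/
lemma exists_root_integral_sign (hc : ContinuousOn w (Icc (-a) a)) (h0 : w 0 = 0)
    (hw : ∀ s ∈ Icc (-a) a, ∀ s' ∈ Icc (-a) a, s < s' → s' - s ≤ w s - w s') {c : ℝ}
    (hca : |c| ≤ a) :
    ∃ s ∈ Icc (-a) a, w s = -c ∧ |s| ≤ |c| ∧
      ∫ t in Icc (-a) a, (SignType.sign (w t + c) : ℝ) = 2 * s := by
  have ha : 0 ≤ a := (abs_nonneg c).trans hca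
  have h0m : (0 : ℝ) ∈ Icc (-a) a := by simp [ha]
  obtain ⟨hc1, hc2⟩ := abs_le.1 hca
  -- Slope at most `-1` forces `w a ≤ -a` and `a ≤ w (-a)`, so the level `-c` is attained when `|c|
  -- ≤ a`. The sign is `1` before the root and `-1` after it.
  have h1 : -c ∈ Icc (w a) (w (-a)) := by
    rcases ha.eq_or_lt with rfl | ha'
    · have : c = 0 := by simpa using hca
      simp [this, h0]
    · have e1 := hw 0 h0m a ⟨by linarith, le_rfl⟩ ha'
      have e2 := hw (-a) ⟨le_rfl, by linarith⟩ 0 h0m (by linarith)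
      constructor <;> linarith
  obtain ⟨s, hs, hsc⟩ := intermediate_value_Icc' (by linarith) hc h1
  refine ⟨s, hs, hsc, ?_, ?_⟩
  · rcases lt_trichotomy s 0 with h | h | h
    · have := hw s hs 0 h0m h
      rw [abs_of_neg h]
      linarith [neg_abs_le c]
    · simp [h]
    · have := hw 0 h0m s hs h
      rw [abs_of_pos h]
      linarith [le_abs_self c]
  have hl : ∀ᵐ t, t ∈ uIoc (-a) s → (1 : ℝ) = (SignType.sign (w t + c) : ℝ) := by
    filter_upwards [Measure.ae_ne volume s] with t hts ht
    rw [uIoc_of_le hs.1] at ht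
    have hlt := lt_of_le_of_ne ht.2 hts
    have := hw t ⟨ht.1.le, by linarith [hs.2]⟩ s hs hlt
    rw [sign_pos (by linarith)]
    simp
  have hr : ∀ᵐ t, t ∈ uIoc s a → (-1 : ℝ) = (SignType.sign (w t + c) : ℝ) := by
    refine Eventually.of_forall fun t ht => ?_
    rw [uIoc_of_le hs.2] at ht
    have := hw s hs t ⟨by linarith [hs.1, ht.1], ht.2⟩ ht.1
    rw [sign_neg (by linarith [ht.1])]
    simp
  have hl' : (fun _ => (1 : ℝ)) =ᵐ[volume.restrict (uIoc (-a) s)]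
      fun t => (SignType.sign (w t + c) : ℝ) :=
    (ae_restrict_iff' measurableSet_uIoc).2 hl
  have hr' : (fun _ => (-1 : ℝ)) =ᵐ[volume.restrict (uIoc s a)]
      fun t => (SignType.sign (w t + c) : ℝ) :=
    (ae_restrict_iff' measurableSet_uIoc).2 hr
  rw [integral_Icc_eq_integral_Ioc, ← intervalIntegral.integral_of_le (by linarith),
    ← intervalIntegral.integral_add_adjacent_intervals (b := s)
      (intervalIntegrable_const.congr_ae hl') (intervalIntegrable_const.congr_ae hr'),
    ← intervalIntegral.integral_congr_ae hl, ← intervalIntegral.integral_congr_ae hr]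
  simp
  ring

/-- Valid for every `c`, it supplies the domination needed later. For `|c| ≥ a` the length `2 a` of
the interval is already a bound. -/
lemma abs_integral_sign_le (ha : 0 ≤ a) (hc : ContinuousOn w (Icc (-a) a)) (h0 : w 0 = 0)
    (hw : ∀ s ∈ Icc (-a) a, ∀ s' ∈ Icc (-a) a, s < s' → s' - s ≤ w s - w s') (c : ℝ) :
    |∫ t in Icc (-a) a, (SignType.sign (w t + c) : ℝ)| ≤ 2 * |c| := by
  rcases le_total |c| a with h | h
  · obtain ⟨s, -, -, h1, h2⟩ := exists_root_integral_sign hc h0 hw h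
    rw [h2, abs_mul, abs_two]
    linarith
  · have h1 := norm_setIntegral_le_of_norm_le_const (μ := volume) (s := Icc (-a) a)
      (f := fun t => (SignType.sign (w t + c) : ℝ)) (C := 1) (by simp)
      (fun t _ => abs_sign_real_le _)
    have h2 : volume.real (Icc (-a) a) = 2 * a := by
      rw [Real.volume_real_Icc_of_le (by linarith)]; ring
    rw [h2] at h1
    exact h1.trans (by linarith)

/-- The integral is `2 s` with `w s = -c`. Since `w' 0 = -2`, the quantity `2 s - c = w s - w 0 + 2
s` is `o(s)`, and `|s| ≤ |c|` makes it `o(c)`. -/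
lemma hasDerivAt_integral_sign (ha : 0 < a) (hc : ContinuousOn w (Icc (-a) a)) (h0 : w 0 = 0)
    (hw : ∀ s ∈ Icc (-a) a, ∀ s' ∈ Icc (-a) a, s < s' → s' - s ≤ w s - w s')
    (hd : HasDerivAt w (-2) 0) :
    HasDerivAt (fun c => ∫ t in Icc (-a) a, (SignType.sign (w t + c) : ℝ)) 1 0 := by
  set H : ℝ → ℝ := fun c => ∫ t in Icc (-a) a, (SignType.sign (w t + c) : ℝ) with hH
  have hH0 : H 0 = 0 := by
    have := abs_integral_sign_le ha.le hc h0 hw 0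
    rw [abs_zero, mul_zero] at this
    exact abs_nonpos_iff.1 this
  rw [hasDerivAt_iff_isLittleO_nhds_zero] at hd ⊢
  rw [Asymptotics.isLittleO_iff] at hd ⊢
  intro η hη
  obtain ⟨δ, hδ, hball⟩ := Metric.eventually_nhds_iff.1 (hd hη)
  have hmin : 0 < min δ a := lt_min hδ ha
  filter_upwards [Metric.ball_mem_nhds (0 : ℝ) hmin] with c hcm
  have hcm' : |c| < min δ a := by simpa using hcm
  obtain ⟨s, hs, hsc, hs1, hs2⟩ := exists_root_integral_sign hc h0 hw
    (hcm'.le.trans (min_le_right _ _))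
  have h1 := hball (y := s) (by
    simpa using hs1.trans_lt (hcm'.trans_le (min_le_left _ _)))
  simp only [zero_add, h0, hsc, smul_eq_mul, sub_zero] at h1
  have h2 : H (0 + c) = 2 * s := by rw [zero_add]; exact hs2
  rw [h2, hH0, sub_zero, smul_eq_mul, mul_one]
  have h3 : -c - s * -2 = 2 * s - c := by ring
  rw [h3] at h1
  exact h1.trans (by gcongr; exact hs1)

end SignIntegral

end SubRiem

/-! ### Two differentiations of the integral of `|v + r p|`. -/

namespace SubRiem

section AreaIntegral

variable {I : Set ℝ} {a : ℝ} {C : Set (ℝ × ℝ)} {v : ℝ × ℝ → ℝ} {p : ℝ → ℝ}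

/-- The set where `v + r p` vanishes and `p` does not is negligible. -/
lemma ae_add_mul_ne_zero (hC : IsCompact C) (hCI : C ⊆ I ×ˢ Icc (-a) a)
    (hv : ContinuousOn v C) (hp : ContinuousOn p I)
    (hmono : ∀ᵐ ε, ε ∈ I → p ε ≠ 0 → ∀ s ∈ Icc (-a) a, ∀ s' ∈ Icc (-a) a, s < s' →
      s' - s ≤ v (ε, s) - v (ε, s')) (r : ℝ) :
    ∀ᵐ x ∂(volume.restrict C), p x.1 ≠ 0 → v x + r * p x.1 ≠ 0 := by
  have hpC : ContinuousOn (fun x : ℝ × ℝ => p x.1) C :=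
    hp.comp continuous_fst.continuousOn fun x hx => (hCI hx).1
  classical
  -- Extension by zero outside `C` gives functions measurable on the plane, as Fubini's theorem for
  -- null sets requires.
  set V : ℝ × ℝ → ℝ := C.piecewise v 0 with hV
  set P : ℝ × ℝ → ℝ := C.piecewise (fun x => p x.1) 0 with hP
  have hVx : ∀ x ∈ C, V x = v x := fun x hx => Set.piecewise_eq_of_mem _ _ _ hx
  have hPx : ∀ x ∈ C, P x = p x.1 := fun x hx => Set.piecewise_eq_of_mem _ _ _ hx
  have hPx0 : ∀ x ∉ C, P x = 0 := fun x hx => Set.piecewise_eq_of_notMem _ _ _ hx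
  have hVm : Measurable V := hv.measurable_piecewise continuousOn_const hC.measurableSet
  have hPm : Measurable P := hpC.measurable_piecewise continuousOn_const hC.measurableSet
  set N : Set (ℝ × ℝ) := {x | P x ≠ 0} ∩ {x | V x + r * P x = 0} with hN
  have hNm : MeasurableSet N :=
    ((measurableSet_eq_fun hPm measurable_const).compl).inter
      (measurableSet_eq_fun (hVm.add (hPm.const_mul r)) measurable_const)
  have hN0 : volume N = 0 := by
    rw [Measure.volume_eq_prod, Measure.measure_prod_null hNm]
    filter_upwards [hmono] with ε hε
    have hmem : ∀ s, (ε, s) ∈ N → (ε, s) ∈ C ∧ p ε ≠ 0 ∧ v (ε, s) + r * p ε = 0 := by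
      intro s hs
      by_cases hsC : (ε, s) ∈ C
      · have h1 := hs.1
        have h2 := hs.2
        simp only [mem_ofPred_eq, hPx _ hsC, hVx _ hsC] at h1 h2
        exact ⟨hsC, h1, h2⟩
      · exact absurd (hPx0 _ hsC) hs.1
    -- Strict monotonicity in `s` leaves at most one zero on each ruling.
    have hsub : (Prod.mk ε ⁻¹' N).Subsingleton := by
      intro s hs s' hs'
      obtain ⟨h1, h2, h3⟩ := hmem s hs
      obtain ⟨h1', -, h3'⟩ := hmem s' hs'
      have hinj := hε (hCI h1).1 h2
      rcases lt_trichotomy s s' with h | h | h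
      · have := hinj s (hCI h1).2 s' (hCI h1').2 h
        linarith
      · exact h
      · have := hinj s' (hCI h1').2 s (hCI h1).2 h
        linarith
    exact hsub.measure_zero _
  rw [ae_restrict_iff' hC.measurableSet]
  filter_upwards [measure_eq_zero_iff_ae_notMem.1 hN0] with x hx hxC h1 h2
  refine hx ⟨?_, ?_⟩
  · rw [mem_ofPred_eq, hPx _ hxC]
    exact h1
  · rw [mem_ofPred_eq, hPx _ hxC, hVx _ hxC]
    exact h2

/-- The integrand is Lipschitz in `r` with constant `|p|`. It is differentiable in `r` almost
everywhere, because `v + r p` vanishes only on a null set where `p ≠ 0`; where `p = 0` it does not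
depend on `r`. -/
theorem hasDerivAt_integral_abs (hC : IsCompact C) (hCI : C ⊆ I ×ˢ Icc (-a) a)
    (hv : ContinuousOn v C) (hp : ContinuousOn p I)
    (hmono : ∀ᵐ ε, ε ∈ I → p ε ≠ 0 → ∀ s ∈ Icc (-a) a, ∀ s' ∈ Icc (-a) a, s < s' →
      s' - s ≤ v (ε, s) - v (ε, s')) (r : ℝ) :
    HasDerivAt (fun r => ∫ x in C, |v x + r * p x.1|)
      (∫ x in C, p x.1 * (SignType.sign (v x + r * p x.1) : ℝ)) r := by
  have hpC : ContinuousOn (fun x : ℝ × ℝ => p x.1) C :=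
    hp.comp continuous_fst.continuousOn fun x hx => (hCI hx).1
  have hcont : ∀ r, ContinuousOn (fun x : ℝ × ℝ => v x + r * p x.1) C := fun r =>
    hv.add (continuousOn_const.mul hpC)
  refine (hasDerivAt_integral_of_dominated_loc_of_lip (μ := volume.restrict C)
    (F := fun r x => |v x + r * p x.1|) (bound := fun x => p x.1) (s := univ)
    univ_mem (Eventually.of_forall fun r => ?_) ?_ ?_ ?_ ?_ ?_).2
  · exact (hcont r).abs.aestronglyMeasurable hC.measurableSet
  · exact (hcont r).abs.integrableOn_compact hC
  · refine (hpC.aestronglyMeasurable hC.measurableSet).mul ?_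
    exact (measurable_sign_real.comp_aemeasurable
      ((hcont r).aemeasurable hC.measurableSet)).aestronglyMeasurable
  · refine Eventually.of_forall fun x => ?_
    refine LipschitzOnWith.of_dist_le_mul fun r _ r' _ => ?_
    simp only [Real.dist_eq, Real.coe_nnabs]
    refine (abs_abs_sub_abs_le_abs_sub _ _).trans (le_of_eq ?_)
    rw [← abs_mul]
    congr 1; ring
  · exact hpC.integrableOn_compact hC
  · filter_upwards [ae_add_mul_ne_zero hC hCI hv hp hmono r] with x hx
    by_cases hp0 : p x.1 = 0
    · simp only [hp0, mul_zero, add_zero, zero_mul]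
      exact hasDerivAt_const _ _
    · have h1 : HasDerivAt (fun r => v x + r * p x.1) (p x.1) r := by
        simpa using ((hasDerivAt_id r).mul_const (p x.1)).const_add (v x)
      have h2 := (hasDerivAt_abs (hx hp0)).comp r h1
      rw [mul_comm]
      exact h2

/-- The sign is not differentiable in `r` pointwise, so the integral over the rulings is taken
first. The inner integral is differentiable at `0` with derivative `p ^ 2`, and its increments are
bounded by `2 p ^ 2 |r|`. -/
theorem hasDerivAt_integral_mul_sign (ha : 0 < a) (hI : MeasurableSet I) (hC : IsCompact C)
    (hCI : C ⊆ I ×ˢ Icc (-a) a) (hv : ContinuousOn v (I ×ˢ Icc (-a) a)) (hp : ContinuousOn p I)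
    (hp2 : IntegrableOn (fun ε => p ε ^ 2) I)
    (hgood : ∀ᵐ ε, ε ∈ I → p ε ≠ 0 → (∀ s ∈ Icc (-a) a, (ε, s) ∈ C) ∧ v (ε, 0) = 0 ∧
      (∀ s ∈ Icc (-a) a, ∀ s' ∈ Icc (-a) a, s < s' → s' - s ≤ v (ε, s) - v (ε, s')) ∧
      HasDerivAt (fun s => v (ε, s)) (-2) 0) :
    HasDerivAt (fun r => ∫ x in C, p x.1 * (SignType.sign (v x + r * p x.1) : ℝ))
      (∫ ε in I, p ε ^ 2) 0 := by
  have hpC : ContinuousOn (fun x : ℝ × ℝ => p x.1) C :=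
    hp.comp continuous_fst.continuousOn fun x hx => (hCI hx).1
  have hcont : ∀ r, ContinuousOn (fun x : ℝ × ℝ => v x + r * p x.1) C := fun r =>
    (hv.mono hCI).add (continuousOn_const.mul hpC)
  have hint : ∀ r : ℝ, IntegrableOn
      (fun x : ℝ × ℝ => p x.1 * (SignType.sign (v x + r * p x.1) : ℝ)) C := by
    intro r
    refine (hpC.integrableOn_compact hC).mul_bdd (c := 1) ?_
      (Eventually.of_forall fun x => abs_sign_real_le _)
    exact (measurable_sign_real.comp_aemeasurable
      ((hcont r).aemeasurable hC.measurableSet)).aestronglyMeasurable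
  set G : ℝ → ℝ × ℝ → ℝ := fun r =>
    C.indicator fun x => p x.1 * (SignType.sign (v x + r * p x.1) : ℝ) with hG
  have hGi : ∀ r, Integrable (G r) (volume.prod volume) := fun r => by
    rw [← Measure.volume_eq_prod]
    exact (integrable_indicator_iff hC.measurableSet).2 (hint r)
  set H : ℝ → ℝ → ℝ := fun r ε => ∫ s, G r (ε, s) with hH
  have hfub : (fun r => ∫ x in C, p x.1 * (SignType.sign (v x + r * p x.1) : ℝ))
      = fun r => ∫ ε, H r ε := by
    funext r
    rw [← integral_indicator hC.measurableSet, Measure.volume_eq_prod]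
    exact integral_prod _ (hGi r)
  have hzero : ∀ ε, (ε ∈ I → p ε = 0) → ∀ r, H r ε = 0 := by
    intro ε hε r
    have : ∀ s, G r (ε, s) = 0 := by
      intro s
      by_cases hs : (ε, s) ∈ C
      · rw [hG]
        simp only [indicator_of_mem hs, hε (hCI hs).1, zero_mul]
      · exact indicator_of_notMem hs _
    simp [hH, this]
  have hfull : ∀ ε ∈ I, (∀ s ∈ Icc (-a) a, (ε, s) ∈ C) → ∀ r, H r ε
      = p ε * ∫ s in Icc (-a) a, (SignType.sign (v (ε, s) + r * p ε) : ℝ) := by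
    intro ε hε hs r
    rw [← integral_const_mul, ← integral_indicator measurableSet_Icc]
    refine integral_congr_ae (Eventually.of_forall fun s => ?_)
    by_cases h : s ∈ Icc (-a) a
    · simp only [hG, indicator_of_mem (hs s h), indicator_of_mem h]
    · have : (ε, s) ∉ C := fun h' => h (hCI h').2
      simp only [hG, indicator_of_notMem this, indicator_of_notMem h]
  have hvε : ∀ ε ∈ I, ContinuousOn (fun s => v (ε, s)) (Icc (-a) a) := fun ε hε =>
    hv.comp (by fun_prop) fun s hs => ⟨hε, hs⟩
  have hind : Integrable (I.indicator fun ε => p ε ^ 2) := (integrable_indicator_iff hI).2 hp2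
  rw [hfub, ← integral_indicator hI]
  set L : ℝ →L[ℝ] ℝ →L[ℝ] ℝ := ContinuousLinearMap.smulRightL ℝ ℝ ℝ 1 with hL
  have hLi : Integrable (fun ε => L (I.indicator (fun ε => p ε ^ 2) ε)) := L.integrable_comp hind
  have key := (hasFDerivAt_integral_of_dominated_loc_of_lip' (𝕜 := ℝ) (μ := volume)
    (F := H) (F' := fun ε => L (I.indicator (fun ε => p ε ^ 2) ε))
    (bound := fun ε => 2 * I.indicator (fun ε => p ε ^ 2) ε) (x₀ := (0 : ℝ)) (s := univ)
    univ_mem (fun r _ => ((hGi r).integral_prod_left).aestronglyMeasurable)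
    ((hGi 0).integral_prod_left) hLi.aestronglyMeasurable ?_ (hind.const_mul 2) ?_).2
  · rw [ContinuousLinearMap.integral_comp_comm L hind] at key
    have := key.hasDerivAt
    simpa [hL] using this
  · filter_upwards [hgood] with ε hε r _
    by_cases h : ε ∈ I → p ε = 0
    · rw [hzero ε h, hzero ε h, sub_self, norm_zero]
      exact mul_nonneg (mul_nonneg zero_le_two (indicator_nonneg (fun _ _ => sq_nonneg _) _))
        (norm_nonneg _)
    · push Not at h
      obtain ⟨hεI, hpε⟩ := h
      obtain ⟨h1, h2, h3, -⟩ := hε hεI hpε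
      have hb := fun c => abs_integral_sign_le ha.le (hvε ε hεI) h2 h3 c
      have h00 := hb (0 * p ε)
      rw [zero_mul, abs_zero, mul_zero] at h00
      rw [hfull ε hεI h1, hfull ε hεI h1, zero_mul, abs_nonpos_iff.1 h00, mul_zero, sub_zero,
        indicator_of_mem hεI, sub_zero, norm_mul, Real.norm_eq_abs, Real.norm_eq_abs,
        Real.norm_eq_abs]
      calc |p ε| * _ ≤ |p ε| * (2 * |r * p ε|) := by gcongr; exact hb _
        _ = 2 * p ε ^ 2 * |r| := by rw [abs_mul, ← sq_abs (p ε)]; ring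
  · filter_upwards [hgood] with ε hε
    by_cases h : ε ∈ I → p ε = 0
    · have e1 : (fun r => H r ε) = fun _ => 0 := funext fun r => hzero ε h r
      have e2 : I.indicator (fun ε => p ε ^ 2) ε = 0 := by
        by_cases hεI : ε ∈ I
        · rw [indicator_of_mem hεI, h hεI]; simp
        · exact indicator_of_notMem hεI _
      rw [e1, e2, map_zero]
      exact hasFDerivAt_const _ _
    · push Not at h
      obtain ⟨hεI, hpε⟩ := h
      obtain ⟨h1, h2, h3, h4⟩ := hε hεI hpε
      have hd := hasDerivAt_integral_sign ha (hvε ε hεI) h2 h3 h4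
      have h5 : HasDerivAt (fun r : ℝ => r * p ε) (p ε) 0 := by
        simpa using (hasDerivAt_id (0 : ℝ)).mul_const (p ε)
      have h6 : HasDerivAt (fun r : ℝ =>
          ∫ t in Icc (-a) a, (SignType.sign (v (ε, t) + r * p ε) : ℝ)) (1 * p ε) 0 :=
        HasDerivAt.comp (h₂ := fun c => ∫ t in Icc (-a) a, (SignType.sign (v (ε, t) + c) : ℝ))
          (h := fun r : ℝ => r * p ε) 0 (by simpa using hd) h5
      have h7 := (h6.const_mul (p ε)).hasFDerivAt
      have e1 : (fun r => H r ε) = fun r =>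
        p ε * ∫ t in Icc (-a) a, (SignType.sign (v (ε, t) + r * p ε) : ℝ) :=
        funext fun r => hfull ε hεI h1 r
      rw [e1, indicator_of_mem hεI]
      refine h7.congr_fderiv ?_
      ext
      simp [hL, sq]

end AreaIntegral

end SubRiem

/-! ### Choice of the radius and the second variation. -/

namespace SubRiem

/-- A zero with nonzero derivative is isolated. The lemma is used to show that a set `C` outside of
which `ρ = 0` contains almost every full ruling with `p ≠ 0`. -/
lemma countable_zeros_of_deriv_ne_zero {f f' : ℝ → ℝ} {I : Set ℝ}
    (hf : ∀ x ∈ I, HasDerivWithinAt f (f' x) I x) :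
    {x ∈ I | f x = 0 ∧ f' x ≠ 0}.Countable := by
  set Z : Set ℝ := {x ∈ I | f x = 0 ∧ f' x ≠ 0} with hZ
  refine (countable_setOfPred_isolated_right_within (s := Z)).mono fun x hx => ?_
  refine ⟨hx, ?_⟩
  have h1 : ∀ᶠ z in 𝓝[I \ {x}] x, f z ≠ 0 := (hf x hx.1).eventually_ne hx.2.2
  have h2 : ∀ᶠ z in 𝓝[Z ∩ Ioi x] x, f z ≠ 0 :=
    nhdsWithin_mono x (show Z ∩ Ioi x ⊆ I \ {x} from fun z hz => ⟨hz.1.1, ne_of_gt hz.2⟩) h1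
  refine Filter.empty_mem_iff_bot.1 ?_
  filter_upwards [h2, self_mem_nhdsWithin] with z hz hzZ
  exact hz hzZ.1.2.1

lemma ae_mem_interior_of_ordConnected {I : Set ℝ} (hI : I.OrdConnected) :
    ∀ᵐ ε, ε ∈ I → ε ∈ interior I := by
  have h := hI.convex.addHaar_frontier (volume : Measure ℝ)
  filter_upwards [measure_eq_zero_iff_ae_notMem.1 h] with ε hε hεI
  by_contra hc
  exact hε ⟨subset_closure hεI, hc⟩

/-- A tube argument: the strict inequality spreads from each point of `K` to a box, and finitely
many boxes suffice. -/
lemma exists_radius_lt {V : ℝ × ℝ → ℝ} {I K : Set ℝ} {σ c : ℝ} (hσ : 0 < σ)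
    (hV : ContinuousOn V (strip I σ)) (hK : IsCompact K) (hKI : K ⊆ I)
    (h0 : ∀ ε ∈ K, V (ε, 0) < c) :
    ∃ σ' > 0, σ' ≤ σ ∧ ∀ ε ∈ K, ∀ s ∈ Ioo (-σ') σ', V (ε, s) < c := by
  have key := hK.induction_on (p := fun S => ∃ σ' > 0, σ' ≤ σ ∧
    ∀ ε ∈ S, ε ∈ I → ∀ s ∈ Ioo (-σ') σ', V (ε, s) < c) ⟨σ, hσ, le_rfl, by simp⟩ ?_ ?_ ?_
  · obtain ⟨σ', h1, h2, h3⟩ := key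
    exact ⟨σ', h1, h2, fun ε hε => h3 ε hε (hKI hε)⟩
  · rintro s t hst ⟨σ', h1, h2, h3⟩
    exact ⟨σ', h1, h2, fun ε hε => h3 ε (hst hε)⟩
  · rintro s t ⟨σ₁, h1, h2, h3⟩ ⟨σ₂, h1', h2', h3'⟩
    refine ⟨min σ₁ σ₂, lt_min h1 h1', (min_le_left _ _).trans h2, ?_⟩
    rintro ε (hε | hε) hεI u hu
    · exact h3 ε hε hεI u (Ioo_subset_Ioo (neg_le_neg (min_le_left _ _)) (min_le_left _ _) hu)
    · exact h3' ε hε hεI u (Ioo_subset_Ioo (neg_le_neg (min_le_right _ _)) (min_le_right _ _) hu)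
  · intro ε hε
    have h1 : {y | V y < c} ∈ 𝓝[strip I σ] (ε, 0) :=
      (hV _ ⟨hKI hε, by simp [hσ.le]⟩) (Iio_mem_nhds (h0 ε hε))
    obtain ⟨δ, hδ, hball⟩ := Metric.mem_nhdsWithin_iff.1 h1
    refine ⟨Metric.ball ε δ, mem_nhdsWithin_of_mem_nhds (Metric.ball_mem_nhds ε hδ), min δ σ,
      lt_min hδ hσ, min_le_right _ _, fun ε' hε' hεI s hs => ?_⟩
    have hs' := abs_lt.2 hs
    refine hball ⟨?_, hεI, abs_le.1 (hs'.le.trans (min_le_right _ _))⟩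
    rw [Metric.mem_ball, Prod.dist_eq]
    refine max_lt hε' ?_
    simpa using hs'.trans_le (min_le_left _ _)

variable {M : Type*} [TopologicalSpace M] [ChartedSpace E3 M] [IsManifold (𝓡 3) ∞ M]

namespace ContactSubRiemannian.IsRuledSurface

variable {A : ContactSubRiemannian M} {I : Set ℝ} {Γ : ℝ → M} {σ : ℝ} {F : ℝ × ℝ → M}

theorem second_variation [T2Space M] (hA : A.IsSasakian) (h : A.IsRuledSurface I Γ σ F)
    (hI : I.OrdConnected) (hI' : I.Nontrivial) (hσ : 0 < σ) (hΓ : A.IsUnitHorizontalOn Γ I)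
    {ρ : ℝ × ℝ → ℝ} (hρ : ContDiffOn ℝ 1 ρ (strip I σ))
    (hρd : ∀ x ∈ strip I σ, ρ x = ρ (x.1, 0) ∧ HasFDerivWithinAt ρ
      (derivWithin (fun ε => ρ (ε, 0)) I x.1 • ContinuousLinearMap.fst ℝ ℝ ℝ) (strip I σ) x)
    (hρΓ : ContDiffOn ℝ 1 (fun ε => ρ (ε, 0)) I)
    {K : Set ℝ} (hKI : K ⊆ I) (hK : IsCompact K) (hρK : ∀ ε ∈ I \ K, ρ (ε, 0) = 0)
    (hV : ∀ ε ∈ K, ∀ s ∈ Icc (-σ) σ, A.reebComponentDeriv F (strip I σ) (ε, s) < -1) :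
    (∃ r₀ > 0,
      (∀ r ∈ Ioo (-r₀) r₀, ∀ x ∈ strip I σ,
        ExpDefined A.g (F x) ((r * ρ x) • A.T (F x))) ∧
      ContMDiffOn 𝓘(ℝ, ℝ × ℝ × ℝ) (𝓡 3) 1
        (fun y : ℝ × ℝ × ℝ => A.verticalVariation F ρ y.1 y.2)
        (Ioo (-r₀) r₀ ×ˢ strip I σ) ∧
      ∀ r ∈ Ioo (-r₀) r₀, ImmersiveOn (A.verticalVariation F ρ r) (strip I σ)) ∧
    ∀ C ⊆ strip I σ, IsCompact C → (∀ x ∈ strip I σ \ C, ρ x = 0) →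
      (∀ᶠ r in 𝓝 (0 : ℝ), DifferentiableAt ℝ
        (fun r => A.area (A.verticalVariation F ρ r) (strip I σ) C) r) ∧
      HasDerivAt
        (deriv (fun r => A.area (A.verticalVariation F ρ r) (strip I σ) C))
        (∫ ε in I, (derivWithin (fun ε => ρ (ε, 0)) I ε) ^ 2) 0 := by
  have hIu := uniqueDiffOn_of_ordConnected hI hI'
  have hD : UniqueDiffOn ℝ (strip I σ) := uniqueDiffOn_prod_Icc hIu (by linarith)
  set p : ℝ → ℝ := derivWithin (fun ε => ρ (ε, 0)) I with hp
  have hp0 : ∀ ε ∈ I \ K, p ε = 0 := by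
    intro ε hε
    have hev : (fun ε => ρ (ε, 0)) =ᶠ[𝓝[I] ε] fun _ => 0 := by
      filter_upwards [self_mem_nhdsWithin, mem_nhdsWithin_of_mem_nhds
        (hK.isClosed.isOpen_compl.mem_nhds hε.2)] with z hz hz' using hρK z ⟨hz, hz'⟩
    rw [hp, hev.derivWithin_eq (hρK ε hε)]
    simp
  have hpK : ∀ ε ∈ I, p ε ≠ 0 → ε ∈ K := fun ε hε h0 => by
    by_contra hc
    exact h0 (hp0 ε ⟨hε, hc⟩)
  have hpc : ContinuousOn p I := hρΓ.continuousOn_derivWithin hIu (by simp)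
  obtain ⟨r₀, hr₀, hexp, hC1, himm⟩ := h.exists_variation hA hIu hσ hρ
    (fun x hx => (hρd x hx).2) hK hKI
    (fun x hx hxK => by rw [(hρd x hx).1, hρK x.1 ⟨hx.1, hxK⟩])
    (fun x hx => by
      by_cases hxK : x.1 ∈ K
      · exact Or.inl ((hV x.1 hxK x.2 hx.2).trans (by norm_num)).ne
      · exact Or.inr (hp0 x.1 ⟨hx.1, hxK⟩))
  refine ⟨⟨r₀, hr₀, hexp, hC1, fun r hr => (himm r hr).1⟩, ?_⟩
  intro C hCD hC hρC
  set v := A.reebComponent F (strip I σ) with hv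
  have hvc : ContinuousOn v (strip I σ) := continuousOn_reebComponent h.contMDiffOn hD
  have harea : ∀ r ∈ Ioo (-r₀) r₀, A.area (A.verticalVariation F ρ r) (strip I σ) C
      = ∫ x in C, |v x + r * p x.1| := fun r hr =>
    setIntegral_congr_fun hC.measurableSet fun x hx => (himm r hr).2 x (hCD hx)
  have hgood : ∀ᵐ ε, ε ∈ I → p ε ≠ 0 → (∀ s ∈ Icc (-σ) σ, (ε, s) ∈ C) ∧ v (ε, 0) = 0 ∧
      (∀ s ∈ Icc (-σ) σ, ∀ s' ∈ Icc (-σ) σ, s < s' → s' - s ≤ v (ε, s) - v (ε, s')) ∧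
      HasDerivAt (fun s => v (ε, s)) (-2) 0 := by
    have hZ := countable_zeros_of_deriv_ne_zero (f := fun ε => ρ (ε, 0)) (f' := p) (I := I)
      fun x hx => ((hρΓ x hx).differentiableWithinAt (by simp)).hasDerivWithinAt
    filter_upwards [ae_mem_interior_of_ordConnected hI, hZ.ae_notMem volume] with ε hεi hεZ hε hpε
    refine ⟨fun s hs => ?_, h.reebComponent_zero hΓ hε, ?_, ?_⟩
    -- A point of the ruling outside `C` would give `ρ_Γ ε = 0` with `p ε ≠ 0`, and such `ε` form a
    -- countable set.
    · by_contra hc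
      refine hεZ ⟨hε, ?_, hpε⟩
      rw [← (hρd (ε, s) ⟨hε, hs⟩).1]
      exact hρC _ ⟨⟨hε, hs⟩, hc⟩
    · intro s hs s' hs' hss
      have hder : ∀ u ∈ Ioo (-σ) σ, HasDerivAt (fun s => v (ε, s)) _ u := fun u hu =>
        h.hasDerivAt_reebComponent hIu hσ (hεi hε) hu
      have := (convex_Icc (-σ) σ).image_sub_le_mul_sub_of_deriv_le (f := fun s => v (ε, s))
        (C := -1) (hvc.comp (by fun_prop) fun s hs => ⟨hε, hs⟩)
        (fun u hu => by
          rw [interior_Icc] at hu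
          exact (hder u hu).differentiableAt.differentiableWithinAt)
        (fun u hu => by
          rw [interior_Icc] at hu
          rw [(hder u hu).deriv]
          exact (hV ε (hpK ε hε hpε) u (Ioo_subset_Icc_self hu)).le) s hs s' hs' hss.le
      linarith
    · have := h.hasDerivAt_reebComponent hIu hσ (hεi hε) (s := 0) ⟨by linarith, hσ⟩
      rwa [h.reebComponentDeriv_zero hΓ hε] at this
  have hd := fun r => hasDerivAt_integral_abs hC hCD (hvc.mono hCD) hpc
    (hgood.mono fun ε hε h1 h2 => (hε h1 h2).2.2.1) r
  have hp2 : IntegrableOn (fun ε => p ε ^ 2) I :=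
    (((hpc.mono hKI).pow 2).integrableOn_compact hK).of_forall_sdiff_eq_zero hI.measurableSet
      fun ε hε => by rw [Pi.pow_apply, hp0 ε hε]; simp
  have hdd := hasDerivAt_integral_mul_sign hσ hI.measurableSet hC hCD hvc hpc hp2 hgood
  have hev : ∀ r ∈ Ioo (-r₀) r₀,
      (fun r => A.area (A.verticalVariation F ρ r) (strip I σ) C)
        =ᶠ[𝓝 r] fun r => ∫ x in C, |v x + r * p x.1| := fun r hr => by
    filter_upwards [isOpen_Ioo.mem_nhds hr] with r' hr' using harea r' hr'
  have h0 : Ioo (-r₀) r₀ ∈ 𝓝 (0 : ℝ) := Ioo_mem_nhds (by linarith) hr₀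
  constructor
  · filter_upwards [h0] with r hr
    exact (hd r).differentiableAt.congr_of_eventuallyEq (hev r hr)
  · refine hdd.congr_of_eventuallyEq ?_
    filter_upwards [h0] with r hr
    rw [(hev r hr).deriv_eq, (hd r).deriv]

end ContactSubRiemannian.IsRuledSurface

end SubRiem

/-! ### The one-sided extensions of the field `S` to `Γ`. -/

namespace SubRiem

variable {M : Type*} [TopologicalSpace M] [ChartedSpace E3 M] [IsManifold (𝓡 3) ∞ M]

/-- The components in the chart at `f x₀` are the fiber coordinates of the trivialization there. -/
lemma continuousWithinAt_tangentBundle {X : Type*} [TopologicalSpace X] {f : X → M}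
    {ξ : (x : X) → TangentSpace (𝓡 3) (f x)} {s : Set X} {x₀ : X}
    (hf : ContinuousWithinAt f s x₀)
    (hξ : ContinuousWithinAt (fun x => (chartFwd (f x₀) (f x) (ξ x) : E3)) s x₀) :
    ContinuousWithinAt (fun x => (⟨f x, ξ x⟩ : TangentBundle (𝓡 3) M)) s x₀ := by
  rw [FiberBundle.continuousWithinAt_totalSpace]
  have key : ∀ x, f x ∈ (ch (f x₀)).source →
      ((trivializationAt E3 (TangentSpace (𝓡 3)) (f x₀)) ⟨f x, ξ x⟩).2
        = chartFwd (f x₀) (f x) (ξ x) := by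
    intro x hx
    have hx' : f x ∈ (chartAt E3 (f x₀)).source := by simpa using hx
    rw [chartFwd, ← TangentBundle.continuousLinearMapAt_trivializationAt hx']
    exact (Bundle.Trivialization.continuousLinearMapAt_apply_of_mem ℝ
      (trivializationAt E3 (TangentSpace (𝓡 3)) (f x₀)) (by simpa using hx') (ξ x)).symm
  refine ⟨hf, hξ.congr_of_eventuallyEq ?_ ?_⟩
  · filter_upwards [hf ((isOpen_ch_source (f x₀)).mem_nhds (mem_extChartAt_source _))] with x hx
    exact key x hx
  · exact key x₀ (mem_extChartAt_source _)

namespace ContactSubRiemannian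

variable {A : ContactSubRiemannian M}

section Surface

variable {f : ℝ × ℝ → M} {D : Set (ℝ × ℝ)} {x : ℝ × ℝ}

/-- The field `S` of a surface ruled by horizontal curves parameterized by arc-length, in terms
of the coordinate fields. -/
lemma fieldS_eq (hw : A.η (f x) (d₂ f D x) = 0)
    (hw1 : A.g.inner (f x) (d₂ f D x) (d₂ f D x) = 1) (hv : A.η (f x) (d₁ f D x) ≠ 0) :
    A.fieldS f D x = ((A.norm (f x) (A.cross (f x) (d₁ f D x) (d₂ f D x)))⁻¹ *
        (|A.η (f x) (d₁ f D x)|⁻¹ * A.η (f x) (d₁ f D x))) •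
          (A.g.inner (f x) (d₁ f D x) (d₂ f D x) • d₂ f D x
            + A.η (f x) (d₁ f D x) • A.T (f x) - d₁ f D x)
      - ((A.norm (f x) (A.cross (f x) (d₁ f D x) (d₂ f D x)))⁻¹ * |A.η (f x) (d₁ f D x)|) •
        A.T (f x) := by
  have h1 := A.eq_of_unit_horizontal hw hw1 (d₁ f D x)
  have h2 := A.inner_J_of_unit_horizontal hw hw1 (d₁ f D x)
  rw [fieldS, A.gaussH_eq hw hw1 hv, A.inner_normal_T hw, A.norm_normalH hw hw1, h2]
  -- The vector `J(d₂)` is eliminated through the orthonormal decomposition of `d₁`, so that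
  -- continuity can be checked on `d₁`, `d₂` and `T` alone.
  have h3 : A.g.inner (f x) (d₁ f D x) (A.J (f x) (d₂ f D x)) • A.J (f x) (d₂ f D x)
      = d₁ f D x - A.g.inner (f x) (d₁ f D x) (d₂ f D x) • d₂ f D x
        - A.η (f x) (d₁ f D x) • A.T (f x) := by
    rw [eq_sub_iff_add_eq, eq_sub_iff_add_eq]
    refine Eq.trans ?_ h1.symm
    abel
  rw [smul_smul, mul_assoc, neg_mul, mul_neg, mul_comm (A.g.inner (f x) _ _), ← mul_assoc,
    neg_smul, ← smul_smul _ (A.g.inner (f x) _ _), h3]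
  module

end Surface

namespace IsRuledSurface

variable {I : Set ℝ} {Γ : ℝ → M} {σ : ℝ} {F : ℝ × ℝ → M}

/-- The sign of `⟨∂F/∂ε, T⟩` on the two sides of `Γ`. -/
lemma mul_reebComponent_neg (h : A.IsRuledSurface I Γ σ F) (hI : I.OrdConnected)
    (hI' : I.Nontrivial) (hσ : 0 < σ) (hΓ : A.IsUnitHorizontalOn Γ I) {x : ℝ × ℝ}
    (hx : x ∈ strip I σ) (hx0 : x.2 ≠ 0) : x.2 * A.reebComponent F (strip I σ) x < 0 := by
  have hIu := uniqueDiffOn_of_ordConnected hI hI'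
  set v := A.reebComponent F (strip I σ) with hv
  have hvc : ContinuousOn v (strip I σ) :=
    continuousOn_reebComponent h.contMDiffOn (uniqueDiffOn_prod_Icc hIu (by linarith))
  obtain ⟨a, ha, b, hb, hab⟩ := hI'.exists_lt
  set ε := (a + b) / 2 with hε
  have hεi : ε ∈ interior I := by
    refine mem_interior.2 ⟨Ioo a b, Ioo_subset_Icc_self.trans (hI.out ha hb), isOpen_Ioo, ?_⟩
    constructor <;> linarith
  have hεI := interior_subset hεi
  have hd := h.hasDerivAt_reebComponent hIu hσ hεi (s := 0) ⟨by linarith, hσ⟩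
  rw [h.reebComponentDeriv_zero hΓ hεI] at hd
  -- On one interior ruling the sign of `v` near `Γ` is read off from `∂v/∂s = -2`. It then spreads
  -- over the whole side, which is connected and on which `v` has no zeros.
  have hslope : ∀ᶠ s in 𝓝[≠] (0 : ℝ), s * v (ε, s) < 0 := by
    filter_upwards [hd.tendsto_slope (Iio_mem_nhds (show (-2 : ℝ) < 0 by norm_num)),
      self_mem_nhdsWithin] with s hs hs0
    rw [mem_preimage, slope_def_field, h.reebComponent_zero hΓ hεI, sub_zero, sub_zero,
      mem_Iio, div_neg_iff] at hs
    rcases hs with ⟨h1, h2⟩ | ⟨h1, h2⟩ <;> nlinarith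
  have key : ∀ T : Set ℝ, IsPreconnected T → (∀ s ∈ T, s ∈ Icc (-σ) σ ∧ s ≠ 0) →
      ∀ s ∈ T, v (ε, s) < 0 → ∀ y ∈ I ×ˢ T, v y < 0 := by
    intro T hT hTσ s hs hvs y hy
    have hsub : I ×ˢ T ⊆ strip I σ := prod_mono_right fun s hs => (hTσ s hs).1
    by_contra hc
    obtain ⟨z, hz, hz0⟩ := (hI.isPreconnected.prod hT).intermediate_value
      (show (ε, s) ∈ I ×ˢ T from ⟨hεI, hs⟩) hy (hvc.mono hsub) ⟨hvs.le, not_lt.1 hc⟩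
    exact h.eta_d₁_ne z (hsub hz) (hTσ z.2 hz.2).2 hz0
  have key' : ∀ T : Set ℝ, IsPreconnected T → (∀ s ∈ T, s ∈ Icc (-σ) σ ∧ s ≠ 0) →
      ∀ s ∈ T, 0 < v (ε, s) → ∀ y ∈ I ×ˢ T, 0 < v y := by
    intro T hT hTσ s hs hvs y hy
    have hsub : I ×ˢ T ⊆ strip I σ := prod_mono_right fun s hs => (hTσ s hs).1
    by_contra hc
    obtain ⟨z, hz, hz0⟩ := (hI.isPreconnected.prod hT).intermediate_value hy
      (show (ε, s) ∈ I ×ˢ T from ⟨hεI, hs⟩) (hvc.mono hsub) ⟨not_lt.1 hc, hvs.le⟩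
    exact h.eta_d₁_ne z (hsub hz) (hTσ z.2 hz.2).2 hz0
  rcases lt_or_gt_of_ne hx0 with hneg | hpos
  · have hmem : Ico (-σ) 0 ∈ 𝓝[<] (0 : ℝ) := Ico_mem_nhdsLT (by linarith)
    have hlt : 𝓝[<] (0 : ℝ) ≤ 𝓝[≠] 0 := nhdsWithin_mono _ fun y hy => ne_of_lt hy
    obtain ⟨s, hs, hsT⟩ := ((hslope.filter_mono hlt).and hmem).exists
    have := key' (Ico (-σ) 0) isPreconnected_Ico
      (fun s hs => ⟨⟨hs.1, hs.2.le.trans hσ.le⟩, hs.2.ne⟩) s hsT (by nlinarith [hsT.2]) x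
      ⟨hx.1, hx.2.1, hneg⟩
    nlinarith
  · have hmem : Ioc 0 σ ∈ 𝓝[>] (0 : ℝ) := Ioc_mem_nhdsGT hσ
    have hgt : 𝓝[>] (0 : ℝ) ≤ 𝓝[≠] 0 := nhdsWithin_mono _ fun y hy => ne_of_gt hy
    obtain ⟨s, hs, hsT⟩ := ((hslope.filter_mono hgt).and hmem).exists
    have := key (Ioc 0 σ) isPreconnected_Ioc
      (fun s hs => ⟨⟨by linarith [hs.1], hs.2⟩, hs.1.ne'⟩) s hsT (by nlinarith [hsT.1]) x
      ⟨hx.1, hpos, hx.2.2⟩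
    nlinarith

/-- The field `S` extends continuously to `Γ` from each of its two sides. -/
theorem tendsto_fieldS (h : A.IsRuledSurface I Γ σ F) (hI : I.OrdConnected)
    (hI' : I.Nontrivial) (hσ : 0 < σ) (hΓ : A.IsUnitHorizontalOn Γ I) {δ : ℝ}
    (hδ : δ = 1 ∨ δ = -1) {ε : ℝ} (hε : ε ∈ I) :
    Tendsto (fun x => (⟨F x, A.fieldS F (strip I σ) x⟩ : TangentBundle (𝓡 3) M))
      (𝓝[{x | x ∈ strip I σ ∧ 0 < δ * x.2}] (ε, 0))
      (𝓝 ⟨F (ε, 0), δ • d₁ F (strip I σ) (ε, 0)⟩) := by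
  have hIu := uniqueDiffOn_of_ordConnected hI hI'
  have hD : UniqueDiffOn ℝ (strip I σ) := uniqueDiffOn_prod_Icc hIu (by linarith)
  set D := strip I σ with hDdef
  have hx₀ : ((ε, 0) : ℝ × ℝ) ∈ D := ⟨hε, by simp [hσ.le]⟩
  have hv0 : A.η (F (ε, 0)) (d₁ F D (ε, 0)) = 0 := h.reebComponent_zero hΓ hε
  have hV0 : A.g.inner (F (ε, 0)) (A.J _ (d₁ F D (ε, 0))) (d₂ F D (ε, 0)) = 1 := by
    have := h.reebComponentDeriv_zero hΓ hε
    rw [reebComponentDeriv] at this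
    linarith
  have hnorm : ∀ x ∈ D, A.norm (F x) (A.cross (F x) (d₁ F D x) (d₂ F D x))
      = Real.sqrt ((-(1 / 2) * A.reebComponentDeriv F D x) ^ 2 + A.reebComponent F D x ^ 2) := by
    intro x hx
    rw [A.norm_cross (h.eta_d₂ x hx) (h.inner_d₂ x hx), reebComponentDeriv, reebComponent]
    congr 2; ring
  have hnorm0 : A.norm (F (ε, 0)) (A.cross (F (ε, 0)) (d₁ F D (ε, 0)) (d₂ F D (ε, 0))) = 1 := by
    rw [A.norm_cross (h.eta_d₂ _ hx₀) (h.inner_d₂ _ hx₀), hV0, hv0]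
    simp
  have hg0 : A.g.inner (F (ε, 0)) (d₁ F D (ε, 0)) (d₂ F D (ε, 0)) = 0 := by
    have h1 := A.inner_self_of_unit_horizontal (h.eta_d₂ _ hx₀) (h.inner_d₂ _ hx₀)
      (d₁ F D (ε, 0))
    rw [hV0, hv0] at h1
    have h2 : A.g.inner (F (ε, 0)) (d₁ F D (ε, 0)) (d₁ F D (ε, 0)) = 1 :=
      (A.inner_totalSpace_congr (h.d₁_zero ε hε)).trans
        (A.inner_self_of_norm_eq_one (hΓ ε hε).2)
    rw [h2] at h1
    nlinarith
  -- This is `S` with the sign of `η(d₁)` replaced by its constant value `-δ` on the chosen side.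
  -- Unlike `S`, it is continuous up to `Γ`, where the length of the cross product is `1` and both
  -- `⟨d₁, d₂⟩` and `η(d₁)` vanish.
  set Ψ : (x : ℝ × ℝ) → TangentSpace (𝓡 3) (F x) := fun x =>
    ((A.norm (F x) (A.cross (F x) (d₁ F D x) (d₂ F D x)))⁻¹ * (-δ)) •
        (A.g.inner (F x) (d₁ F D x) (d₂ F D x) • d₂ F D x
          + A.η (F x) (d₁ F D x) • A.T (F x) - d₁ F D x)
      - ((A.norm (F x) (A.cross (F x) (d₁ F D x) (d₂ F D x)))⁻¹ * |A.η (F x) (d₁ F D x)|) •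
        A.T (F x) with hΨ
  have hΨ0 : Ψ (ε, 0) = δ • d₁ F D (ε, 0) := by
    rw [hΨ]
    simp only [hnorm0, hg0, hv0]
    simp
  have hval : ∀ x ∈ {x | x ∈ D ∧ 0 < δ * x.2}, A.fieldS F D x = Ψ x := by
    rintro x ⟨hx, hx0⟩
    have hx2 : x.2 ≠ 0 := right_ne_zero_of_mul hx0.ne'
    have hne := h.eta_d₁_ne x hx hx2
    have hneg := h.mul_reebComponent_neg hI hI' hσ hΓ hx hx2
    rw [reebComponent] at hneg
    rw [A.fieldS_eq (h.eta_d₂ x hx) (h.inner_d₂ x hx) hne, hΨ]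
    have hsign : |A.η (F x) (d₁ F D x)|⁻¹ * A.η (F x) (d₁ F D x) = -δ := by
      rcases hδ with rfl | rfl
      · have h1 : A.η (F x) (d₁ F D x) < 0 := by
          by_contra hc
          have := mul_nonneg (by linarith : (0 : ℝ) ≤ x.2) (not_lt.1 hc)
          linarith
        rw [abs_of_neg h1, inv_neg, neg_mul, inv_mul_cancel₀ h1.ne]
      · have h1 : 0 < A.η (F x) (d₁ F D x) := by
          by_contra hc
          have := mul_nonneg_of_nonpos_of_nonpos (by linarith : x.2 ≤ (0 : ℝ)) (not_lt.1 hc)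
          linarith
        rw [abs_of_pos h1, inv_mul_cancel₀ h1.ne', neg_neg]
    simp only [← hDdef, hsign]
  have hsx : F (ε, 0) ∈ (ch (F (ε, 0))).source := mem_extChartAt_source _
  have hFc : ContinuousWithinAt F D (ε, 0) := h.contMDiffOn.continuousOn _ hx₀
  have hc0 := (contDiffWithinAt_ch_comp (n := 1) (F (ε, 0)) (h.contMDiffOn _ hx₀)
    hsx).continuousWithinAt
  have hc1 := (contDiffWithinAt_chartFwd_mfderivWithin (n := 0) (F (ε, 0)) h.contMDiffOn hD hx₀ hsx
    (1, 0)).continuousWithinAt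
  have hc2 := (contDiffWithinAt_chartFwd_mfderivWithin (n := 0) (F (ε, 0)) h.contMDiffOn hD hx₀ hsx
    (0, 1)).continuousWithinAt
  have hcv := continuousOn_reebComponent (A := A) h.contMDiffOn hD _ hx₀
  have hcV := continuousOn_reebComponentDeriv (A := A) h.contMDiffOn hD _ hx₀
  have hcN : ContinuousWithinAt
      (fun x => A.norm (F x) (A.cross (F x) (d₁ F D x) (d₂ F D x))) D (ε, 0) :=
    ((((hcV.const_mul (-(1 / 2))).pow 2).add (hcv.pow 2)).sqrt).congr (fun x hx => hnorm x hx)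
      (hnorm _ hx₀)
  have hcNi := hcN.inv₀ (by rw [hnorm0]; norm_num)
  have hsrc := hFc ((isOpen_ch_source (F (ε, 0))).mem_nhds hsx)
  have hcT : ContinuousWithinAt (fun x => (chartFwd (F (ε, 0)) (F x) (A.T (F x)) : E3)) D
      (ε, 0) := by
    have h1 : ContinuousAt (A.reebC (F (ε, 0))) (ch (F (ε, 0)) (F (ε, 0))) :=
      (A.hasFDerivAt_reebC _ ((ch (F (ε, 0))).map_source hsx)).continuousAt
    refine (ContinuousAt.comp_continuousWithinAt (g := A.reebC (F (ε, 0)))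
      (f := ch (F (ε, 0)) ∘ F) h1 hc0).congr_of_eventuallyEq ?_ (A.chartFwd_T _ hsx)
    filter_upwards [hsrc] with x hx using A.chartFwd_T _ hx
  have hcg : ContinuousWithinAt (fun x => A.g.inner (F x) (d₁ F D x) (d₂ F D x)) D (ε, 0) := by
    have h1 : ContinuousAt (metricC A.g (F (ε, 0))) (ch (F (ε, 0)) (F (ε, 0))) :=
      (contDiffOn_metricC A.g (F (ε, 0))).continuousOn.continuousAt
        ((isOpen_ch_target _).mem_nhds ((ch (F (ε, 0))).map_source hsx))
    refine (((ContinuousAt.comp_continuousWithinAt (g := metricC A.g (F (ε, 0)))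
      (f := ch (F (ε, 0)) ∘ F) h1 hc0).clm_apply hc1).clm_apply hc2).congr_of_eventuallyEq ?_
      (inner_eq_metricC A.g _ hsx _ _)
    filter_upwards [hsrc] with x hx using inner_eq_metricC A.g _ hx _ _
  have hcΨ : ContinuousWithinAt (fun x => (⟨F x, Ψ x⟩ : TangentBundle (𝓡 3) M)) D (ε, 0) := by
    refine continuousWithinAt_tangentBundle hFc ?_
    have hmain := ((hcNi.mul (continuousWithinAt_const (b := -δ))).smul
      (((hcg.smul hc2).add (hcv.smul hcT)).sub hc1)).sub ((hcNi.mul hcv.abs).smul hcT)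
    refine hmain.congr (fun x _ => ?_) ?_
    · simp only [hΨ, map_sub, map_add, map_smul]
      rfl
    · simp only [hΨ, map_sub, map_add, map_smul]
      rfl
  have hlim := (hcΨ.mono (fun x hx => hx.1 : {x | x ∈ D ∧ 0 < δ * x.2} ⊆ D)).tendsto
  rw [hΨ0] at hlim
  refine hlim.congr' ?_
  filter_upwards [self_mem_nhdsWithin] with x hx
  rw [hval x hx]

end IsRuledSurface

end ContactSubRiemannian

end SubRiem

end

theorem proposition4p4 {M : Type*} [TopologicalSpace M] [T2Space M] [ConnectedSpace M]
    [ChartedSpace E3 M] [IsManifold (𝓡 3) ∞ M]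
    (A : ContactSubRiemannian M) (hA : A.IsSasakian)
    -- the horizontal curve
    (I : Set ℝ) (hI : I.OrdConnected) (hI' : I.Nontrivial)
    (Γ : ℝ → M) (hΓ : ContMDiffOn 𝓘(ℝ, ℝ) (𝓡 3) 3 Γ I) (hΓh : A.IsUnitHorizontalOn Γ I)
    -- the neighborhood
    (lam σ : ℝ) (F : ℝ × ℝ → M) (hF : A.IsNeighborhood I Γ lam σ F)
    -- the function on the surface
    (ρ : ℝ × ℝ → ℝ)
    (hρ : ContDiffOn ℝ 1 ρ (strip I σ))
    (hZ : ∀ x ∈ strip I σ, x.2 ≠ 0 →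
      surfaceDeriv F (strip I σ) ρ x
        (A.fieldZ F (strip I σ) x) = 0)
    (hρΓ : ContDiffOn ℝ 2 (fun ε => ρ (ε, 0)) I)
    (hsupp : ∃ K ⊆ I, IsCompact K ∧ ∀ ε ∈ I \ K, ρ (ε, 0) = 0) :
    -- the second derivative of the area, for all small radii `σ₀`
    (∃ σ' > 0, σ' ≤ σ ∧ ∀ σ₀ : ℝ, 0 < σ₀ → σ₀ < σ' →
      -- for small `r` the variation is well defined, of class `C^1` and by immersions
      (∃ r₀ > 0,
        (∀ r ∈ Ioo (-r₀) r₀, ∀ x ∈ strip I σ₀,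
          ExpDefined A.g (F x) ((r * ρ x) • A.T (F x))) ∧
        ContMDiffOn 𝓘(ℝ, ℝ × ℝ × ℝ) (𝓡 3) 1
          (fun y : ℝ × ℝ × ℝ => A.verticalVariation F ρ y.1 y.2)
          (Ioo (-r₀) r₀ ×ˢ strip I σ₀) ∧
        ∀ r ∈ Ioo (-r₀) r₀,
          ImmersiveOn (A.verticalVariation F ρ r)
            (strip I σ₀)) ∧
      -- the area is computed in any compact set `C` containing the support of `ρ`
      ∀ C ⊆ strip I σ₀, IsCompact C →
        (∀ x ∈ strip I σ₀ \ C, ρ x = 0) →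
        (∀ᶠ r in 𝓝 (0 : ℝ), DifferentiableAt ℝ
          (fun r => A.area (A.verticalVariation F ρ r)
            (strip I σ₀) C) r) ∧
        HasDerivAt
          (deriv (fun r => A.area (A.verticalVariation F ρ r)
            (strip I σ₀) C))
          (∫ ε in I, (derivWithin (fun ε => ρ (ε, 0)) I ε) ^ 2) 0) ∧
    -- the same value in terms of the extension of `S` to `Γ` from any of the two sides
    ∀ δ : ℝ, δ = 1 ∨ δ = -1 →
      ∃ S : (ε : ℝ) → TangentSpace (𝓡 3) (F (ε, 0)),
        (∀ ε ∈ I, Tendsto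
          (fun x => (⟨F x, A.fieldS F (strip I σ) x⟩ :
            TangentBundle (𝓡 3) M))
          (𝓝[{x | x ∈ strip I σ ∧ 0 < δ * x.2}] (ε, 0))
          (𝓝 ⟨F (ε, 0), S ε⟩)) ∧
        ∫ ε in I, (derivWithin (fun ε => ρ (ε, 0)) I ε) ^ 2
          = ∫ ε in I, (surfaceDeriv F
              (strip I σ) ρ (ε, 0) (S ε)) ^ 2
                * A.norm (Γ ε) (velocity Γ I ε) := by
  have hIu := uniqueDiffOn_of_ordConnected hI hI'
  have hσ : 0 < σ := hF.1
  have h := hF.isRuledSurface hIu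
  have hρd := h.hasFDerivWithinAt_of_fieldZ hIu hσ hρ hZ
  obtain ⟨K, hKI, hK, hρK⟩ := hsupp
  have hD : UniqueDiffOn ℝ (strip I σ) := uniqueDiffOn_prod_Icc hIu (by linarith)
  refine ⟨?_, fun δ hδ => ⟨fun ε => δ • d₁ F (strip I σ) (ε, 0),
    fun ε hε => h.tendsto_fieldS hI hI' hσ hΓh hδ hε, ?_⟩⟩
  -- On `Γ` the derivative `∂v/∂s` is `-2`, so it stays below `-1` near the compact set `K`. A
  -- radius `σ₀ < σ'` keeps the closed strip inside the open one where this holds.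
  · obtain ⟨σ', hσ', hσσ, hV⟩ := exists_radius_lt (c := -1) hσ
      (ContactSubRiemannian.continuousOn_reebComponentDeriv (A := A) h.contMDiffOn hD) hK hKI
      (fun ε hε => by rw [h.reebComponentDeriv_zero hΓh (hKI hε)]; norm_num)
    refine ⟨σ', hσ', hσσ, fun σ₀ h0 h1 => ?_⟩
    have hle : σ₀ ≤ σ := h1.le.trans hσσ
    have hsub : strip I σ₀ ⊆ strip I σ := prod_mono_right (Icc_subset_Icc (by linarith) hle)
    refine (h.mono hIu hσ h0 hle).second_variation hA hI hI' h0 hΓh (hρ.mono hsub)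
      (fun x hx => ⟨(hρd x (hsub hx)).1, (hρd x (hsub hx)).2.mono hsub⟩)
      (hρΓ.of_le (by norm_num)) hKI hK hρK (fun ε hε s hs => ?_)
    have hx : ((ε, s) : ℝ × ℝ) ∈ strip I σ₀ := ⟨hKI hε, hs⟩
    have := hV ε hε s ⟨by linarith [hs.1], by linarith [hs.2]⟩
    rw [ContactSubRiemannian.reebComponentDeriv, d₁, d₂] at this ⊢
    rwa [h.mfderivWithin_mono hIu hσ h0 hle hx]
  · refine setIntegral_congr_fun hI.measurableSet fun ε hε => ?_
    have hx : ((ε, 0) : ℝ × ℝ) ∈ strip I σ := ⟨hε, by simp [hσ.le]⟩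
    -- The extension of `S` is the image of `δ • (1, 0)`, so `S(ρ) = δ ρ_Γ'`; then `δ ^ 2 = 1`, and
    -- the length element is `dε` because `Γ` has unit speed.
    have h1 := surfaceDeriv_mfderivWithin h.immersiveOn hx ρ (δ • (1, 0))
    have hL : mfderivWithin 𝓘(ℝ, ℝ × ℝ) (𝓡 3) F (strip I σ) (ε, 0) (δ • ((1, 0) : ℝ × ℝ))
        = δ • d₁ F (strip I σ) (ε, 0) :=
      ContinuousLinearMap.map_smul (show ℝ × ℝ →L[ℝ] E3 from
        mfderivWithin 𝓘(ℝ, ℝ × ℝ) (𝓡 3) F (strip I σ) (ε, 0)) δ (1, 0)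
    rw [hL, (hρd _ hx).2.fderivWithin (hD _ hx)] at h1
    have hδ2 : δ ^ 2 = 1 := by rcases hδ with rfl | rfl <;> norm_num
    simp only [h1, (hΓh ε hε).2]
    simp [mul_pow, hδ2]
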